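/- Let $\mathbb K=\mathbb R$ or $\mathbb C$, and let $\mathbb K^{2n}$ carry coordinates $(p_1,\dots,p_n,q_1,\dots,q_n)$, the symplectic form $\sum_i dp_i\wedge dq_i$, the sheaf $\mathcal O$ of $\mathbb K$-analytic functions and the Poisson bracket $\{f,g\}=\sum_i(\partial_{p_i}f\,\partial_{q_i}g-\partial_{q_i}f\,\partial_{p_i}g)$. A lagrangian germ $(L,0)\subset(\mathbb K^{2n},0)$ is represented by a closed analytic subspace $L$ of an open neighbourhood of $0$, given by an ideal sheaf $\mathcal I\subset\mathcal O$ of finite type, which is involutive ($\{\mathcal I,\mathcal I\}\subset\mathcal I$), reduced ($\mathcal I$ consists of all analytic functions vanishing on $L$) and of dimension $n$ at $0$. Let $\mathcal O_L=\mathcal O/\mathcal I$, let $$\mathcal C^p_L=\mathcal Hom_{\mathcal O_L}\bigl(\textstyle\bigwedge^p(\mathcal I/\mathcal I^2),\mathcal O_L\bigr),$$ and let $\delta:\mathcal C^p_L\to\mathcal C^{p+1}_L$ be given by $$(\delta\phi)(h_1\wedge\dots\wedge h_{p+1})=\sum_{i}(-1)^i\{h_i,\phi(\cdots\widehat{h_i}\cdots)\}+\sum_{i<j}(-1)^{i+j-1}\phi(\{h_i,h_j\}\wedge\cdots\widehat{h_i}\cdots\widehat{h_j}\cdots).$$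 This is a complex $\mathcal C^\bullet_L$ of sheaves of $\mathbb K$-vector spaces on $L$. Let $(L,0)\subset(\mathbb K^{2n},0)$ and $(L',0)\subset(\mathbb K^{2n-2},0)$, $n\ge1$, be lagrangian germs with $(L,0)=(L',0)\times(\mathbb K,0)$ in suitable symplectic coordinates; that is, there is a germ $\Phi$ of an analytic symplectic change of coordinates of $(\mathbb K^{2n},0)$ such that the ideal sheaf $\mathcal I$ of $L$ is, near $0$, generated by $p_1\circ\Phi$ and by the functions $f\circ\pi$ with $f$ in the ideal sheaf $\mathcal I'$ of $L'$, where $\pi$ is $\Phi$ followed by the projection $\mathbb K^{2n}\to\mathbb K^{2n-2}$ that forgets $(p_1,q_1)$. Then on every sufficiently small open neighbourhood of $0$ the map $\pi$ restricts to a continuous map $\pi:L\to L'$, and there is a morphism of complexes of sheaves $$j:\pi^{-1}\mathcal C^\bullet_{L'}\to\mathcal C^\bullet_L,$$ the natural inclusion, which sends a local section $\phi$ of $\mathcal C^p_{L'}$ to the section $j(\phi)$ of $\mathcal C^p_L$ with $j(\phi)(\pi^*f_1\wedge\dots\wedge\pi^*f_p)=\pi^*(\phi(f_1\wedge\dots\wedge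 f_p))$ for $f_1,\dots,f_p\in\mathcal I'$ and $j(\phi)(h_1\wedge\dots\wedge h_p)=0$ if some $h_i$ equals $p_1\circ\Phi$. The morphism $j$ is a quasi-isomorphism, and for all $i$ there are isomorphisms of sheaves $$\pi^{-1}\mathcal H^i(\mathcal C^\bullet_{L'})\cong\mathcal H^i(\mathcal C^\bullet_L).$$ -/

import Mathlib

open CategoryTheory TopologicalSpace Opposite Filter Topology
universe u
namespace LieRinehartAlgebra
section
variable {A M : Type*} [CommRing A] [LieRing M] [LieRingModule M A]

/-- The value of the differential of the standard complex on `h₀, …, h_p`: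
`∑ᵢ (-1)^(i+1) ⁅hᵢ, φ(h₀, …, ĥᵢ, …, h_p)⁆ + ∑_{i<j} (-1)^i φ(h₀, …, ĥᵢ, …, ⁅hᵢ, hⱼ⁆, …, h_p)`,
where in the second sum `⁅hᵢ, hⱼ⁆` stands in the place of `hⱼ`. Moving it to the front turns the
sign into `(-1)^(i+j+1)`, see `delta_apply_succ`. (The indices start at `0`.) -/
def deltaFun {p : ℕ} (φ : (Fin p → M) → A) (h : Fin (p + 1) → M) : A :=
  ∑ i : Fin (p + 1), (-1) ^ ((i : ℕ) + 1) * ⁅h i, φ (i.removeNth h)⁆ +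
    ∑ i : Fin (p + 1), ∑ j ∈ Finset.Ioi i,
      (-1) ^ (i : ℕ) * φ (i.removeNth (Function.update h j ⁅h i, h j⁆))

/-- The Lie derivative of a cochain along `x`. -/
def lieFun {p : ℕ} (x : M) (φ : (Fin p → M) → A) (v : Fin p → M) : A :=
  ⁅x, φ v⁆ - ∑ j, φ (Function.update v j ⁅x, v j⁆)

lemma deltaFun_cons {p : ℕ} (φ : (Fin (p+1) → M) → A) (x : M) (v : Fin (p + 1) → M) :
    deltaFun φ (Fin.cons x v : Fin (p + 2) → M) =
      - lieFun x φ v - deltaFun (fun w => φ (Fin.cons x w : Fin (p+1) → M)) v := by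
  unfold deltaFun lieFun
  rw [Fin.sum_univ_succ, Fin.sum_univ_succ (n := p+1)]
  have h1 : ∀ (i : Fin (p+1)) (w : Fin (p+2) → M), i.succ.removeNth w = Fin.cons (w 0) (i.removeNth (Fin.tail w)) := by
    intro i w
    ext k
    refine Fin.cases ?_ (fun k => ?_) k
    · simp [Fin.removeNth]
    · simp [Fin.removeNth, Fin.tail]
  have h2 : ∀ (f : Fin (p+2) → A), ∑ j ∈ Finset.Ioi 0, f j = ∑ j : Fin (p+1), f j.succ := by
    intro f
    rw [Fin.Ioi_zero_eq_map, Finset.sum_map]; rfl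
  have h3 : ∀ (i : Fin (p+1)) (f : Fin (p+2) → A), ∑ j ∈ Finset.Ioi i.succ, f j = ∑ j ∈ Finset.Ioi i, f j.succ := by
    intro i f
    rw [← Fin.map_succEmb_Ioi, Finset.sum_map]; rfl
  have h4 : ∀ w : Fin (p+2) → M, Fin.removeNth 0 w = Fin.tail w := fun w => by
    simp [Fin.removeNth_zero]
  simp only [h1, h2, h3, h4, Fin.cons_zero, Fin.cons_succ, Fin.tail_cons,
    ← Fin.cons_update, Fin.val_zero, Fin.val_succ, pow_succ, pow_zero]
  simp only [Finset.sum_neg_distrib, mul_neg, neg_mul, mul_one, one_mul]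
  abel
lemma deltaFun_zero (φ : (Fin 0 → M) → A) (h : Fin 1 → M) :
    deltaFun φ h = - ⁅h 0, φ 0⁆ := by
  have : (0 : Fin 1).removeNth h = 0 := Subsingleton.elim _ _
  simp [deltaFun, this]

lemma deltaFun_add {p : ℕ} (φ ψ : (Fin p → M) → A) :
    deltaFun (fun v => φ v + ψ v) = fun h => deltaFun φ h + deltaFun ψ h := by
  funext h
  simp only [deltaFun, lie_add, mul_add, Finset.sum_add_distrib]
  abel

end

section
variable {A M : Type*} [CommRing A] [LieRing M] [Module A M] [LieRingModule M A]
  [LieRinehartRing A M]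

lemma deltaFun_smul {p : ℕ} (a : A) (φ : (Fin p → M) → A) (h : Fin (p + 1) → M) :
    deltaFun (fun v => a * φ v) h =
      a * deltaFun φ h - ∑ i : Fin (p + 1), (-1) ^ (i : ℕ) * (⁅h i, a⁆ * φ (i.removeNth h)) := by
  simp only [deltaFun, LieRinehartRing.leibniz_mul_right, mul_add, Finset.sum_add_distrib,
    Finset.mul_sum, smul_eq_mul, pow_succ, mul_neg, neg_mul, mul_one, Finset.sum_neg_distrib,
    mul_left_comm a]
  ring

/-- The Lie derivative of an alternating form along `x`. -/
def lieDeriv {p : ℕ} (x : M) (φ : M [⋀^Fin p]→ₗ[A] A) : M [⋀^Fin p]→ₗ[A] A where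
  toFun := lieFun x φ
  map_update_add' := by
    intro _ v i a b
    have e : ‹DecidableEq (Fin p)› = instDecidableEqFin p := Subsingleton.elim _ _
    subst e
    have key : ∀ j, φ (Function.update (Function.update v i (a + b)) j
        ⁅x, Function.update v i (a + b) j⁆) =
        φ (Function.update (Function.update v i a) j ⁅x, Function.update v i a j⁆) +
        φ (Function.update (Function.update v i b) j ⁅x, Function.update v i b j⁆) := by
      intro j
      by_cases hj : j = i
      · subst hj; simp
      · simp [Function.update_of_ne hj, Function.update_comm (Ne.symm hj)]
    simp only [lieFun, key, Finset.sum_add_distrib, AlternatingMap.map_update_add, lie_add]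
    abel
  map_update_smul' := by
    intro _ v i c a
    have e : ‹DecidableEq (Fin p)› = instDecidableEqFin p := Subsingleton.elim _ _
    subst e
    have key : ∀ j, φ (Function.update (Function.update v i (c • a)) j
        ⁅x, Function.update v i (c • a) j⁆) =
        c * φ (Function.update (Function.update v i a) j ⁅x, Function.update v i a j⁆) +
        if j = i then ⁅x, c⁆ * φ (Function.update v i a) else 0 := by
      intro j
      by_cases hj : j = i
      · subst hj; simp
      · simp [Function.update_comm (Ne.symm hj), hj]
    simp only [lieFun, key, Finset.sum_add_distrib, AlternatingMap.map_update_smul, smul_eq_mul,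
      LieRinehartRing.leibniz_mul_right, Finset.sum_ite_eq', Finset.mem_univ, if_true,
      ← Finset.mul_sum]
    ring
  map_eq_zero_of_eq' := by
    intro v i j hij hne
    have h0 : φ v = 0 := φ.map_eq_zero_of_eq v hij hne
    have hk : ∑ k, φ (Function.update v k ⁅x, v k⁆) =
        φ (Function.update v i ⁅x, v i⁆) + φ (Function.update v j ⁅x, v j⁆) := by
      refine Fintype.sum_eq_add _ _ hne fun k hk => ?_
      refine φ.map_eq_zero_of_eq _ ?_ hne
      rw [Function.update_of_ne hk.1.symm, Function.update_of_ne hk.2.symm, hij]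
    have hs : φ (Function.update v j ⁅x, v j⁆) = - φ (Function.update v i ⁅x, v i⁆) := by
      rw [← φ.map_swap _ hne]
      congr 1
      ext k
      by_cases hki : k = i
      · subst hki; simp [Function.update_of_ne hne, Function.update_of_ne hne.symm, hij]
      · by_cases hkj : k = j
        · subst hkj; simp [hij]
        · simp [Equiv.swap_apply_of_ne_of_ne hki hkj, hki, hkj]
    simp only [lieFun, h0, hk, hs, lie_zero]
    abel

lemma lieDeriv_apply {p : ℕ} (x : M) (φ : M [⋀^Fin p]→ₗ[A] A) (v : Fin p → M) :
    lieDeriv x φ v = ⁅x, φ v⁆ - ∑ j, φ (Function.update v j ⁅x, v j⁆) := rfl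

lemma deltaFun_cons' {p : ℕ} (φ : M [⋀^Fin (p + 1)]→ₗ[A] A) (x : M) (v : Fin (p + 1) → M) :
    deltaFun φ (Fin.cons x v : Fin (p + 2) → M) =
      - lieDeriv x φ v - deltaFun (φ.curryLeft x) v :=
  deltaFun_cons φ x v

lemma deltaFun_alternating : ∀ (p : ℕ) (φ : M [⋀^Fin p]→ₗ[A] A),
    (∀ (h : Fin (p + 1) → M) (i : Fin (p + 1)) (x y : M),
      deltaFun φ (Function.update h i (x + y)) =
        deltaFun φ (Function.update h i x) + deltaFun φ (Function.update h i y)) ∧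
    (∀ (h : Fin (p + 1) → M) (i : Fin (p + 1)) (c : A) (x : M),
      deltaFun φ (Function.update h i (c • x)) = c * deltaFun φ (Function.update h i x)) ∧
    (∀ (h : Fin (p + 1) → M) (i j : Fin (p + 1)), h i = h j → i ≠ j → deltaFun φ h = 0) := by
  intro p
  induction p with
  | zero =>
    intro φ
    refine ⟨fun h i x y => ?_, fun h i c x => ?_, fun h i j _ hne => ?_⟩
    · obtain rfl : i = 0 := Fin.fin_one_eq_zero i
      simp [deltaFun_zero, add_comm]
    · obtain rfl : i = 0 := Fin.fin_one_eq_zero i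
      simp [deltaFun_zero]
    · exact absurd ((Fin.fin_one_eq_zero i).trans (Fin.fin_one_eq_zero j).symm) hne
  | succ p ih =>
    intro φ
    have hadd : ∀ (h : Fin (p + 2) → M) (i : Fin (p + 2)) (x y : M),
      deltaFun φ (Function.update h i (x + y)) =
        deltaFun φ (Function.update h i x) + deltaFun φ (Function.update h i y) := by
      intro h i x y
      induction h using Fin.consCases with | cons z v => ?_
      induction i using Fin.cases with
      | zero =>
        have := deltaFun_add (φ.curryLeft x) (φ.curryLeft y)
        have h2 : (⇑(φ.curryLeft (x + y))) = fun v => φ.curryLeft x v + φ.curryLeft y v := by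
          ext; simp
        simp only [Fin.update_cons_zero, deltaFun_cons', h2, this, lieDeriv_apply, add_lie,
          AlternatingMap.map_update_add, Finset.sum_add_distrib]
        abel
      | succ i =>
        simp only [← Fin.cons_update, deltaFun_cons', (ih _).1, AlternatingMap.map_update_add]
        abel
    have hsmul : ∀ (h : Fin (p + 2) → M) (i : Fin (p + 2)) (c : A) (x : M),
      deltaFun φ (Function.update h i (c • x)) = c * deltaFun φ (Function.update h i x) := by
      intro h i c x
      induction h using Fin.consCases with | cons z v => ?_
      induction i using Fin.cases with
      | zero =>
        have h2 : (⇑(φ.curryLeft (c • x))) = fun v => c * φ.curryLeft x v := by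
          ext; simp
        have h3 : ∀ j, φ (Function.update v j ⁅c • x, v j⁆) =
            c * φ (Function.update v j ⁅x, v j⁆) -
              (-1) ^ (j : ℕ) * (⁅v j, c⁆ * φ.curryLeft x (j.removeNth v)) := by
          intro j
          have h4 : ⁅c • x, v j⁆ = c • ⁅x, v j⁆ + (- ⁅v j, c⁆) • x := by
            rw [← lie_skew, LieRinehartRing.leibniz_smul_right, neg_add, ← smul_neg, lie_skew,
              neg_smul]
          have h5 : Function.update v j x = j.insertNth x (j.removeNth v) := by
            rw [Fin.insertNth_removeNth]
          have h6 := AlternatingMap.map_insertNth φ j x (j.removeNth v)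
          rw [h4, AlternatingMap.map_update_add, AlternatingMap.map_update_smul,
            AlternatingMap.map_update_smul, h5, h6]
          simp [Int.cast_pow, zsmul_eq_mul]
          ring
        simp only [Fin.update_cons_zero, deltaFun_cons', h2, deltaFun_smul, lieDeriv_apply, h3,
          LieRinehartRing.lie_smul_eq_mul, Finset.sum_sub_distrib, ← Finset.mul_sum]
        ring
      | succ i =>
        simp only [← Fin.cons_update, deltaFun_cons', (ih _).2.1, AlternatingMap.map_update_smul,
          smul_eq_mul]
        ring
    have htail : ∀ (x : M) (v : Fin (p + 1) → M) (i j : Fin (p + 1)), v i = v j → i ≠ j →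
        deltaFun φ (Fin.cons x v : Fin (p + 2) → M) = 0 := by
      intro x v i j hij hne
      rw [deltaFun_cons', (ih _).2.2 v i j hij hne, (lieDeriv x φ).map_eq_zero_of_eq v hij hne]
      simp
    have h01 : ∀ (x : M) (w : Fin p → M),
        deltaFun φ (Fin.cons x (Fin.cons x w : Fin (p + 1) → M) : Fin (p + 2) → M) = 0 := by
      intro x w
      have hx : lieDeriv x φ (Fin.cons x w : Fin (p + 1) → M) = lieDeriv x (φ.curryLeft x) w := by
        simp only [lieDeriv_apply, Fin.sum_univ_succ, Fin.cons_zero, Fin.cons_succ, lie_self,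
          Fin.update_cons_zero, ← Fin.cons_update]
        have : φ (Fin.cons 0 w : Fin (p + 1) → M) = 0 := φ.map_coord_zero 0 rfl
        rw [this, zero_add]
        rfl
      rw [deltaFun_cons', hx]
      cases p with
      | zero =>
        have hw : w = 0 := Subsingleton.elim _ _
        simp [deltaFun_zero, lieDeriv_apply, hw]
      | succ q =>
        rw [deltaFun_cons']
        have : (φ.curryLeft x).curryLeft x = 0 := by ext; simp
        simp only [this]
        simp [deltaFun]
    have hzero : ∀ (h : Fin (p + 2) → M) (j : Fin (p + 1)), h 0 = h j.succ → deltaFun φ h = 0 := by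
      intro h j hj
      induction h using Fin.consCases with | cons x v => ?_
      simp only [Fin.cons_zero, Fin.cons_succ] at hj
      let ψ : M [⋀^Fin (p + 1)]→ₗ[A] A :=
        { toFun := fun v => deltaFun φ (Fin.cons x v : Fin (p + 2) → M)
          map_update_add' := by
            intro _ v i a b
            have e : ‹DecidableEq (Fin (p + 1))› = instDecidableEqFin (p + 1) :=
              Subsingleton.elim _ _
            subst e
            simp only [Fin.cons_update, hadd]
          map_update_smul' := by
            intro _ v i a b
            have e : ‹DecidableEq (Fin (p + 1))› = instDecidableEqFin (p + 1) :=
              Subsingleton.elim _ _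
            subst e
            simp only [Fin.cons_update, hsmul, smul_eq_mul]
          map_eq_zero_of_eq' := fun v i j h1 h2 => htail x v i j h1 h2 }
      change ψ v = 0
      by_cases hj0 : j = 0
      · subst hj0
        have := h01 x (Fin.tail v)
        rw [hj] at this
        rw [Fin.cons_self_tail, ← hj] at this
        exact this
      · have h1 := ψ.map_swap v hj0
        have h2 : ψ (v ∘ Equiv.swap j 0) = 0 := by
          have := h01 x (Fin.tail (v ∘ Equiv.swap j 0))
          have h3 : (v ∘ Equiv.swap j 0) 0 = x := by
            rw [Function.comp_apply, Equiv.swap_apply_right, hj]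
          nth_rewrite 2 [← h3] at this
          rw [Fin.cons_self_tail] at this
          exact this
        rw [h2] at h1
        exact neg_eq_zero.mp h1.symm
    refine ⟨hadd, hsmul, fun h i j hij hne => ?_⟩
    induction i using Fin.cases with
    | zero =>
      induction j using Fin.cases with
      | zero => exact absurd rfl hne
      | succ j => exact hzero h j hij
    | succ i =>
      induction j using Fin.cases with
      | zero => exact hzero h i hij.symm
      | succ j =>
        rw [← Fin.cons_self_tail h]
        exact htail _ _ i j hij (fun e => hne (e ▸ rfl))

end

lemma ext_curryLeft {A M : Type*} [CommRing A] [AddCommGroup M] [Module A M] {p : ℕ} {φ ψ : M [⋀^Fin (p + 1)]→ₗ[A] A}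
    (h : ∀ x, φ.curryLeft x = ψ.curryLeft x) : φ = ψ := by
  ext v
  have := congrArg (fun χ => χ (Fin.tail v)) (h (v 0))
  simpa [Matrix.vecCons] using this

section
variable (R : Type*) {A M : Type*} [CommRing R] [CommRing A] [LieRing M] [Module A M]
  [LieRingModule M A] [LieRinehartRing A M] [Algebra R A] [LieAlgebra R M]
  [LieRinehartAlgebra R A M]

/-- The differential `δ : Hom_A(Λ^p M, A) → Hom_A(Λ^(p+1) M, A)` of the standard complex of a
Lie-Rinehart algebra `M` over `A`. -/
def delta (p : ℕ) : (M [⋀^Fin p]→ₗ[A] A) →ₗ[R] (M [⋀^Fin (p + 1)]→ₗ[A] A) where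
  toFun φ :=
    { toFun := deltaFun φ
      map_update_add' := by
        intro _ v i a b
        have e : ‹DecidableEq (Fin (p + 1))› = instDecidableEqFin (p + 1) := Subsingleton.elim _ _
        subst e
        exact (deltaFun_alternating p φ).1 v i a b
      map_update_smul' := by
        intro _ v i a b
        have e : ‹DecidableEq (Fin (p + 1))› = instDecidableEqFin (p + 1) := Subsingleton.elim _ _
        subst e
        exact (deltaFun_alternating p φ).2.1 v i a b
      map_eq_zero_of_eq' := fun v i j h1 h2 => (deltaFun_alternating p φ).2.2 v i j h1 h2 }
  map_add' φ ψ := by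
    ext h
    exact congrFun (deltaFun_add φ ψ) h
  map_smul' r φ := by
    ext h
    change deltaFun _ h = r • deltaFun φ h
    simp only [deltaFun, AlternatingMap.smul_apply, lie_smul, Finset.smul_sum, smul_add,
      mul_smul_comm]

variable {R}

lemma delta_apply (p : ℕ) (φ : M [⋀^Fin p]→ₗ[A] A) (h : Fin (p + 1) → M) :
    delta R p φ h = deltaFun φ h := rfl

lemma delta_cons {p : ℕ} (φ : M [⋀^Fin (p + 1)]→ₗ[A] A) (x : M) (v : Fin (p + 1) → M) :
    delta R (p + 1) φ (Fin.cons x v : Fin (p + 2) → M) =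
      - lieDeriv x φ v - delta R p (φ.curryLeft x) v :=
  deltaFun_cons φ x v

/-- The usual formula for the differential:
`∑ᵢ (-1)^(i+1) ⁅hᵢ, φ(…, ĥᵢ, …)⁆ + ∑_{i<j} (-1)^(i+j+1) φ(⁅hᵢ, hⱼ⁆, …, ĥᵢ, …, ĥⱼ, …)`
(indices start at `0`; the pairs `i < j` are written as `i < i.succAbove j`). -/
lemma delta_apply_succ (p : ℕ) (φ : M [⋀^Fin (p + 1)]→ₗ[A] A) (h : Fin (p + 2) → M) :
    delta R (p + 1) φ h =
      ∑ i : Fin (p + 2), (-1) ^ ((i : ℕ) + 1) * ⁅h i, φ (i.removeNth h)⁆ +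
      ∑ i : Fin (p + 2), ∑ j : Fin (p + 1), if i < i.succAbove j then
        (-1) ^ ((i : ℕ) + (i.succAbove j : ℕ) + 1) *
          φ (Fin.cons ⁅h i, h (i.succAbove j)⁆ (j.removeNth (i.removeNth h)))
        else 0 := by
  rw [delta_apply, deltaFun]
  congr 1
  refine Finset.sum_congr rfl fun i _ => ?_
  have h1 : ∀ f : Fin (p + 2) → A, ∑ j ∈ Finset.Ioi i, f j =
      ∑ j : Fin (p + 1), if i < i.succAbove j then f (i.succAbove j) else 0 := by
    intro f
    have : Finset.Ioi i = Finset.univ.filter (fun j => i < j) := by ext; simp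
    rw [this, Finset.sum_filter, Fin.sum_univ_succAbove _ i]
    simp
  rw [h1]
  refine Finset.sum_congr rfl fun j _ => ?_
  split_ifs with hij
  · have h2 : i.removeNth (Function.update h (i.succAbove j) ⁅h i, h (i.succAbove j)⁆) =
        j.insertNth ⁅h i, h (i.succAbove j)⁆ (j.removeNth (i.removeNth h)) := by
      rw [Fin.insertNth_removeNth]
      ext k
      by_cases hk : k = j
      · subst hk; simp [Fin.removeNth]
      · simp [Fin.removeNth, Function.update_of_ne hk, Function.update_of_ne
          (fun e => hk (Fin.succAbove_right_injective e))]
    have h3 : (i.succAbove j : ℕ) = j + 1 := by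
      have := Fin.succAbove_of_le_castSucc i j (by
        by_contra hlt
        rw [Fin.succAbove_of_castSucc_lt i j (not_le.mp hlt)] at hij
        exact hlt hij.le)
      rw [this, Fin.val_succ]
    rw [h2, AlternatingMap.map_insertNth, h3, Matrix.vecCons]
    simp only [zsmul_eq_mul, Int.cast_pow, Int.cast_neg, Int.cast_one, pow_add, pow_one]
    ring
  · rfl

lemma lieDeriv_cons {p : ℕ} (φ : M [⋀^Fin (p + 1)]→ₗ[A] A) (x y : M) (v : Fin p → M) :
    lieDeriv x φ (Fin.cons y v : Fin (p + 1) → M) =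
      lieDeriv x (φ.curryLeft y) v - φ.curryLeft ⁅x, y⁆ v := by
  simp only [lieDeriv_apply, Fin.sum_univ_succ, Fin.cons_zero, Fin.cons_succ,
    Fin.update_cons_zero, ← Fin.cons_update, AlternatingMap.curryLeft_apply_apply, Matrix.vecCons]
  abel

lemma curryLeft_lieDeriv {p : ℕ} (φ : M [⋀^Fin (p + 1)]→ₗ[A] A) (x y : M) :
    (lieDeriv x φ).curryLeft y = lieDeriv x (φ.curryLeft y) - φ.curryLeft ⁅x, y⁆ := by
  ext v
  exact lieDeriv_cons φ x y v

lemma curryLeft_delta {p : ℕ} (φ : M [⋀^Fin (p + 1)]→ₗ[A] A) (x : M) :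
    (delta R (p + 1) φ).curryLeft x = - lieDeriv x φ - delta R p (φ.curryLeft x) := by
  ext v
  exact delta_cons φ x v

lemma curryLeft_delta_zero (φ : M [⋀^Fin 0]→ₗ[A] A) (x : M) :
    (delta R 0 φ).curryLeft x = - lieDeriv x φ := by
  ext v
  obtain rfl : v = 0 := Subsingleton.elim _ _
  simp [delta_apply, deltaFun_zero, lieDeriv_apply]

lemma lieDeriv_add {p : ℕ} (x : M) (φ ψ : M [⋀^Fin p]→ₗ[A] A) :
    lieDeriv x (φ + ψ) = lieDeriv x φ + lieDeriv x ψ := by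
  ext v
  simp only [lieDeriv_apply, AlternatingMap.add_apply, lie_add, Finset.sum_add_distrib]
  abel

lemma lieDeriv_neg {p : ℕ} (x : M) (φ : M [⋀^Fin p]→ₗ[A] A) :
    lieDeriv x (-φ) = - lieDeriv x φ := by
  ext v
  simp only [lieDeriv_apply, AlternatingMap.neg_apply, lie_neg, Finset.sum_neg_distrib]
  abel

lemma lieDeriv_sub {p : ℕ} (x : M) (φ ψ : M [⋀^Fin p]→ₗ[A] A) :
    lieDeriv x (φ - ψ) = lieDeriv x φ - lieDeriv x ψ := by
  rw [sub_eq_add_neg, lieDeriv_add, lieDeriv_neg, sub_eq_add_neg]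

lemma lieDeriv_lie {p : ℕ} (x y : M) (φ : M [⋀^Fin p]→ₗ[A] A) :
    lieDeriv ⁅x, y⁆ φ = lieDeriv x (lieDeriv y φ) - lieDeriv y (lieDeriv x φ) := by
  induction p with
  | zero => ext v; simp [lieDeriv_apply]
  | succ p ih =>
    refine ext_curryLeft fun z => ?_
    have hs : (lieDeriv x (lieDeriv y φ) - lieDeriv y (lieDeriv x φ)).curryLeft z =
      (lieDeriv x (lieDeriv y φ)).curryLeft z - (lieDeriv y (lieDeriv x φ)).curryLeft z := rfl
    rw [hs]
    simp only [curryLeft_lieDeriv, lieDeriv_sub, ih, lie_lie, map_sub]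
    abel

lemma lieDeriv_delta {p : ℕ} (x : M) (φ : M [⋀^Fin p]→ₗ[A] A) :
    lieDeriv x (delta R p φ) = delta R p (lieDeriv x φ) := by
  induction p with
  | zero =>
    refine ext_curryLeft fun y => ?_
    simp only [curryLeft_lieDeriv, curryLeft_delta_zero, lieDeriv_neg, lieDeriv_lie]
    abel
  | succ p ih =>
    refine ext_curryLeft fun y => ?_
    simp only [curryLeft_lieDeriv, curryLeft_delta, lieDeriv_neg, lieDeriv_sub, lieDeriv_lie, ih,
      map_sub]
    abel

theorem delta_delta {p : ℕ} (φ : M [⋀^Fin p]→ₗ[A] A) :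
    delta R (p + 1) (delta R p φ) = 0 := by
  induction p with
  | zero =>
    refine ext_curryLeft fun y => ?_
    simp [curryLeft_delta, curryLeft_delta_zero, lieDeriv_delta]
  | succ p ih =>
    refine ext_curryLeft fun y => ?_
    simp [curryLeft_delta, lieDeriv_delta, ih]

end
end LieRinehartAlgebra

noncomputable section

section Germs
variable {𝕜 : Type u} [RCLike 𝕜] {E : Type u} [NormedAddCommGroup E] [NormedSpace 𝕜 E]
/-- Germs of `𝕜`-valued functions form a `𝕜`-algebra. -/
instance germAlgebra (l : Filter E) : Algebra 𝕜 (Germ l 𝕜) where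
  algebraMap :=
    { toFun := fun c => ((fun _ => c : E → 𝕜) : Germ l 𝕜)
      map_one' := rfl
      map_mul' := fun _ _ => rfl
      map_zero' := rfl
      map_add' := fun _ _ => rfl }
  commutes' _ _ := mul_comm _ _
  smul_def' c a := by
    induction a using Germ.inductionOn with | h f => ?_
    rfl

variable (𝕜) in
/-- The germs at `x` of functions that are analytic at `x`. -/
def analyticSubalgebra (x : E) : Subalgebra 𝕜 (Germ (𝓝 x) 𝕜) where
  carrier := {a | ∃ f : E → 𝕜, AnalyticAt 𝕜 f x ∧ a = (f : Germ (𝓝 x) 𝕜)}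
  mul_mem' := by
    rintro _ _ ⟨f, hf, rfl⟩ ⟨g, hg, rfl⟩
    exact ⟨f * g, hf.mul hg, rfl⟩
  add_mem' := by
    rintro _ _ ⟨f, hf, rfl⟩ ⟨g, hg, rfl⟩
    exact ⟨f + g, hf.add hg, rfl⟩
  algebraMap_mem' c := ⟨fun _ => c, analyticAt_const, rfl⟩

variable (𝕜) in
/-- The stalk `O_x` of the sheaf `O` of analytic functions. -/
def AnalyticGerm (x : E) : Type u := analyticSubalgebra 𝕜 x

namespace AnalyticGerm

instance (x : E) : CommRing (AnalyticGerm 𝕜 x) := inferInstanceAs (CommRing (analyticSubalgebra 𝕜 x))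

instance (x : E) : Algebra 𝕜 (AnalyticGerm 𝕜 x) :=
  inferInstanceAs (Algebra 𝕜 (analyticSubalgebra 𝕜 x))

/-- The underlying germ of a function. -/
def toGerm {x : E} (a : AnalyticGerm 𝕜 x) : Germ (𝓝 x) 𝕜 :=
  (show analyticSubalgebra 𝕜 x from a).1

/-- The germ at `x` of a function that is analytic at `x`. -/
def mk {x : E} (f : E → 𝕜) (hf : AnalyticAt 𝕜 f x) : AnalyticGerm 𝕜 x :=
  (⟨(f : Germ (𝓝 x) 𝕜), ⟨f, hf, rfl⟩⟩ : analyticSubalgebra 𝕜 x)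

lemma toGerm_mk {x : E} (f : E → 𝕜) (hf : AnalyticAt 𝕜 f x) :
    (mk f hf).toGerm = (f : Germ (𝓝 x) 𝕜) := rfl

lemma toGerm_injective {x : E} {a b : AnalyticGerm 𝕜 x} (h : a.toGerm = b.toGerm) : a = b :=
  Subtype.ext h

/-- `toGerm` as a homomorphism of algebras. -/
def toGermHom (x : E) : AnalyticGerm 𝕜 x →ₐ[𝕜] Germ (𝓝 x) 𝕜 := (analyticSubalgebra 𝕜 x).val

lemma toGermHom_apply {x : E} (a : AnalyticGerm 𝕜 x) : toGermHom x a = a.toGerm := rfl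

lemma exists_mk {x : E} (a : AnalyticGerm 𝕜 x) : ∃ f hf, a = mk f hf := by
  obtain ⟨_, f, hf, rfl⟩ := a
  exact ⟨f, hf, rfl⟩

lemma mk_eq_mk {x : E} {f g : E → 𝕜} {hf : AnalyticAt 𝕜 f x} {hg : AnalyticAt 𝕜 g x} :
    mk f hf = mk g hg ↔ f =ᶠ[𝓝 x] g :=
  Subtype.ext_iff.trans Germ.coe_eq

lemma analyticAt_fderiv_apply {x : E} {f : E → 𝕜} (hf : AnalyticAt 𝕜 f x) (v : E) :
    AnalyticAt 𝕜 (fun y => fderiv 𝕜 f y v) x :=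
  (ContinuousLinearMap.apply 𝕜 𝕜 v).analyticAt _ |>.comp hf.fderiv

/-- The directional derivative of a germ. -/
def dFun {x : E} (v : E) (a : AnalyticGerm 𝕜 x) : AnalyticGerm 𝕜 x :=
  (⟨Germ.map' (lc := 𝓝 x) (fun f y => fderiv 𝕜 f y v)
      (fun _ _ h => h.fderiv.fun_comp (fun T => T v)) a.toGerm, by
    obtain ⟨_, f, hf, rfl⟩ := a
    exact ⟨_, analyticAt_fderiv_apply hf v, rfl⟩⟩ : analyticSubalgebra 𝕜 x)

lemma dFun_mk {x : E} (v : E) (f : E → 𝕜) (hf : AnalyticAt 𝕜 f x) :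
    dFun v (mk f hf) = mk _ (analyticAt_fderiv_apply hf v) := rfl

/-- The derivation `f ↦ ∂f/∂v` of the ring of germs. -/
def deriv {x : E} (v : E) : Derivation 𝕜 (AnalyticGerm 𝕜 x) (AnalyticGerm 𝕜 x) :=
  Derivation.mk'
    { toFun := dFun v
      map_add' := fun a b => by
        obtain ⟨f, hf, rfl⟩ := exists_mk a
        obtain ⟨g, hg, rfl⟩ := exists_mk b
        refine mk_eq_mk (hf := analyticAt_fderiv_apply (hf.add hg) v)
          (hg := (analyticAt_fderiv_apply hf v).add (analyticAt_fderiv_apply hg v)) |>.mpr ?_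
        filter_upwards [hf.eventually_analyticAt, hg.eventually_analyticAt] with y h1 h2
        rw [fderiv_add h1.differentiableAt h2.differentiableAt]
        rfl
      map_smul' := fun c a => by
        obtain ⟨f, hf, rfl⟩ := exists_mk a
        refine mk_eq_mk (hf := analyticAt_fderiv_apply (hf.const_smul (c := c)) v)
          (hg := (analyticAt_fderiv_apply hf v).const_smul (c := c)) |>.mpr ?_
        filter_upwards [hf.eventually_analyticAt] with y h1
        rw [fderiv_const_smul h1.differentiableAt]
        rfl }
    (fun a b => by
        obtain ⟨f, hf, rfl⟩ := exists_mk a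
        obtain ⟨g, hg, rfl⟩ := exists_mk b
        refine mk_eq_mk (hf := analyticAt_fderiv_apply (hf.mul hg) v)
          (hg := (hf.mul (analyticAt_fderiv_apply hg v)).add
            (hg.mul (analyticAt_fderiv_apply hf v))) |>.mpr ?_
        filter_upwards [hf.eventually_analyticAt, hg.eventually_analyticAt] with y h1 h2
        rw [fderiv_mul h1.differentiableAt h2.differentiableAt]
        rfl)

lemma deriv_mk {x : E} (v : E) (f : E → 𝕜) (hf : AnalyticAt 𝕜 f x) :
    deriv v (mk f hf) = mk _ (analyticAt_fderiv_apply hf v) := rfl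

lemma deriv_comm {x : E} (v w : E) (a : AnalyticGerm 𝕜 x) :
    deriv v (deriv w a) = deriv w (deriv v a) := by
  obtain ⟨f, hf, rfl⟩ := exists_mk a
  simp only [deriv_mk, mk_eq_mk]
  filter_upwards [hf.eventually_analyticAt] with y hy
  have h1 : IsSymmSndFDerivAt 𝕜 f y :=
    (hy.contDiffAt (n := ⊤)).isSymmSndFDerivAt le_top
  have h2 : DifferentiableAt 𝕜 (fderiv 𝕜 f) y := hy.fderiv.differentiableAt
  have h3 : ∀ v w : E, fderiv 𝕜 (fun z => fderiv 𝕜 f z w) y v = fderiv 𝕜 (fderiv 𝕜 f) y v w := by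
    intro v w
    rw [fderiv_clm_apply h2 (differentiableAt_const w)]
    simp
  rw [h3, h3]
  exact h1 v w

/-- The pullback of germs `f ↦ f ∘ ψ`, for `ψ` analytic at `x` with `ψ x = y`. -/
def pullback {F : Type u} [NormedAddCommGroup F] [NormedSpace 𝕜 F] {ψ : E → F} {x : E} {y : F}
    (hψ : AnalyticAt 𝕜 ψ x) (hy : ψ x = y) : AnalyticGerm 𝕜 y →ₐ[𝕜] AnalyticGerm 𝕜 x where
  toFun a := (⟨a.toGerm.compTendsto ψ (hy ▸ hψ.continuousAt), by
    obtain ⟨_, f, hf, rfl⟩ := a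
    exact ⟨f ∘ ψ, AnalyticAt.comp (hy ▸ hf) hψ, rfl⟩⟩ : analyticSubalgebra 𝕜 x)
  map_one' := rfl
  map_mul' := by
    rintro ⟨_, f, hf, rfl⟩ ⟨_, g, hg, rfl⟩
    rfl
  map_zero' := rfl
  map_add' := by
    rintro ⟨_, f, hf, rfl⟩ ⟨_, g, hg, rfl⟩
    rfl
  commutes' _ := rfl

end AnalyticGerm
end Germs

/-- The space `𝕜 ^ (2n)` with coordinates `(p, q)`. -/
abbrev PhaseSpace (𝕜 : Type u) (n : ℕ) : Type u := (Fin n → 𝕜) × (Fin n → 𝕜)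

namespace PhaseSpace
variable {𝕜 : Type u} [RCLike 𝕜] {n : ℕ}

/-- The standard symplectic form `∑ dpᵢ ∧ dqᵢ`. -/
def omega (u v : PhaseSpace 𝕜 n) : 𝕜 := ∑ i, (u.1 i * v.2 i - u.2 i * v.1 i)

open AnalyticGerm

/-- Poisson bracket `∑ (∂f/∂pᵢ ∂g/∂qᵢ - ∂f/∂qᵢ ∂g/∂pᵢ)` on germs. -/
def poisson {x : PhaseSpace 𝕜 n} (a b : AnalyticGerm 𝕜 x) : AnalyticGerm 𝕜 x :=
  ∑ i, (deriv (Pi.single i 1, 0) a * deriv (0, Pi.single i 1) b -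
    deriv (0, Pi.single i 1) a * deriv (Pi.single i 1, 0) b)

/-- The Poisson bracket of functions. -/
def poissonFun (f g : PhaseSpace 𝕜 n → 𝕜) (y : PhaseSpace 𝕜 n) : 𝕜 :=
  ∑ i, (fderiv 𝕜 f y (Pi.single i 1, 0) * fderiv 𝕜 g y (0, Pi.single i 1) -
    fderiv 𝕜 f y (0, Pi.single i 1) * fderiv 𝕜 g y (Pi.single i 1, 0))

lemma analyticAt_poissonFun {x : PhaseSpace 𝕜 n} {f g : PhaseSpace 𝕜 n → 𝕜}
    (hf : AnalyticAt 𝕜 f x) (hg : AnalyticAt 𝕜 g x) : AnalyticAt 𝕜 (poissonFun f g) x := by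
  refine Finset.analyticAt_fun_sum _ fun i _ => ?_
  exact ((analyticAt_fderiv_apply hf _).mul (analyticAt_fderiv_apply hg _)).sub
    ((analyticAt_fderiv_apply hf _).mul (analyticAt_fderiv_apply hg _))

lemma poisson_mk {x : PhaseSpace 𝕜 n} {f g : PhaseSpace 𝕜 n → 𝕜}
    (hf : AnalyticAt 𝕜 f x) (hg : AnalyticAt 𝕜 g x) :
    poisson (mk f hf) (mk g hg) = mk (poissonFun f g) (analyticAt_poissonFun hf hg) := by
  apply toGerm_injective
  have h1 := map_sum (toGermHom (𝕜 := 𝕜) x) (fun i =>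
    deriv (Pi.single i 1, 0) (mk f hf) * deriv (0, Pi.single i 1) (mk g hg) -
    deriv (0, Pi.single i 1) (mk f hf) * deriv (Pi.single i 1, 0) (mk g hg)) Finset.univ
  have h2 := map_sum (Germ.coeRingHom (R := 𝕜) (𝓝 x)) (fun (i : Fin n) y =>
    (fderiv 𝕜 f y (Pi.single i 1, 0) * fderiv 𝕜 g y (0, Pi.single i 1) -
    fderiv 𝕜 f y (0, Pi.single i 1) * fderiv 𝕜 g y (Pi.single i 1, 0))) Finset.univ
  refine h1.trans (h2.symm.trans ?_)
  refine congrArg (fun h : PhaseSpace 𝕜 n → 𝕜 => (h : Germ (𝓝 x) 𝕜)) ?_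
  ext y
  simp [poissonFun]

variable {x : PhaseSpace 𝕜 n} (a b c : AnalyticGerm 𝕜 x)

lemma poisson_self : poisson a a = 0 := by
  simp [poisson, mul_comm]

lemma poisson_skew : poisson b a = - poisson a b := by
  simp only [poisson, ← Finset.sum_neg_distrib]
  exact Finset.sum_congr rfl fun i _ => by ring

lemma poisson_add_right : poisson a (b + c) = poisson a b + poisson a c := by
  simp only [poisson, ← Finset.sum_add_distrib, map_add]
  exact Finset.sum_congr rfl fun i _ => by ring

lemma poisson_mul_right : poisson a (b * c) = b * poisson a c + poisson a b * c := by
  simp only [poisson, Finset.mul_sum, Finset.sum_mul, ← Finset.sum_add_distrib,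
    Derivation.leibniz, smul_eq_mul]
  exact Finset.sum_congr rfl fun i _ => by ring

lemma poisson_smul_right (r : 𝕜) : poisson a (r • b) = r • poisson a b := by
  simp only [poisson, Finset.smul_sum, Derivation.map_smul, smul_sub, mul_smul_comm]

lemma poisson_add_left : poisson (a + b) c = poisson a c + poisson b c := by
  rw [poisson_skew, poisson_add_right, poisson_skew a c, poisson_skew b c]; ring

lemma poisson_zero_right : poisson a 0 = 0 := by simp [poisson]

lemma poisson_neg_right : poisson a (-b) = - poisson a b := by
  simp only [poisson, ← Finset.sum_neg_distrib, map_neg]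
  exact Finset.sum_congr rfl fun i _ => by ring

lemma poisson_sub_right : poisson a (b - c) = poisson a b - poisson a c := by
  rw [sub_eq_add_neg, poisson_add_right, poisson_neg_right, sub_eq_add_neg]

lemma poisson_sub_left : poisson (a - b) c = poisson a c - poisson b c := by
  rw [poisson_skew, poisson_sub_right, poisson_skew a c, poisson_skew b c]; ring

lemma poisson_mul_left : poisson (a * b) c = a * poisson b c + poisson a c * b := by
  rw [poisson_skew, poisson_mul_right, poisson_skew a c, poisson_skew b c]; ring

lemma poisson_smul_left (r : 𝕜) : poisson (r • a) b = r • poisson a b := by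
  rw [poisson_skew, poisson_smul_right, poisson_skew a b, smul_neg, neg_neg]

lemma poisson_jacobi :
    poisson a (poisson b c) = poisson (poisson a b) c + poisson b (poisson a c) := by
  let X (i : Fin n) : Derivation 𝕜 (AnalyticGerm 𝕜 x) (AnalyticGerm 𝕜 x) := deriv (Pi.single i 1, 0)
  let Y (i : Fin n) : Derivation 𝕜 (AnalyticGerm 𝕜 x) (AnalyticGerm 𝕜 x) := deriv (0, Pi.single i 1)
  have hP : ∀ f g : AnalyticGerm 𝕜 x, poisson f g = ∑ i, (X i f * Y i g - Y i f * X i g) :=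
    fun _ _ => rfl
  have hXX : ∀ i j f, X i (X j f) = X j (X i f) := fun i j f => deriv_comm _ _ f
  have hYY : ∀ i j f, Y i (Y j f) = Y j (Y i f) := fun i j f => deriv_comm _ _ f
  have hYX : ∀ i j f, Y i (X j f) = X j (Y i f) := fun i j f => deriv_comm _ _ f
  have hD : ∀ (D : Derivation 𝕜 (AnalyticGerm 𝕜 x) (AnalyticGerm 𝕜 x)) (f g : AnalyticGerm 𝕜 x),
      D (poisson f g) = poisson (D f) g + poisson f (D g) + ∑ i, (
        (D (X i f) - X i (D f)) * Y i g + X i f * (D (Y i g) - Y i (D g)) -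
        (D (Y i f) - Y i (D f)) * X i g - Y i f * (D (X i g) - X i (D g))) := by
    intro D f g
    simp only [hP, map_sum, map_sub, Derivation.leibniz, smul_eq_mul, ← Finset.sum_add_distrib]
    exact Finset.sum_congr rfl fun i _ => by ring
  have hX : ∀ j f g, X j (poisson f g) = poisson (X j f) g + poisson f (X j g) := by
    intro j f g
    rw [hD]
    simp [hXX j, hYX]
  have hY : ∀ j f g, Y j (poisson f g) = poisson (Y j f) g + poisson f (Y j g) := by
    intro j f g
    rw [hD]
    simp [hYY j, hYX]
  rw [hP a (poisson b c), hP (poisson a b) c, hP b (poisson a c)]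
  simp only [hX, hY, mul_add, add_mul, Finset.sum_add_distrib, Finset.sum_sub_distrib]
  have e1 : ∑ i, X i a * poisson (Y i b) c - ∑ i, Y i a * poisson (X i b) c =
      ∑ i, poisson a (X i b) * Y i c - ∑ i, poisson a (Y i b) * X i c := by
    simp only [hP, ← Finset.sum_sub_distrib, Finset.mul_sum, Finset.sum_mul]
    rw [Finset.sum_comm]
    refine Finset.sum_congr rfl fun i _ => Finset.sum_congr rfl fun j _ => ?_
    rw [hXX j i, hYY j i, hYX j i, hYX i j]
    ring
  have e2 : ∑ i, X i a * poisson b (Y i c) - ∑ i, Y i a * poisson b (X i c) =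
      ∑ i, X i b * poisson a (Y i c) - ∑ i, Y i b * poisson a (X i c) := by
    simp only [hP, ← Finset.sum_sub_distrib, Finset.mul_sum]
    rw [Finset.sum_comm]
    refine Finset.sum_congr rfl fun i _ => Finset.sum_congr rfl fun j _ => ?_
    rw [hXX j i, hYY j i, hYX j i, hYX i j]
    ring
  have e3 : ∑ i, poisson (X i a) b * Y i c - ∑ i, poisson (Y i a) b * X i c +
      (∑ i, X i b * poisson (Y i a) c - ∑ i, Y i b * poisson (X i a) c) = 0 := by
    have : ∑ i, X i b * poisson (Y i a) c - ∑ i, Y i b * poisson (X i a) c =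
        -(∑ i, poisson (X i a) b * Y i c - ∑ i, poisson (Y i a) b * X i c) := by
      simp only [hP, ← Finset.sum_sub_distrib, Finset.mul_sum, Finset.sum_mul,
        ← Finset.sum_neg_distrib]
      rw [Finset.sum_comm]
      refine Finset.sum_congr rfl fun i _ => Finset.sum_congr rfl fun j _ => ?_
      rw [hXX j i, hYY j i, hYX j i, hYX i j]
      ring
    rw [this, add_neg_cancel]
  linear_combination e1 + e2 - e3

end PhaseSpace
end

noncomputable section

open PhaseSpace

/-- An involutive analytic subspace `L` of the open set `D ⊆ 𝕜^(2n)`: an ideal sheaf `I ⊆ O_D`,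
given by its stalks, which is locally generated by finitely many analytic functions and satisfies
`{I, I} ⊆ I`. (The values of `ideal` outside of `D` play no role.) -/
structure InvolutiveSubspace {𝕜 : Type u} [RCLike 𝕜] {n : ℕ} (D : Opens (PhaseSpace 𝕜 n)) where
  ideal : ∀ x : PhaseSpace 𝕜 n, Ideal (AnalyticGerm 𝕜 x)
  finite_type : ∀ x ∈ D, ∃ s : Finset (PhaseSpace 𝕜 n → 𝕜), (∀ f ∈ s, AnalyticAt 𝕜 f x) ∧
    ∀ᶠ y in 𝓝 x, ideal y = Ideal.span {a | ∃ f ∈ s, a.toGerm = (f : Germ (𝓝 y) 𝕜)}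
  involutive : ∀ x ∈ D, ∀ a ∈ ideal x, ∀ b ∈ ideal x, poisson a b ∈ ideal x

namespace InvolutiveSubspace

variable {𝕜 : Type u} [RCLike 𝕜] {n : ℕ} {D : Opens (PhaseSpace 𝕜 n)}

/-- The restriction of `L` to a smaller open set. -/
def restrict (L : InvolutiveSubspace D) (W : Opens (PhaseSpace 𝕜 n)) (hW : W ≤ D) :
    InvolutiveSubspace W where
  ideal := L.ideal
  finite_type x hx := L.finite_type x (hW hx)
  involutive x hx := L.involutive x (hW hx)

variable (L : InvolutiveSubspace D)

/-- The points of `L`: those at which `I` is a proper ideal. -/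
def support : Set (PhaseSpace 𝕜 n) := {x | x ∈ D ∧ L.ideal x ≠ ⊤}

/-- `L` is reduced: `I` is the full ideal sheaf of its zero set, so that `O_L` is a sheaf of
functions on `L`. -/
def IsReduced : Prop :=
  ∀ x ∈ D, ∀ (f : PhaseSpace 𝕜 n → 𝕜) (hf : AnalyticAt 𝕜 f x),
    (∀ᶠ y in 𝓝 x, y ∈ L.support → f y = 0) → AnalyticGerm.mk f hf ∈ L.ideal x

/-- `L` represents a lagrangian germ `(L, 0) ⊂ (𝕜^(2n), 0)`: it is involutive (as all our
subspaces), reduced, and of dimension `n` at `0` (in particular `0 ∈ L`). -/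
structure IsLagrangianAtZero : Prop where
  zero_mem : 0 ∈ D
  reduced : L.IsReduced
  dim_eq : ringKrullDim (AnalyticGerm 𝕜 (0 : PhaseSpace 𝕜 n) ⧸ L.ideal 0) = n

/-- `L` as a topological space. -/
abbrev space : TopCat.{u} := TopCat.of L.support

/-- The stalk of `O_L = O / I`. -/
def Stalk (x : L.support) : Type u := AnalyticGerm 𝕜 x.1 ⧸ L.ideal x.1

instance (x : L.support) : CommRing (L.Stalk x) :=
  inferInstanceAs (CommRing (AnalyticGerm 𝕜 x.1 ⧸ L.ideal x.1))

instance (x : L.support) : Algebra 𝕜 (L.Stalk x) :=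
  inferInstanceAs (Algebra 𝕜 (AnalyticGerm 𝕜 x.1 ⧸ L.ideal x.1))

/-- The quotient map `O_x → O_{L,x}`. -/
def toStalk (x : L.support) : AnalyticGerm 𝕜 x.1 →ₐ[𝕜] L.Stalk x :=
  Ideal.Quotient.mkₐ 𝕜 (L.ideal x.1)

lemma toStalk_surjective {x : L.support} (f : L.Stalk x) : ∃ g, L.toStalk x g = f :=
  Ideal.Quotient.mk_surjective f

lemma toStalk_eq {x : L.support} {f g : AnalyticGerm 𝕜 x.1} :
    L.toStalk x f = L.toStalk x g ↔ f - g ∈ L.ideal x.1 :=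
  Ideal.Quotient.mk_eq_mk_iff_sub_mem f g

/-- The stalk at `x` of the conormal sheaf `I / I²`. -/
def Conormal (x : L.support) : Type u := (L.ideal x.1).Cotangent

variable (x : L.support)

instance : AddCommGroup (L.Conormal x) := inferInstanceAs (AddCommGroup (L.ideal x.1).Cotangent)
instance : Module (L.Stalk x) (L.Conormal x) :=
  inferInstanceAs (Module (AnalyticGerm 𝕜 x.1 ⧸ L.ideal x.1) (L.ideal x.1).Cotangent)
instance : Module 𝕜 (L.Conormal x) := inferInstanceAs (Module 𝕜 (L.ideal x.1).Cotangent)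

variable {L x}

/-- The class of `a ∈ I_x` in `I_x / I_x²`. -/
def toConormal (a : L.ideal x.1) : L.Conormal x := (L.ideal x.1).toCotangent a

lemma toConormal_surjective (u : L.Conormal x) : ∃ a : L.ideal x.1, toConormal a = u :=
  (L.ideal x.1).toCotangent_surjective u

lemma toConormal_eq {a b : L.ideal x.1} :
    toConormal a = toConormal b ↔ (a - b : AnalyticGerm 𝕜 x.1) ∈ L.ideal x.1 ^ 2 :=
  (L.ideal x.1).toCotangent_eq

lemma toConormal_add (a b : L.ideal x.1) : toConormal (a + b) = toConormal a + toConormal b := rfl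

lemma toConormal_smul (r : 𝕜) (a : L.ideal x.1) : toConormal (r • a) = r • toConormal a := rfl

/-- The product `f a ∈ I` for `f ∈ O`, `a ∈ I`. -/
def idealSMul (f : AnalyticGerm 𝕜 x.1) (a : L.ideal x.1) : L.ideal x.1 :=
  ⟨f * a.1, Ideal.mul_mem_left _ _ a.2⟩

lemma toConormal_mk_smul (f : AnalyticGerm 𝕜 x.1) (a : L.ideal x.1) :
    toConormal (idealSMul f a) = L.toStalk x f • toConormal a := rfl

/-- The Poisson bracket of two elements of the involutive ideal `I_x`. -/
def idealBracket (a b : L.ideal x.1) : L.ideal x.1 :=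
  ⟨poisson a.1 b.1, L.involutive x.1 x.2.1 _ a.2 _ b.2⟩

lemma poisson_mem_sq (a b : AnalyticGerm 𝕜 x.1) (ha : a ∈ L.ideal x.1 ^ 2) (hb : b ∈ L.ideal x.1) :
    poisson a b ∈ L.ideal x.1 ^ 2 := by
  rw [pow_two] at ha ⊢
  refine Submodule.mul_induction_on ha (fun f hf g hg => ?_) (fun f g hf hg => ?_)
  · rw [poisson_mul_left]
    exact add_mem (Ideal.mul_mem_mul hf (L.involutive _ x.2.1 _ hg _ hb))
      (Ideal.mul_mem_mul (L.involutive _ x.2.1 _ hf _ hb) hg)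
  · rw [poisson_add_left]
    exact add_mem hf hg

lemma poisson_mem_of_sq (a b : AnalyticGerm 𝕜 x.1) (ha : a ∈ L.ideal x.1 ^ 2) :
    poisson a b ∈ L.ideal x.1 := by
  rw [pow_two] at ha
  refine Submodule.mul_induction_on ha (fun f hf g hg => ?_) (fun f g hf hg => ?_)
  · rw [poisson_mul_left]
    exact add_mem (Ideal.mul_mem_right _ _ hf) (Ideal.mul_mem_left _ _ hg)
  · rw [poisson_add_left]
    exact add_mem hf hg

lemma conormalBracket_wd {a a' b b' : L.ideal x.1} (ha : toConormal a = toConormal a')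
    (hb : toConormal b = toConormal b') :
    toConormal (idealBracket a b) = toConormal (idealBracket a' b') := by
  rw [toConormal_eq] at *
  have : ((idealBracket a b : AnalyticGerm 𝕜 x.1) - idealBracket a' b') =
      poisson (a - a' : AnalyticGerm 𝕜 x.1) b - poisson (b - b' : AnalyticGerm 𝕜 x.1) a' := by
    rw [poisson_sub_left, poisson_sub_left, poisson_skew a'.1 b.1, poisson_skew a'.1 b'.1]
    simp only [idealBracket]
    ring
  rw [this]
  exact sub_mem (poisson_mem_sq _ _ ha b.2) (poisson_mem_sq _ _ hb a'.2)

lemma anchor_wd {a a' : L.ideal x.1} {f f' : AnalyticGerm 𝕜 x.1}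
    (ha : toConormal a = toConormal a')
    (hf : L.toStalk x f = L.toStalk x f') :
    L.toStalk x (poisson a.1 f) =
      L.toStalk x (poisson a'.1 f') := by
  rw [toConormal_eq] at ha
  rw [toStalk_eq] at *
  have : poisson a.1 f - poisson a'.1 f' = poisson (a - a' : AnalyticGerm 𝕜 x.1) f +
      poisson a'.1 (f - f') := by
    rw [poisson_sub_left, poisson_sub_right]
    ring
  rw [this]
  exact add_mem (poisson_mem_of_sq _ _ ha) (L.involutive _ x.2.1 _ a'.2 _ hf)

variable (L x)

/-- The bracket of `I_x / I_x²` induced by the Poisson bracket, see `lie_toConormal`. -/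
instance : Bracket (L.Conormal x) (L.Conormal x) where
  bracket u v := toConormal (idealBracket (toConormal_surjective u).choose
    (toConormal_surjective v).choose)

/-- The action of `I_x / I_x²` on `O_{L,x}` induced by the Poisson bracket, see `lie_mk`. -/
instance : Bracket (L.Conormal x) (L.Stalk x) where
  bracket u f := L.toStalk x (poisson (toConormal_surjective u).choose.1
    (L.toStalk_surjective f).choose)

variable {L x}

lemma lie_toConormal (a b : L.ideal x.1) :
    ⁅(toConormal a : L.Conormal x), (toConormal b : L.Conormal x)⁆ =
      toConormal (idealBracket a b) :=
  conormalBracket_wd (toConormal_surjective _).choose_spec (toConormal_surjective _).choose_spec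

lemma lie_mk (a : L.ideal x.1) (f : AnalyticGerm 𝕜 x.1) :
    ⁅(toConormal a : L.Conormal x), L.toStalk x f⁆ =
      L.toStalk x (poisson a.1 f) :=
  anchor_wd (toConormal_surjective _).choose_spec (L.toStalk_surjective _).choose_spec

variable (L x)

instance : LieRing (L.Conormal x) where
  add_lie u v w := by
    obtain ⟨a, rfl⟩ := toConormal_surjective u
    obtain ⟨b, rfl⟩ := toConormal_surjective v
    obtain ⟨c, rfl⟩ := toConormal_surjective w
    simp only [← toConormal_add, lie_toConormal]
    exact congrArg _ (Subtype.ext (poisson_add_left _ _ _))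
  lie_add u v w := by
    obtain ⟨a, rfl⟩ := toConormal_surjective u
    obtain ⟨b, rfl⟩ := toConormal_surjective v
    obtain ⟨c, rfl⟩ := toConormal_surjective w
    simp only [← toConormal_add, lie_toConormal]
    exact congrArg _ (Subtype.ext (poisson_add_right _ _ _))
  lie_self u := by
    obtain ⟨a, rfl⟩ := toConormal_surjective u
    rw [lie_toConormal]
    exact congrArg (toConormal (L := L) (x := x)) (a₂ := 0) (Subtype.ext (poisson_self _))
  leibniz_lie u v w := by
    obtain ⟨a, rfl⟩ := toConormal_surjective u
    obtain ⟨b, rfl⟩ := toConormal_surjective v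
    obtain ⟨c, rfl⟩ := toConormal_surjective w
    simp only [← toConormal_add, lie_toConormal]
    exact congrArg _ (Subtype.ext (poisson_jacobi _ _ _))

instance : LieAlgebra 𝕜 (L.Conormal x) where
  lie_smul r u v := by
    obtain ⟨a, rfl⟩ := toConormal_surjective u
    obtain ⟨b, rfl⟩ := toConormal_surjective v
    simp only [← toConormal_smul, lie_toConormal]
    exact congrArg _ (Subtype.ext (poisson_smul_right _ _ _))

instance : LieRingModule (L.Conormal x) (L.Stalk x) where
  add_lie u v f := by
    obtain ⟨a, rfl⟩ := toConormal_surjective u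
    obtain ⟨b, rfl⟩ := toConormal_surjective v
    obtain ⟨f, rfl⟩ := L.toStalk_surjective f
    simp only [← toConormal_add, lie_mk]
    exact congrArg _ (poisson_add_left _ _ _)
  lie_add u f g := by
    obtain ⟨a, rfl⟩ := toConormal_surjective u
    obtain ⟨f, rfl⟩ := L.toStalk_surjective f
    obtain ⟨g, rfl⟩ := L.toStalk_surjective g
    simp only [← map_add, lie_mk]
    exact congrArg _ (poisson_add_right _ _ _)
  leibniz_lie u v f := by
    obtain ⟨a, rfl⟩ := toConormal_surjective u
    obtain ⟨b, rfl⟩ := toConormal_surjective v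
    obtain ⟨f, rfl⟩ := L.toStalk_surjective f
    simp only [lie_toConormal, lie_mk, ← map_add]
    exact congrArg _ (poisson_jacobi _ _ _)

instance : LieRinehartRing (L.Stalk x) (L.Conormal x) where
  lie_smul_eq_mul' f g u := by
    obtain ⟨a, rfl⟩ := toConormal_surjective u
    obtain ⟨f, rfl⟩ := L.toStalk_surjective f
    obtain ⟨g, rfl⟩ := L.toStalk_surjective g
    rw [← toConormal_mk_smul, lie_mk, lie_mk, ← map_mul, toStalk_eq]
    have : poisson (idealSMul f a).1 g - f * poisson a.1 g =
        poisson f g * a.1 := by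
      change poisson (f * a.1) g - _ = _
      rw [poisson_mul_left]
      ring
    rw [this]
    exact Ideal.mul_mem_left _ _ a.2
  leibniz_mul_right' u f g := by
    obtain ⟨a, rfl⟩ := toConormal_surjective u
    obtain ⟨f, rfl⟩ := L.toStalk_surjective f
    obtain ⟨g, rfl⟩ := L.toStalk_surjective g
    rw [← map_mul, lie_mk, lie_mk, lie_mk, poisson_mul_right, smul_eq_mul, map_add, map_mul,
      map_mul]
  leibniz_smul_right' u v f := by
    obtain ⟨a, rfl⟩ := toConormal_surjective u
    obtain ⟨b, rfl⟩ := toConormal_surjective v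
    obtain ⟨f, rfl⟩ := L.toStalk_surjective f
    rw [← toConormal_mk_smul, lie_mk, lie_toConormal, lie_toConormal, ← toConormal_mk_smul,
      ← toConormal_mk_smul, ← toConormal_add]
    exact congrArg _ (Subtype.ext (poisson_mul_right _ _ _))

instance : IsScalarTower 𝕜 (L.Stalk x) (L.Conormal x) where
  smul_assoc r f u := by
    obtain ⟨a, rfl⟩ := toConormal_surjective u
    obtain ⟨f, rfl⟩ := L.toStalk_surjective f
    rw [← map_smul, ← toConormal_mk_smul, ← toConormal_mk_smul, ← toConormal_smul]
    refine congrArg _ (Subtype.ext ?_)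
    exact smul_mul_assoc r f a.1

instance : LieRinehartAlgebra 𝕜 (L.Stalk x) (L.Conormal x) where
  smul_lie r u f := by
    obtain ⟨a, rfl⟩ := toConormal_surjective u
    obtain ⟨f, rfl⟩ := L.toStalk_surjective f
    rw [← toConormal_smul, lie_mk, lie_mk]
    exact congrArg _ (poisson_smul_left _ _ _)
  lie_smul r u f := by
    obtain ⟨a, rfl⟩ := toConormal_surjective u
    obtain ⟨f, rfl⟩ := L.toStalk_surjective f
    have h : ∀ h, r • L.toStalk x h =
      L.toStalk x (r • h) := fun _ => rfl
    rw [lie_mk, h, h, lie_mk, poisson_smul_right]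

/-- The module `Hom(Λ^p (I_x / I_x²), O_{L,x})` over `O_{L,x}`, as the module of alternating
forms. -/
abbrev Cochain (p : ℕ) (x : L.support) : Type u :=
  (L.Conormal x) [⋀^Fin p]→ₗ[L.Stalk x] (L.Stalk x)

variable {L} in
/-- A section over `V` of the sheaf `Hom_{O_L}(Λ^p (I / I²), O_L)`, given by its family `φ` of
homomorphisms between stalks: whenever `h₁, …, h_p` are sections of `I` near a point `y ∈ V`, the
family `z ↦ φ_z(h₁ ∧ … ∧ h_p) ∈ O_{L,z}` is near `y` a section of `O_L`, that is, it is induced by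
an analytic function `g`. -/
def IsSection {p : ℕ} {V : Opens L.space} (φ : ∀ x : V, L.Cochain p x.1) : Prop :=
  ∀ (y : V) (h : Fin p → PhaseSpace 𝕜 n → 𝕜),
    (∀ i, ∀ᶠ z in 𝓝 y.1.1, ∃ a ∈ L.ideal z, a.toGerm = (h i : Germ (𝓝 z) 𝕜)) →
    ∃ g : PhaseSpace 𝕜 n → 𝕜, AnalyticAt 𝕜 g y.1.1 ∧
      ∀ᶠ z in 𝓝 y.1.1, ∀ (hz : z ∈ L.support) (hzV : (⟨z, hz⟩ : L.support) ∈ V)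
        (a : Fin p → L.ideal z) (b : AnalyticGerm 𝕜 z),
        (∀ i, (a i).1.toGerm = (h i : Germ (𝓝 z) 𝕜)) → b.toGerm = (g : Germ (𝓝 z) 𝕜) →
        φ ⟨⟨z, hz⟩, hzV⟩ (fun i => toConormal (a i)) = L.toStalk ⟨z, hz⟩ b

variable {L} in
lemma IsSection.restrict {p : ℕ} {V W : Opens L.space} (hWV : W ≤ V)
    {φ : ∀ x : V, L.Cochain p x.1} (hφ : IsSection φ) :
    IsSection (fun x : W => φ ⟨x.1, hWV x.2⟩) := by
  intro y h hh
  obtain ⟨g, hg, H⟩ := hφ ⟨y.1, hWV y.2⟩ h hh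
  refine ⟨g, hg, ?_⟩
  filter_upwards [H] with z hz h1 h2 a b ha hb
  exact hz h1 (hWV h2) a b ha hb

variable {L} in
lemma IsSection.of_local {p : ℕ} {V : Opens L.space} (φ : ∀ x : V, L.Cochain p x.1)
    (hφ : ∀ x : V, ∃ (W : Opens L.space) (_ : x.1 ∈ W) (hWV : W ≤ V),
      IsSection (fun x : W => φ ⟨x.1, hWV x.2⟩)) : IsSection φ := by
  intro y h hh
  obtain ⟨W, hyW, hWV, hW⟩ := hφ y
  obtain ⟨g, hg, H⟩ := hW ⟨y.1, hyW⟩ h hh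
  refine ⟨g, hg, ?_⟩
  obtain ⟨U, hU, hUW⟩ := isOpen_induced_iff.mp W.2
  have hyU : y.1.1 ∈ U := by
    have : y.1 ∈ W.carrier := hyW
    rw [← hUW] at this
    exact this
  filter_upwards [H, hU.mem_nhds hyU] with z hz hzU h1 h2 a b ha hb
  refine hz h1 ?_ a b ha hb
  change (⟨z, h1⟩ : L.support) ∈ W.carrier
  rw [← hUW]
  exact hzU

/-- The module of sections of `C^p` over `V`. -/
def sections (p : ℕ) (V : Opens L.space) : Submodule 𝕜 (∀ x : V, L.Cochain p x.1) where
  carrier := {φ | IsSection φ}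
  zero_mem' y h hh := by
    refine ⟨fun _ => 0, analyticAt_const, Eventually.of_forall fun z hz hzV a b _ hb => ?_⟩
    have : b = 0 := AnalyticGerm.toGerm_injective hb
    rw [this, map_zero]
    rfl
  add_mem' {φ ψ} hφ hψ y h hh := by
    obtain ⟨g, hg, H⟩ := hφ y h hh
    obtain ⟨g', hg', H'⟩ := hψ y h hh
    refine ⟨g + g', hg.add hg', ?_⟩
    filter_upwards [H, H', hg.eventually_analyticAt, hg'.eventually_analyticAt]
      with z hz hz' h1 h2 hs hV a b ha hb
    have e : b = AnalyticGerm.mk g h1 + AnalyticGerm.mk g' h2 := AnalyticGerm.toGerm_injective hb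
    rw [e, map_add, ← hz hs hV a _ ha rfl, ← hz' hs hV a _ ha rfl]
    rfl
  smul_mem' r φ hφ y h hh := by
    obtain ⟨g, hg, H⟩ := hφ y h hh
    refine ⟨r • g, hg.const_smul, ?_⟩
    filter_upwards [H, hg.eventually_analyticAt] with z hz h1 hs hV a b ha hb
    have e : b = r • AnalyticGerm.mk g h1 := AnalyticGerm.toGerm_injective hb
    rw [e, map_smul, ← hz hs hV a _ ha rfl]
    rfl

/-- The presheaf `V ↦ Hom_{O_V}(Λ^p (I / I²), O_V)` on `L`. -/
def cochainPresheaf (p : ℕ) : TopCat.Presheaf (ModuleCat.{u} 𝕜) L.space where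
  obj V := ModuleCat.of 𝕜 (L.sections p V.unop)
  map {V W} i := ModuleCat.ofHom
    { toFun := fun φ => ⟨fun x => φ.1 ⟨x.1, i.unop.le x.2⟩, IsSection.restrict i.unop.le φ.2⟩
      map_add' := fun _ _ => rfl
      map_smul' := fun _ _ => rfl }

/-- `IsSection` as a local predicate; used to see that the presheaf is a sheaf. -/
def cochainLocalPredicate (p : ℕ) : TopCat.LocalPredicate (X := L.space) (L.Cochain p) where
  pred φ := IsSection φ
  res i _ hφ := IsSection.restrict i.le hφ
  locality φ hφ := IsSection.of_local φ fun x => by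
    obtain ⟨W, hx, i, h⟩ := hφ x
    exact ⟨W, hx, i.le, h⟩

lemma cochainPresheaf_isSheaf (p : ℕ) : (L.cochainPresheaf p).IsSheaf := by
  rw [TopCat.Presheaf.isSheaf_iff_isSheaf_comp (forget (ModuleCat.{u} 𝕜))]
  exact TopCat.subpresheafToTypes.isSheaf (L.cochainLocalPredicate p)

/-- The sheaf `C^p_L = Hom_{O_L}(Λ^p (I / I²), O_L)`, as a sheaf of `𝕜`-vector spaces. -/
def cochainSheaf (p : ℕ) : TopCat.Sheaf (ModuleCat.{u} 𝕜) L.space :=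
  ⟨L.cochainPresheaf p, L.cochainPresheaf_isSheaf p⟩


variable {L} in
lemma IsSection.delta {p : ℕ} {V : Opens L.space} {φ : ∀ x : V, L.Cochain p x.1}
    (hφ : IsSection φ) :
    IsSection (fun x : V => LieRinehartAlgebra.delta 𝕜 p (φ x)) := by
  intro y h hh
  have han : ∀ i, ∀ᶠ z in 𝓝 y.1.1, AnalyticAt 𝕜 (h i) z := by
    intro i
    filter_upwards [hh i] with z ⟨a, _, ha⟩
    obtain ⟨f, hf, rfl⟩ := AnalyticGerm.exists_mk a
    exact hf.congr (Germ.coe_eq.mp ha)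
  have hmem : ∀ i, ∀ᶠ z in 𝓝 y.1.1, ∀ hz : AnalyticAt 𝕜 (h i) z,
      AnalyticGerm.mk (h i) hz ∈ L.ideal z := by
    intro i
    filter_upwards [hh i] with z ⟨a, ha, hag⟩ hz
    rwa [← AnalyticGerm.toGerm_injective (a := a) (b := AnalyticGerm.mk (h i) hz) hag]
  have hbr : ∀ i j, ∀ᶠ z in 𝓝 y.1.1, ∃ a ∈ L.ideal z,
      a.toGerm = (poissonFun (h i) (h j) : Germ (𝓝 z) 𝕜) := by
    intro i j
    filter_upwards [han i, han j, hmem i, hmem j, D.2.mem_nhds y.1.2.1] with z h1 h2 h3 h4 hz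
    exact ⟨_, L.involutive z hz _ (h3 h1) _ (h4 h2), congrArg _ (poisson_mk h1 h2)⟩
  have hA : ∀ i : Fin (p + 1), ∀ k, ∀ᶠ z in 𝓝 y.1.1, ∃ a ∈ L.ideal z,
      a.toGerm = ((i.removeNth h k : PhaseSpace 𝕜 n → 𝕜) : Germ (𝓝 z) 𝕜) :=
    fun i k => hh _
  have hB : ∀ i j : Fin (p + 1), ∀ k, ∀ᶠ z in 𝓝 y.1.1, ∃ a ∈ L.ideal z,
      a.toGerm = ((i.removeNth (Function.update h j (poissonFun (h i) (h j))) k :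
        PhaseSpace 𝕜 n → 𝕜) : Germ (𝓝 z) 𝕜) := by
    intro i j k
    by_cases hk : i.succAbove k = j
    · simpa [Fin.removeNth, hk] using hbr i j
    · simpa [Fin.removeNth, Function.update_of_ne hk] using hh (i.succAbove k)
  choose G hG HG using fun i => hφ y (i.removeNth h) (hA i)
  choose K hK HK using fun i j =>
    hφ y (i.removeNth (Function.update h j (poissonFun (h i) (h j)))) (hB i j)
  refine ⟨fun z => ∑ i : Fin (p + 1), (-1) ^ ((i : ℕ) + 1) * poissonFun (h i) (G i) z +
    ∑ i : Fin (p + 1), ∑ j ∈ Finset.Ioi i, (-1) ^ (i : ℕ) * K i j z, ?_, ?_⟩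
  · refine (Finset.analyticAt_fun_sum _ fun i _ => ?_).add
      (Finset.analyticAt_fun_sum _ fun i _ => Finset.analyticAt_fun_sum _ fun j _ => ?_)
    · exact analyticAt_const.mul (analyticAt_poissonFun (han i).self_of_nhds (hG i))
    · exact analyticAt_const.mul (hK i j)
  · have hGe := fun i => (hG i).eventually_analyticAt
    have hKe := fun i j => (hK i j).eventually_analyticAt
    filter_upwards [eventually_all.2 HG, eventually_all.2 fun i => eventually_all.2 (HK i),
      eventually_all.2 hGe, eventually_all.2 fun i => eventually_all.2 (hKe i),
      eventually_all.2 han] with z HGz HKz hGz hKz hanz hs hV a b ha hb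
    have hai : ∀ i, (a i).1 = AnalyticGerm.mk (h i) (hanz i) :=
      fun i => AnalyticGerm.toGerm_injective (ha i)
    have e1 : ∀ i, φ ⟨⟨z, hs⟩, hV⟩ (i.removeNth fun k => (toConormal (a k) : L.Conormal ⟨z, hs⟩)) =
        L.toStalk ⟨z, hs⟩ (AnalyticGerm.mk (G i) (hGz i)) :=
      fun i => HGz i hs hV (i.removeNth a) _ (fun k => ha _) rfl
    have e2 : ∀ i j, φ ⟨⟨z, hs⟩, hV⟩ (i.removeNth (Function.update
          (fun k => (toConormal (a k) : L.Conormal ⟨z, hs⟩)) j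
          ⁅(toConormal (a i) : L.Conormal ⟨z, hs⟩), (toConormal (a j) : L.Conormal ⟨z, hs⟩)⁆)) =
        L.toStalk ⟨z, hs⟩ (AnalyticGerm.mk (K i j) (hKz i j)) := by
      intro i j
      rw [← HKz i j hs hV (i.removeNth (Function.update a j
        (idealBracket (L := L) (x := ⟨z, hs⟩) (a i) (a j)))) _ ?_ rfl]
      · congr 1
        ext k
        by_cases hk : i.succAbove k = j
        · simp [Fin.removeNth, hk, lie_toConormal]
        · simp [Fin.removeNth, Function.update_of_ne hk]
      · intro k
        by_cases hk : i.succAbove k = j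
        · simp only [Fin.removeNth, hk, Function.update_self]
          change (poisson (a i).1 (a j).1).toGerm = _
          rw [hai i, hai j, poisson_mk]
          rfl
        · simpa [Fin.removeNth, Function.update_of_ne hk] using ha (i.succAbove k)
    have e3 : b = ∑ i : Fin (p + 1), (-1) ^ ((i : ℕ) + 1) *
          poisson (a i).1 (AnalyticGerm.mk (G i) (hGz i)) +
        ∑ i : Fin (p + 1), ∑ j ∈ Finset.Ioi i, (-1) ^ (i : ℕ) * AnalyticGerm.mk (K i j) (hKz i j) := by
      apply AnalyticGerm.toGerm_injective
      rw [hb, ← AnalyticGerm.toGermHom_apply]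
      simp only [map_add, map_sum, map_mul, map_pow, map_neg, map_one, hai, poisson_mk]
      change Germ.coeRingHom (R := 𝕜) (𝓝 z) _ = _
      have hfun : (fun z => ∑ i : Fin (p + 1), (-1) ^ ((i : ℕ) + 1) * poissonFun (h i) (G i) z +
          ∑ i : Fin (p + 1), ∑ j ∈ Finset.Ioi i, (-1) ^ (i : ℕ) * K i j z : PhaseSpace 𝕜 n → 𝕜) =
          ∑ i : Fin (p + 1), (-1) ^ ((i : ℕ) + 1) * poissonFun (h i) (G i) +
          ∑ i : Fin (p + 1), ∑ j ∈ Finset.Ioi i, (-1) ^ (i : ℕ) * K i j := by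
        ext w
        simp [Finset.sum_apply]
      rw [hfun]
      simp only [map_add, map_sum, map_mul, map_pow, map_neg, map_one]
      rfl
    have e4 : ∀ i, ⁅(toConormal (a i) : L.Conormal ⟨z, hs⟩),
        L.toStalk ⟨z, hs⟩ (AnalyticGerm.mk (G i) (hGz i))⁆ =
        L.toStalk ⟨z, hs⟩ (poisson (a i).1 (AnalyticGerm.mk (G i) (hGz i))) :=
      fun i => lie_mk (x := ⟨z, hs⟩) (a i) _
    rw [LieRinehartAlgebra.delta_apply, LieRinehartAlgebra.deltaFun, e3]
    simp only [e1, e2, e4, map_add, map_sum, map_mul, map_pow, map_neg, map_one]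

/-- The differential `δ : C^p_L → C^{p+1}_L`. -/
def differential (p : ℕ) : L.cochainSheaf p ⟶ L.cochainSheaf (p + 1) :=
  ⟨{ app := fun _ => ModuleCat.ofHom
      { toFun := fun φ => ⟨fun x => LieRinehartAlgebra.delta 𝕜 p (φ.1 x), IsSection.delta φ.2⟩
        map_add' := fun _ _ => Subtype.ext (funext fun _ => map_add _ _ _)
        map_smul' := fun r φ => Subtype.ext (funext fun x => (LieRinehartAlgebra.delta 𝕜 p).map_smul r (φ.1 x)) }
     naturality := fun _ _ _ => rfl }⟩

lemma differential_comp (p : ℕ) : L.differential p ≫ L.differential (p + 1) = 0 := by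
  apply CategoryTheory.Sheaf.hom_ext
  ext V φ
  exact Subtype.ext (funext fun x => LieRinehartAlgebra.delta_delta (R := 𝕜) (φ.1 x))

/-- The complex of sheaves `C^•_L` on `L`. -/
def complex : CochainComplex (TopCat.Sheaf (ModuleCat.{u} 𝕜) L.space) ℕ :=
  CochainComplex.of L.cochainSheaf L.differential L.differential_comp

end InvolutiveSubspace

section Decomposition
variable {𝕜 : Type u} [RCLike 𝕜] {m : ℕ}

namespace PhaseSpace

/-- The projection `𝕜^(2m+2) = 𝕜^(2m) × 𝕜² → 𝕜^(2m)` that forgets `(p₁, q₁)`. -/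
def proj (y : PhaseSpace 𝕜 (m + 1)) : PhaseSpace 𝕜 m := (Fin.tail y.1, Fin.tail y.2)

lemma analyticAt_proj (y : PhaseSpace 𝕜 (m + 1)) : AnalyticAt 𝕜 (proj (𝕜 := 𝕜) (m := m)) y := by
  refine AnalyticAt.prod ?_ ?_
  · exact AnalyticAt.pi fun i => ((ContinuousLinearMap.proj (R := 𝕜) (φ := fun _ => 𝕜) i.succ).comp
      (ContinuousLinearMap.fst 𝕜 (Fin (m + 1) → 𝕜) (Fin (m + 1) → 𝕜))).analyticAt y
  · exact AnalyticAt.pi fun i => ((ContinuousLinearMap.proj (R := 𝕜) (φ := fun _ => 𝕜) i.succ).comp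
      (ContinuousLinearMap.snd 𝕜 (Fin (m + 1) → 𝕜) (Fin (m + 1) → 𝕜))).analyticAt y

/-- The coordinate `p₁` on `𝕜^(2m+2)`. -/
def coordP (y : PhaseSpace 𝕜 (m + 1)) : 𝕜 := y.1 0

lemma analyticAt_coordP (y : PhaseSpace 𝕜 (m + 1)) :
    AnalyticAt 𝕜 (coordP (𝕜 := 𝕜) (m := m)) y :=
  ((ContinuousLinearMap.proj (R := 𝕜) (φ := fun _ => 𝕜) 0).comp
      (ContinuousLinearMap.fst 𝕜 (Fin (m + 1) → 𝕜) (Fin (m + 1) → 𝕜))).analyticAt y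

end PhaseSpace

namespace InvolutiveSubspace

/-- The stalk at `y` of the ideal sheaf of the product `L' × 𝕜 ⊂ 𝕜^(2m) × 𝕜²`, where the factor `𝕜`
is the `q₁`-axis `{p₁ = 0} ⊂ 𝕜²`: it is generated by the ideals of the two factors. -/
def prodLineIdeal {D' : Opens (PhaseSpace 𝕜 m)} (L' : InvolutiveSubspace D')
    (y : PhaseSpace 𝕜 (m + 1)) : Ideal (AnalyticGerm 𝕜 y) :=
  (L'.ideal (proj y)).map (AnalyticGerm.pullback (analyticAt_proj y) rfl) ⊔
    Ideal.span {AnalyticGerm.mk coordP (analyticAt_coordP y)}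

/-- `Φ` exhibits the germ `(L, 0)` as the product `(L', 0) × (𝕜, 0)`: it is a germ of a symplectic
analytic change of coordinates of `(𝕜^(2m+2), 0)` that takes `(L, 0)` to `(L' × 𝕜, 0)`.
(The inverse of `Φ` exists by the inverse function theorem.) -/
structure IsDecomposition {D : Opens (PhaseSpace 𝕜 (m + 1))} {D' : Opens (PhaseSpace 𝕜 m)}
    (L : InvolutiveSubspace D) (L' : InvolutiveSubspace D')
    (Φ : PhaseSpace 𝕜 (m + 1) → PhaseSpace 𝕜 (m + 1)) : Prop where
  map_zero : Φ 0 = 0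
  analyticAt : AnalyticAt 𝕜 Φ 0
  symplectic : ∀ᶠ x in 𝓝 0, ∀ v w, omega (fderiv 𝕜 Φ x v) (fderiv 𝕜 Φ x w) = omega v w
  ideal_eq : ∀ᶠ x in 𝓝 0, ∃ hx : AnalyticAt 𝕜 Φ x,
    L.ideal x = (L'.prodLineIdeal (Φ x)).map (AnalyticGerm.pullback hx rfl)

/-- `ψ` is the image of `φ` under the inclusion
`Hom(Λ^p (I'/I'²), O_{L'}) ⊂ Hom(π^* Λ^p (I'/I'²), O_L) ⊕ Hom(π^* Λ^{p-1} (I'/I'²), O_L)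
  = Hom(Λ^p (I/I²), O_L)`:
it is `π^* φ` on the pullbacks of elements of `I'`, and it vanishes if one of its arguments is the
additional generator `p₁ ∘ Φ` of `I`. -/
def IsCochainPullback {D : Opens (PhaseSpace 𝕜 (m + 1))} {D' : Opens (PhaseSpace 𝕜 m)}
    {L : InvolutiveSubspace D} {L' : InvolutiveSubspace D'}
    (Φ : PhaseSpace 𝕜 (m + 1) → PhaseSpace 𝕜 (m + 1)) {p : ℕ} {x : L.support} {y : L'.support}
    (φ : L'.Cochain p y) (ψ : L.Cochain p x) : Prop :=
  ∃ (hx : AnalyticAt 𝕜 Φ x.1) (hΦ : AnalyticAt 𝕜 (fun z => proj (Φ z)) x.1)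
    (hy : proj (Φ x.1) = y.1),
    (∀ (a : Fin p → L'.ideal y.1) (b : AnalyticGerm 𝕜 y.1) (c : Fin p → L.ideal x.1),
      φ (fun i => toConormal (a i)) = L'.toStalk y b →
      (∀ i, (c i).1 = AnalyticGerm.pullback hΦ hy (a i).1) →
      ψ (fun i => toConormal (c i)) = L.toStalk x (AnalyticGerm.pullback hΦ hy b)) ∧
    (∀ c : Fin p → L.ideal x.1,
      (∃ i, (c i).1 = AnalyticGerm.pullback hx rfl
        (AnalyticGerm.mk coordP (analyticAt_coordP (Φ x.1)))) →
      ψ (fun i => toConormal (c i)) = 0)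

/-- The morphism `j : π⁻¹ C^•_{L'} → C^•_L` is the natural inclusion: the morphism
`C^p_{L'} → π_* C^p_L` that corresponds to it by adjunction sends `φ` to its pullback. -/
def IsNaturalInclusion {D : Opens (PhaseSpace 𝕜 (m + 1))} {D' : Opens (PhaseSpace 𝕜 m)}
    {L : InvolutiveSubspace D} {L' : InvolutiveSubspace D'}
    (Φ : PhaseSpace 𝕜 (m + 1) → PhaseSpace 𝕜 (m + 1)) (π : L.space ⟶ L'.space)
    (j : ((TopCat.Sheaf.pullback (ModuleCat.{u} 𝕜) π).mapHomologicalComplex _).obj L'.complex ⟶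
      L.complex) : Prop :=
  ∀ (p : ℕ) (V : Opens L'.space) (φ : L'.sections p V) (ψ : L.sections p ((Opens.map π).obj V)),
    ψ = ((TopCat.Sheaf.pullbackPushforwardAdjunction (ModuleCat.{u} 𝕜) π).homEquiv
        (L'.complex.X p) (L.complex.X p) (j.f p)).1.app (op V) φ →
    ∀ (x : L.support) (hx : π x ∈ V),
      IsCochainPullback Φ (φ.1 ⟨π x, hx⟩) (ψ.1 ⟨x, hx⟩)

end InvolutiveSubspace
end Decomposition
end

/-! After the symplectic change of coordinates, `L` is `L' × 𝕜`, where `𝕜` is the `q₁`-axis, and `I`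
is generated by `p₁` and by the pullbacks of `I'`. Let `u` be the class of `p₁` in `I/I²`. Two
brackets govern the argument: `{p₁, π^*f} = 0` and `{p₁, g} = ∂g/∂q₁`. Call a cochain horizontal if
it vanishes as soon as one argument is `u`. With the signs of `δ`, Cartan's formula reads `𝓛_u =
-(i_u δ + δ i_u)` (`curryLeft_delta`), and on pullback arguments `𝓛_u` is the derivative along the
lines of `L' × 𝕜`. Hence, locally, the horizontal sections with `𝓛_u ψ = 0` are pullbacks from `L'`
(`exists_descent`), and every horizontal section `η` is `𝓛_u κ` for some horizontal `κ`
(`exists_primitive`).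

Now let `δχ` be horizontal. Choose a horizontal `κ` with `𝓛_u κ = -i_u χ`. Then `i_u δκ = i_u χ`, so
`χ - δκ` is horizontal. Its differential is `δχ`, which is horizontal too, so `𝓛_u (χ - δκ) = 0` by
Cartan's formula and `χ - δκ` is a pullback (`exists_eq_pullback_add_delta`). For `δχ = 0` this is
surjectivity of `j` on cohomology. For `δχ = j(φ)` it gives `χ = j(φ') + δκ`, hence `j(φ) = j(δφ')`,
and `φ = δφ'` because `j` is injective on stalks (`stalkInclusion_injective`). This is injectivity.

The analytic difficulty is that `I/I²` need not be locally free, so cochains cannot be integrated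
coefficient by coefficient. Reducedness helps: an element of `O_L` is determined by its values on
`L`. Sections of `C^p` therefore correspond to families of alternating forms `I_x × ⋯ × I_x → 𝕜`
whose values on local sections of `I` extend to analytic functions
(`IsAnalyticFamily.exists_section`, `IsSection.ext_evForm`). Such families can be integrated point
by point along straight segments, over `ℝ` and `ℂ` alike. Analyticity of the result needs a check
only on finitely many generators of `I'` (`isAnalyticFamily_slForm`, `analyticAt_primitive`).

The quasi-isomorphism is tested on stalks. About the stalks of `π⁻¹F` it is enough to know that
`F_{π(x)} → (π⁻¹F)_x` is surjective (`epi_stalkToPullback`). Exactness of `π⁻¹` turns the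
quasi-isomorphism into the isomorphisms of cohomology sheaves. -/

noncomputable section

/-- Multilinear maps that agree on the tuples of elements of a spanning set are equal. -/
lemma AlternatingMap.ext_of_span_eq_top {R M N ι : Type*} [CommRing R] [AddCommGroup M] [Module R M]
    [AddCommGroup N] [Module R N] [Finite ι] {S : Set M} (hS : Submodule.span R S = ⊤)
    {f g : M [⋀^ι]→ₗ[R] N} (h : ∀ v : ι → M, (∀ i, v i ∈ S) → f v = g v) : f = g := by
  classical
  cases nonempty_fintype ι
  have key : ∀ (s : Finset ι) (v : ι → M), (∀ i ∉ s, v i ∈ S) → f v = g v := by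
    intro s
    induction s using Finset.induction_on with
    | empty => exact fun v hv => h v fun i => hv i (by simp)
    | insert i s hi ih =>
      intro v hv
      have : ∀ x ∈ Submodule.span R S, f (Function.update v i x) = g (Function.update v i x) := by
        intro x hx
        induction hx using Submodule.span_induction with
        | mem x hx =>
          refine ih _ fun k hk => ?_
          by_cases hki : k = i
          · subst hki; simpa using hx
          · simpa [hki] using hv k (by simp [hki, hk])
        | zero => simp [AlternatingMap.map_update_zero]
        | add x y _ _ hx hy => simp only [AlternatingMap.map_update_add, hx, hy]
        | smul a x _ hx => simp only [AlternatingMap.map_update_smul, hx]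
      simpa using this (v i) (hS ▸ Submodule.mem_top)
  ext v
  exact key Finset.univ v (by simp)

/-! ### Values of germs at the base point. -/

namespace AnalyticGerm
variable {𝕜 : Type u} [RCLike 𝕜] {E : Type u} [NormedAddCommGroup E] [NormedSpace 𝕜 E]

/-- Evaluation of a germ at its base point. -/
def ev (x : E) : AnalyticGerm 𝕜 x →ₐ[𝕜] 𝕜 where
  toFun a := a.toGerm.value
  map_one' := rfl
  map_mul' := by
    rintro ⟨_, f, hf, rfl⟩ ⟨_, g, hg, rfl⟩
    rfl
  map_zero' := rfl
  map_add' := by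
    rintro ⟨_, f, hf, rfl⟩ ⟨_, g, hg, rfl⟩
    rfl
  commutes' _ := rfl

@[simp] lemma ev_mk {x : E} (f : E → 𝕜) (hf : AnalyticAt 𝕜 f x) : ev x (mk f hf) = f x := rfl

/-- Germs act on the base field by evaluation. -/
instance evModule (x : E) : Module (AnalyticGerm 𝕜 x) 𝕜 := Module.compHom 𝕜 (ev x).toRingHom

lemma smul_eq_ev_mul {x : E} (a : AnalyticGerm 𝕜 x) (c : 𝕜) : a • c = ev x a * c := rfl

/-- The reciprocal of a non-vanishing analytic function is analytic. So an ideal is proper exactly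
if its elements vanish at the base point, and membership in `support` becomes a question about
values. -/
lemma isUnit_of_ev_ne_zero {x : E} {a : AnalyticGerm 𝕜 x} (h : ev x a ≠ 0) : IsUnit a := by
  obtain ⟨f, hf, rfl⟩ := exists_mk a
  refine IsUnit.of_mul_eq_one (mk f⁻¹ (hf.inv h)) (toGerm_injective (Germ.coe_eq.mpr ?_))
  filter_upwards [hf.continuousAt.eventually_ne h] with y hy
  exact mul_inv_cancel₀ hy

lemma ev_eq_zero_of_mem {x : E} {I : Ideal (AnalyticGerm 𝕜 x)} (hI : I ≠ ⊤) {a : AnalyticGerm 𝕜 x}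
    (ha : a ∈ I) : ev x a = 0 := by
  by_contra h
  exact hI (Ideal.eq_top_of_isUnit_mem _ ha (isUnit_of_ev_ne_zero h))

lemma ne_top_of_ev_eq_zero {x : E} {I : Ideal (AnalyticGerm 𝕜 x)}
    (h : ∀ a ∈ I, ev x a = 0) : I ≠ ⊤ := by
  rintro rfl
  exact one_ne_zero (α := 𝕜) ((map_one (ev x)).symm.trans (h 1 trivial))

variable {F : Type u} [NormedAddCommGroup F] [NormedSpace 𝕜 F]

lemma pullback_mk {ψ : E → F} {x : E} {y : F} (hψ : AnalyticAt 𝕜 ψ x) (hy : ψ x = y) (f : F → 𝕜)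
    (hf : AnalyticAt 𝕜 f y) :
    pullback hψ hy (mk f hf) = mk (f ∘ ψ) (AnalyticAt.comp (hy ▸ hf) hψ) := rfl

lemma ev_pullback {ψ : E → F} {x : E} {y : F} (hψ : AnalyticAt 𝕜 ψ x) (hy : ψ x = y)
    (a : AnalyticGerm 𝕜 y) : ev x (pullback hψ hy a) = ev y a := by
  obtain ⟨f, hf, rfl⟩ := exists_mk a
  rw [pullback_mk, ev_mk, ev_mk, ← hy]
  rfl

lemma mk_eq_of_toGerm {x : E} {a : AnalyticGerm 𝕜 x} {f : E → 𝕜}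
    (h : a.toGerm = (f : Germ (𝓝 x) 𝕜)) : ∃ hf, a = mk f hf := by
  obtain ⟨g, hg, rfl⟩ := exists_mk a
  have : g =ᶠ[𝓝 x] f := Germ.coe_eq.mp h
  exact ⟨hg.congr this, mk_eq_mk.mpr this⟩

end AnalyticGerm

/-! ### Local sections of the ideal sheaf; `O_L` as a sheaf of functions. -/

namespace InvolutiveSubspace
open PhaseSpace AnalyticGerm

variable {𝕜 : Type u} [RCLike 𝕜] {n : ℕ} {D : Opens (PhaseSpace 𝕜 n)} {L : InvolutiveSubspace D}

/-- `f` is, near `x`, a section of the ideal sheaf. -/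
def LocallyMem (L : InvolutiveSubspace D) (f : PhaseSpace 𝕜 n → 𝕜) (x : PhaseSpace 𝕜 n) : Prop :=
  ∀ᶠ z in 𝓝 x, ∃ a ∈ L.ideal z, a.toGerm = (f : Germ (𝓝 z) 𝕜)

lemma LocallyMem.eventually {f : PhaseSpace 𝕜 n → 𝕜} {x : PhaseSpace 𝕜 n} (h : L.LocallyMem f x) :
    ∀ᶠ z in 𝓝 x, L.LocallyMem f z := eventually_eventually_nhds.mpr h

lemma LocallyMem.analyticAt {f : PhaseSpace 𝕜 n → 𝕜} {x : PhaseSpace 𝕜 n} (h : L.LocallyMem f x) :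
    AnalyticAt 𝕜 f x := by
  obtain ⟨a, _, ha⟩ := h.self_of_nhds
  exact (mk_eq_of_toGerm ha).1

lemma LocallyMem.mem {f : PhaseSpace 𝕜 n → 𝕜} {x : PhaseSpace 𝕜 n} (h : L.LocallyMem f x) :
    AnalyticGerm.mk f h.analyticAt ∈ L.ideal x := by
  obtain ⟨a, h1, ha⟩ := h.self_of_nhds
  obtain ⟨_, rfl⟩ := mk_eq_of_toGerm ha
  exact h1

/-- The germ of a local section of the ideal sheaf. -/
def LocallyMem.germ {f : PhaseSpace 𝕜 n → 𝕜} {x : PhaseSpace 𝕜 n} (h : L.LocallyMem f x) :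
    L.ideal x := ⟨AnalyticGerm.mk f h.analyticAt, h.mem⟩

lemma LocallyMem.eq_germ {f : PhaseSpace 𝕜 n → 𝕜} {x : PhaseSpace 𝕜 n} (h : L.LocallyMem f x)
    (a : L.ideal x) (ha : a.1.toGerm = (f : Germ (𝓝 x) 𝕜)) : a = h.germ :=
  Subtype.ext (toGerm_injective ha)

/-- This is what finite type is for: a combination of the generators at `x` has coefficients that
are analytic near `x`, and the same functions generate the ideals of the nearby points. -/
lemma locallyMem_of_mem {x : PhaseSpace 𝕜 n} (hx : x ∈ D) {f : PhaseSpace 𝕜 n → 𝕜}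
    (hf : AnalyticAt 𝕜 f x) (h : AnalyticGerm.mk f hf ∈ L.ideal x) : L.LocallyMem f x := by
  obtain ⟨s, hs, H⟩ := L.finite_type x hx
  have key : ∀ a ∈ L.ideal x, ∃ (g : PhaseSpace 𝕜 n → 𝕜), a.toGerm = (g : Germ (𝓝 x) 𝕜) ∧
      ∀ᶠ z in 𝓝 x, ∃ a ∈ L.ideal z, a.toGerm = (g : Germ (𝓝 z) 𝕜) := by
    intro a ha
    rw [H.self_of_nhds] at ha
    induction ha using Submodule.span_induction with
    | mem a ha =>
      obtain ⟨f, hfs, hf⟩ := ha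
      refine ⟨f, hf, ?_⟩
      filter_upwards [H, (hs f hfs).eventually_analyticAt] with z hz hfz
      refine ⟨AnalyticGerm.mk f hfz, ?_, rfl⟩
      rw [hz]
      exact Ideal.subset_span ⟨f, hfs, rfl⟩
    | zero => exact ⟨0, rfl, Eventually.of_forall fun z => ⟨0, zero_mem _, rfl⟩⟩
    | add a b _ _ ha hb =>
      obtain ⟨f, hf, hf'⟩ := ha
      obtain ⟨g, hg, hg'⟩ := hb
      refine ⟨f + g, ?_, ?_⟩
      · change a.toGerm + b.toGerm = _
        rw [hf, hg]; rfl
      · filter_upwards [hf', hg'] with z ⟨a, ha, ha'⟩ ⟨b, hb, hb'⟩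
        refine ⟨a + b, add_mem ha hb, ?_⟩
        change a.toGerm + b.toGerm = _
        rw [ha', hb']; rfl
    | smul c a _ ha =>
      obtain ⟨f, hf, hf'⟩ := ha
      obtain ⟨g, hg, rfl⟩ := exists_mk c
      refine ⟨g * f, ?_, ?_⟩
      · change (g : Germ (𝓝 x) 𝕜) * a.toGerm = _
        rw [hf]; rfl
      · filter_upwards [hf', hg.eventually_analyticAt] with z ⟨a, ha, ha'⟩ hgz
        refine ⟨AnalyticGerm.mk g hgz * a, Ideal.mul_mem_left _ _ ha, ?_⟩
        change (g : Germ (𝓝 z) 𝕜) * a.toGerm = _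
        rw [ha']; rfl
  obtain ⟨g, hg, H⟩ := key _ h
  have e : f =ᶠ[𝓝 x] g := Germ.coe_eq.mp hg
  filter_upwards [H, e.eventuallyEq_nhds] with z ⟨a, ha, ha'⟩ hz
  exact ⟨a, ha, ha'.trans (Germ.coe_eq.mpr hz.symm)⟩

lemma exists_locallyMem {x : PhaseSpace 𝕜 n} (hx : x ∈ D) (a : L.ideal x) :
    ∃ (f : PhaseSpace 𝕜 n → 𝕜) (h : L.LocallyMem f x), a = h.germ := by
  obtain ⟨f, hf, h⟩ := exists_mk a.1
  have := locallyMem_of_mem hx hf (h ▸ a.2)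
  exact ⟨f, this, this.eq_germ a (by rw [h]; rfl)⟩

lemma LocallyMem.eq_zero {f : PhaseSpace 𝕜 n → 𝕜} {x : PhaseSpace 𝕜 n} (h : L.LocallyMem f x)
    (hx : x ∈ L.support) : f x = 0 := ev_eq_zero_of_mem hx.2 h.mem

/-- Finite type gives one direction, reducedness the other. From here on, identities in `O_{L,x}`
are proved by comparing values at the points of `L` near `x`. -/
lemma mk_mem_ideal_iff (hL : L.IsReduced) {x : PhaseSpace 𝕜 n} (hx : x ∈ D)
    {f : PhaseSpace 𝕜 n → 𝕜} (hf : AnalyticAt 𝕜 f x) :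
    AnalyticGerm.mk f hf ∈ L.ideal x ↔ ∀ᶠ y in 𝓝 x, y ∈ L.support → f y = 0 := by
  refine ⟨fun h => ?_, hL x hx f hf⟩
  filter_upwards [(locallyMem_of_mem hx hf h).eventually] with y hy hys
  exact hy.eq_zero hys

lemma IsReduced.restrict (hL : L.IsReduced) (W : Opens (PhaseSpace 𝕜 n)) (hW : W ≤ D) :
    (L.restrict W hW).IsReduced := by
  intro x hx f hf h
  refine hL x (hW hx) f hf ?_
  filter_upwards [h, W.2.mem_nhds hx] with y hy hyW hyL
  exact hy ⟨hyW, hyL.2⟩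

/-- The value of an element of `O_{L,x}` at `x`. -/
def evStalk (x : L.support) : L.Stalk x →ₐ[𝕜] 𝕜 :=
  Ideal.Quotient.liftₐ (L.ideal x.1) (ev x.1) fun _ ha => ev_eq_zero_of_mem x.2.2 ha

lemma toStalk_mk_eq_iff (hL : L.IsReduced) {x : L.support} {f g : PhaseSpace 𝕜 n → 𝕜}
    (hf : AnalyticAt 𝕜 f x.1) (hg : AnalyticAt 𝕜 g x.1) :
    L.toStalk x (AnalyticGerm.mk f hf) = L.toStalk x (AnalyticGerm.mk g hg) ↔
      ∀ᶠ y in 𝓝 x.1, y ∈ L.support → f y = g y := by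
  rw [toStalk_eq]
  have : AnalyticGerm.mk f hf - AnalyticGerm.mk g hg = AnalyticGerm.mk (f - g) (hf.sub hg) := rfl
  rw [this, mk_mem_ideal_iff hL x.2.1]
  simp only [Pi.sub_apply, sub_eq_zero]

lemma eventually_support {P : L.support → Prop} {x : L.support} :
    (∀ᶠ z in 𝓝 x.1, ∀ hz : z ∈ L.support, P ⟨z, hz⟩) ↔ ∀ᶠ z in 𝓝 x, P z := by
  rw [nhds_subtype_eq_comap, eventually_comap]
  exact ⟨fun h => h.mono fun z hz a ha => by subst ha; exact hz a.2,
    fun h => h.mono fun z hz hzL => hz _ rfl⟩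

end InvolutiveSubspace
end

/-! ### Sections of the cochain sheaf as analytic families of `𝕜`-valued forms. -/

noncomputable section

lemma AlternatingMap.congr_of_sub_mem {R M N ι : Type*} [CommRing R] [AddCommGroup M] [Module R M]
    [AddCommGroup N] [Module R N] [Finite ι] (f : M [⋀^ι]→ₗ[R] N) (K : Submodule R M)
    (hK : ∀ v i, v i ∈ K → f v = 0) {v w : ι → M} (h : ∀ i, v i - w i ∈ K) : f v = f w := by
  classical
  cases nonempty_fintype ι
  have key : ∀ s : Finset ι, f (s.piecewise w v) = f v := by
    intro s
    induction s using Finset.induction_on with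
    | empty => simp
    | insert i s hi ih =>
      rw [Finset.piecewise_insert, ← ih, ← sub_eq_zero, ← neg_eq_zero, neg_sub,
        ← Function.update_eq_self i (s.piecewise w v), Function.update_idem,
        ← AlternatingMap.map_update_sub]
      refine hK _ i ?_
      simpa [hi] using h i
  have := key Finset.univ
  rw [Finset.piecewise_univ] at this
  exact this.symm

namespace InvolutiveSubspace
open PhaseSpace AnalyticGerm

variable {𝕜 : Type u} [RCLike 𝕜] {n : ℕ} {D : Opens (PhaseSpace 𝕜 n)} {L : InvolutiveSubspace D}

instance stalkModule (x : L.support) : Module (AnalyticGerm 𝕜 x.1) (L.Stalk x) :=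
  Module.compHom _ (L.toStalk x).toRingHom

lemma smul_stalk_eq {x : L.support} (c : AnalyticGerm 𝕜 x.1) (s : L.Stalk x) :
    c • s = L.toStalk x c * s := rfl

lemma toConormal_smul_germ {x : L.support} (c : AnalyticGerm 𝕜 x.1) (a : L.ideal x.1) :
    toConormal (c • a) = L.toStalk x c • (toConormal a : L.Conormal x) := rfl

/-- `O_L` is annihilated by `I`: for `s, t ∈ I` one has `f(st, …) = s f(t, …) = 0`. So forms on
`I_x` with values in `O_{L,x}` are forms on `I_x / I_x²`, and it is possible to work with germs in
place of classes. -/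
lemma map_congr_toConormal {p : ℕ} {x : L.support}
    (f : (L.ideal x.1) [⋀^Fin p]→ₗ[AnalyticGerm 𝕜 x.1] L.Stalk x) {a b : Fin p → L.ideal x.1}
    (h : ∀ i, (toConormal (a i) : L.Conormal x) = toConormal (b i)) : f a = f b := by
  refine f.congr_of_sub_mem
    (Submodule.comap (Submodule.subtype (L.ideal x.1)) (L.ideal x.1 ^ 2)) ?_ ?_
  · intro v i hv
    have : ∀ c ∈ L.ideal x.1 * L.ideal x.1, ∃ hc : c ∈ L.ideal x.1,
        f (Function.update v i ⟨c, hc⟩) = 0 := by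
      intro c hc
      refine Submodule.mul_induction_on hc ?_ ?_
      · intro s hs t ht
        refine ⟨Ideal.mul_mem_left _ _ ht, ?_⟩
        have : (⟨s * t, Ideal.mul_mem_left _ _ ht⟩ : L.ideal x.1) = s • (⟨t, ht⟩ : L.ideal x.1) :=
          rfl
        rw [this, f.map_update_smul, smul_stalk_eq]
        have : L.toStalk x s = 0 := Ideal.Quotient.eq_zero_iff_mem.mpr hs
        rw [this, zero_mul]
      · rintro s t ⟨hs', hs⟩ ⟨ht', ht⟩
        refine ⟨add_mem hs' ht', ?_⟩
        have : (⟨s + t, add_mem hs' ht'⟩ : L.ideal x.1) = ⟨s, hs'⟩ + ⟨t, ht'⟩ := rfl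
        rw [this, f.map_update_add, hs, ht, add_zero]
    obtain ⟨hc, h2⟩ := this (v i).1 (by rw [← pow_two]; exact hv)
    simpa using h2
  · intro i
    exact toConormal_eq.mp (h i)

/-- A representative of a class in `I_x / I_x²`. -/
def Conormal.out {x : L.support} (u : L.Conormal x) : L.ideal x.1 :=
  (toConormal_surjective u).choose

@[simp] lemma toConormal_out {x : L.support} (u : L.Conormal x) : toConormal u.out = u :=
  (toConormal_surjective u).choose_spec

/-- The chosen representatives `out` are neither additive nor homogeneous. This permits any other
representative in the slot under consideration. -/
lemma map_update_out {p : ℕ} {x : L.support} [DecidableEq (Fin p)]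
    (f : (L.ideal x.1) [⋀^Fin p]→ₗ[AnalyticGerm 𝕜 x.1] L.Stalk x) (v : Fin p → L.Conormal x)
    (i : Fin p) (c : L.Conormal x) (a : L.ideal x.1) (ha : toConormal a = c) :
    f (fun k => (Function.update v i c k).out) =
      f (Function.update (fun k => (v k).out) i a) := by
  refine map_congr_toConormal f fun k => ?_
  by_cases hk : k = i
  · subst hk; simp [ha]
  · simp [hk]

/-- A form on `I_x` with values in `O_{L,x}` kills `I_x²`. -/
def Cochain.ofIdeal {p : ℕ} {x : L.support}
    (f : (L.ideal x.1) [⋀^Fin p]→ₗ[AnalyticGerm 𝕜 x.1] L.Stalk x) : L.Cochain p x where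
  toFun u := f (fun i => (u i).out)
  map_update_add' := by
    intro _ v i a b
    rw [map_update_out f v i a _ (toConormal_out a), map_update_out f v i b _ (toConormal_out b),
      map_update_out f v i (a + b) (a.out + b.out) (by simp [toConormal_add]), f.map_update_add]
  map_update_smul' := by
    intro _ v i c a
    obtain ⟨c, rfl⟩ := L.toStalk_surjective c
    rw [map_update_out f v i a _ (toConormal_out a), map_update_out f v i _ (c • a.out)
      (by rw [toConormal_smul_germ, toConormal_out]), f.map_update_smul, smul_stalk_eq, smul_eq_mul]
  map_eq_zero_of_eq' := fun v i j hij hne => f.map_eq_zero_of_eq _ (by simp [hij]) hne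

lemma Cochain.ofIdeal_apply {p : ℕ} {x : L.support}
    (f : (L.ideal x.1) [⋀^Fin p]→ₗ[AnalyticGerm 𝕜 x.1] L.Stalk x) (a : Fin p → L.ideal x.1) :
    Cochain.ofIdeal f (fun i => toConormal (a i)) = f a :=
  map_congr_toConormal f fun _ => toConormal_out _

/-- A cochain at `x` as a form on `I_x`. -/
def Cochain.toIdeal {p : ℕ} {x : L.support} (φ : L.Cochain p x) :
    (L.ideal x.1) [⋀^Fin p]→ₗ[AnalyticGerm 𝕜 x.1] L.Stalk x where
  toFun a := φ (fun i => toConormal (a i))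
  map_update_add' := by
    intro _ v i a b
    have h : ∀ c : L.ideal x.1, (fun k => (toConormal (Function.update v i c k) : L.Conormal x)) =
        Function.update (fun k => toConormal (v k)) i (toConormal c) :=
      fun c => Function.comp_update (toConormal (L := L) (x := x)) v i c
    rw [h, h, h, toConormal_add, φ.map_update_add]
  map_update_smul' := by
    intro _ v i c a
    have h : ∀ c : L.ideal x.1, (fun k => (toConormal (Function.update v i c k) : L.Conormal x)) =
        Function.update (fun k => toConormal (v k)) i (toConormal c) :=
      fun c => Function.comp_update (toConormal (L := L) (x := x)) v i c
    rw [h, h, toConormal_smul_germ, φ.map_update_smul]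
    rfl
  map_eq_zero_of_eq' := fun v i j hij hne =>
    φ.map_eq_zero_of_eq _ (congrArg (toConormal (L := L) (x := x)) hij) hne

lemma Cochain.toIdeal_apply {p : ℕ} {x : L.support} (φ : L.Cochain p x)
    (a : Fin p → L.ideal x.1) : φ.toIdeal a = φ (fun i => toConormal (a i)) := rfl

lemma Cochain.toIdeal_injective {p : ℕ} {x : L.support} {φ ψ : L.Cochain p x}
    (h : φ.toIdeal = ψ.toIdeal) : φ = ψ := by
  ext u
  have := DFunLike.congr_fun h (fun i => (u i).out)
  simpa [toIdeal_apply] using this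

/-- Evaluation at `x` as a linear map. -/
def evLinear (x : L.support) : L.Stalk x →ₗ[AnalyticGerm 𝕜 x.1] 𝕜 where
  toFun := evStalk x
  map_add' := map_add _
  map_smul' c s := by
    rw [smul_stalk_eq, map_mul]
    rfl

variable (L) in
/-- The `p`-forms on the fibre `I_x / m_x I_x` of the ideal sheaf. -/
abbrev PointForm (p : ℕ) (x : PhaseSpace 𝕜 n) : Type u :=
  (L.ideal x) [⋀^Fin p]→ₗ[AnalyticGerm 𝕜 x] 𝕜

/-- The value of a cochain at the base point. -/
def Cochain.evForm {p : ℕ} {x : L.support} (φ : L.Cochain p x) : L.PointForm p x.1 :=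
  (evLinear x).compAlternatingMap φ.toIdeal

lemma Cochain.evForm_apply {p : ℕ} {x : L.support} (φ : L.Cochain p x)
    (a : Fin p → L.ideal x.1) :
    φ.evForm a = evStalk x (φ (fun i => toConormal (a i))) := rfl

section Sections
variable {V : Opens L.space}

lemma nhds_opens_eq (y : V) : 𝓝 y = comap (fun z : V => z.1.1) (𝓝 y.1.1) :=
  ((IsInducing.subtypeVal (t := L.support)).comp
    (IsInducing.subtypeVal (t := (V : Set L.support)))).nhds_eq_comap y

lemma eventually_opens {y : V} {P : V → Prop} :
    (∀ᶠ z in 𝓝 y.1.1, ∀ (hz : z ∈ L.support) (hzV : (⟨z, hz⟩ : L.support) ∈ V),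
      P ⟨⟨z, hz⟩, hzV⟩) ↔ ∀ᶠ z in 𝓝 y, P z := by
  rw [nhds_opens_eq, eventually_comap]
  exact ⟨fun h => h.mono fun z hz a ha => by subst ha; exact hz a.1.2 a.2,
    fun h => h.mono fun z hz h1 h2 => hz ⟨⟨z, h1⟩, h2⟩ rfl⟩

lemma eventually_of_nhds {y : V} {P : PhaseSpace 𝕜 n → Prop} (h : ∀ᶠ z in 𝓝 y.1.1, P z) :
    ∀ᶠ z in 𝓝 y, P z.1.1 :=
  eventually_opens.mp (h.mono fun _ hz _ _ => hz)

lemma toStalk_mk_eq_iff_opens (hL : L.IsReduced) {y : V} {f g : PhaseSpace 𝕜 n → 𝕜}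
    (hf : AnalyticAt 𝕜 f y.1.1) (hg : AnalyticAt 𝕜 g y.1.1) :
    L.toStalk y.1 (AnalyticGerm.mk f hf) = L.toStalk y.1 (AnalyticGerm.mk g hg) ↔
      ∀ᶠ z in 𝓝 y, f z.1.1 = g z.1.1 := by
  rw [toStalk_mk_eq_iff hL, ← eventually_opens (P := fun z => f z.1.1 = g z.1.1)]
  have hV : ∀ᶠ z in 𝓝 y.1.1, ∀ hz : z ∈ L.support, (⟨z, hz⟩ : L.support) ∈ V :=
    eventually_support.mpr (V.2.mem_nhds y.2)
  constructor
  · exact fun h => h.mono fun z hz h1 _ => hz h1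
  · intro h
    filter_upwards [h, hV] with z hz hzV h1
    exact hz h1 (hzV h1)

/-- `IsSection` speaks of neighbourhoods in the phase space and of arbitrary germs; here both are
replaced by neighbourhoods in `V` and by the canonical germs of the given functions. -/
lemma isSection_iff {p : ℕ} {φ : ∀ x : V, L.Cochain p x.1} :
    IsSection φ ↔ ∀ (y : V) (h : Fin p → PhaseSpace 𝕜 n → 𝕜), (∀ i, L.LocallyMem (h i) y.1.1) →
      ∃ g : PhaseSpace 𝕜 n → 𝕜, AnalyticAt 𝕜 g y.1.1 ∧ ∀ᶠ z in 𝓝 y,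
        ∀ (hm : ∀ i, L.LocallyMem (h i) z.1.1) (hg : AnalyticAt 𝕜 g z.1.1),
        φ z (fun i => toConormal (hm i).germ) = L.toStalk z.1 (AnalyticGerm.mk g hg) := by
  refine forall_congr' fun y => forall_congr' fun h => forall_congr' fun hh =>
    exists_congr fun g => and_congr_right fun hg => ?_
  rw [← eventually_opens (y := y) (P := fun z => ∀ (hm : ∀ i, L.LocallyMem (h i) z.1.1)
    (hg : AnalyticAt 𝕜 g z.1.1),
        φ z (fun i => toConormal (hm i).germ) = L.toStalk z.1 (AnalyticGerm.mk g hg))]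
  constructor
  · exact fun H => H.mono fun z hz h1 h2 hm hg => hz h1 h2 _ _ (fun i => rfl) rfl
  · intro H
    filter_upwards [H, eventually_all.mpr fun i => LocallyMem.eventually (hh i),
      hg.eventually_analyticAt] with z hz hm hgz h1 h2 a b ha hb
    have : a = fun i => (hm i).germ := funext fun i => (hm i).eq_germ _ (ha i)
    rw [this, hz h1 h2 hm hgz, ← toGerm_injective (a := b) (b := AnalyticGerm.mk g hgz) hb]

/-- A family of point forms that depends analytically on the point. -/
def IsAnalyticFamily {p : ℕ} (F : ∀ x : V, L.PointForm p x.1.1) : Prop :=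
  ∀ (y : V) (h : Fin p → PhaseSpace 𝕜 n → 𝕜), (∀ i, L.LocallyMem (h i) y.1.1) →
      ∃ g : PhaseSpace 𝕜 n → 𝕜, AnalyticAt 𝕜 g y.1.1 ∧ ∀ᶠ z in 𝓝 y,
        ∀ (hm : ∀ i, L.LocallyMem (h i) z.1.1), F z (fun i => (hm i).germ) = g z.1.1

lemma IsSection.isAnalyticFamily {p : ℕ} {φ : ∀ x : V, L.Cochain p x.1} (hφ : IsSection φ) :
    IsAnalyticFamily (fun x => (φ x).evForm) := by
  intro y h hh
  obtain ⟨g, hg, H⟩ := isSection_iff.mp hφ y h hh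
  refine ⟨g, hg, ?_⟩
  filter_upwards [H, eventually_of_nhds hg.eventually_analyticAt] with z hz hgz hm
  rw [Cochain.evForm_apply, hz hm hgz]
  rfl

/-- A function that represents an element of the ideal `I_y`. -/
def repr {y : L.support} (a : L.ideal y.1) : PhaseSpace 𝕜 n → 𝕜 :=
  (exists_locallyMem y.2.1 a).choose

lemma locallyMem_repr {y : L.support} (a : L.ideal y.1) : L.LocallyMem (repr a) y.1 :=
  (exists_locallyMem y.2.1 a).choose_spec.choose

lemma germ_repr {y : L.support} (a : L.ideal y.1) : (locallyMem_repr a).germ = a :=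
  (exists_locallyMem y.2.1 a).choose_spec.choose_spec.symm

open Classical in
/-- The germ at `z` of a representative of a germ `a` at `y`. -/
def spread {y : L.support} (z : PhaseSpace 𝕜 n) (a : L.ideal y.1) : L.ideal z :=
  -- The value `0` is a dummy: for `z` near `y` the first case applies.
  if h : L.LocallyMem (repr a) z then h.germ else 0

lemma spread_of_locallyMem {y : L.support} {z : PhaseSpace 𝕜 n} (a : L.ideal y.1)
    (h : L.LocallyMem (repr a) z) : spread z a = h.germ := dif_pos h

lemma eventually_spread_eq {y : L.support} (a : L.ideal y.1) {f : PhaseSpace 𝕜 n → 𝕜}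
    (hf : L.LocallyMem f y.1) (h : hf.germ = a) :
    ∀ᶠ z in 𝓝 y.1, ∃ hz : L.LocallyMem f z, spread z a = hz.germ := by
  have h1 : f =ᶠ[𝓝 y.1] repr a := 
    Germ.coe_eq.mp (congrArg (fun b : L.ideal y.1 => b.1.toGerm) (h.trans (germ_repr a).symm))
  filter_upwards [h1.eventuallyEq_nhds, hf.eventually, (locallyMem_repr a).eventually]
    with z hz hfz haz
  refine ⟨hfz, ?_⟩
  rw [spread_of_locallyMem a haz]
  exact Subtype.ext (toGerm_injective (Germ.coe_eq.mpr hz.symm))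

/-- The representatives of `a`, `b` and `a + b` are chosen independently. They are compatible only
as germs at `y`, hence on a neighbourhood of `y` that depends on `a` and `b`. -/
lemma eventually_spread_add {y : L.support} (a b : L.ideal y.1) :
    ∀ᶠ z in 𝓝 y.1, spread z (a + b) = spread z a + spread z b := by
  have h : (repr (a + b)) =ᶠ[𝓝 y.1] repr a + repr b := by
    have h1 := congrArg Subtype.val (germ_repr (a + b))
    have h2 := congrArg Subtype.val (germ_repr a)
    have h3 := congrArg Subtype.val (germ_repr b)
    have h4 : (a + b : L.ideal y.1).1 = a.1 + b.1 := rfl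
    rw [h4, ← h2, ← h3] at h1
    exact Germ.coe_eq.mp (congrArg toGerm h1)
  filter_upwards [h.eventuallyEq_nhds, (locallyMem_repr a).eventually,
    (locallyMem_repr b).eventually, (locallyMem_repr (a + b)).eventually] with z hz h1 h2 h3
  rw [spread_of_locallyMem a h1, spread_of_locallyMem b h2, spread_of_locallyMem _ h3]
  exact Subtype.ext (toGerm_injective (Germ.coe_eq.mpr hz))

lemma eventually_spread_smul {y : L.support} {f : PhaseSpace 𝕜 n → 𝕜} (hf : AnalyticAt 𝕜 f y.1)
    (a : L.ideal y.1) :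
    ∀ᶠ z in 𝓝 y.1, ∃ hz : AnalyticAt 𝕜 f z,
      spread z (AnalyticGerm.mk f hf • a) = AnalyticGerm.mk f hz • spread z a := by
  have h : (repr (AnalyticGerm.mk f hf • a)) =ᶠ[𝓝 y.1] f * repr a := by
    have h1 := congrArg Subtype.val (germ_repr (AnalyticGerm.mk f hf • a))
    have h2 := congrArg Subtype.val (germ_repr a)
    have h4 : (AnalyticGerm.mk f hf • a : L.ideal y.1).1 = AnalyticGerm.mk f hf * a.1 := rfl
    rw [h4, ← h2] at h1
    exact Germ.coe_eq.mp (congrArg toGerm h1)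
  filter_upwards [h.eventuallyEq_nhds, (locallyMem_repr a).eventually,
    (locallyMem_repr (AnalyticGerm.mk f hf • a)).eventually, hf.eventually_analyticAt]
    with z hz h1 h3 hfz
  refine ⟨hfz, ?_⟩
  rw [spread_of_locallyMem a h1, spread_of_locallyMem _ h3]
  exact Subtype.ext (toGerm_injective (Germ.coe_eq.mpr hz))

lemma spread_self {y : L.support} (a : L.ideal y.1) : spread y.1 a = a := by
  rw [spread_of_locallyMem a (locallyMem_repr a), germ_repr]

section Family
variable {p : ℕ} {F : ∀ x : V, L.PointForm p x.1.1}

lemma IsAnalyticFamily.exists_spread (hF : IsAnalyticFamily F) (y : V)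
    (a : Fin p → L.ideal y.1.1) : ∃ g : PhaseSpace 𝕜 n → 𝕜, AnalyticAt 𝕜 g y.1.1 ∧
      ∀ᶠ z in 𝓝 y, F z (fun i => spread z.1.1 (a i)) = g z.1.1 := by
  obtain ⟨g, hg, H⟩ := hF y (fun i => repr (a i)) (fun i => locallyMem_repr (a i))
  refine ⟨g, hg, ?_⟩
  filter_upwards [H, eventually_of_nhds (eventually_all.mpr fun i =>
    (locallyMem_repr (a i)).eventually)] with z hz hm
  rw [← hz hm]
  exact congrArg _ (funext fun i => spread_of_locallyMem (a i) (hm i))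

/-- The function `z ↦ F_z(a)`, extended analytically from `L` to the phase space. -/
def IsAnalyticFamily.fn (hF : IsAnalyticFamily F) (y : V) (a : Fin p → L.ideal y.1.1) :
    PhaseSpace 𝕜 n → 𝕜 := (hF.exists_spread y a).choose

lemma IsAnalyticFamily.analyticAt_fn (hF : IsAnalyticFamily F) (y : V)
    (a : Fin p → L.ideal y.1.1) : AnalyticAt 𝕜 (hF.fn y a) y.1.1 :=
  (hF.exists_spread y a).choose_spec.1

lemma IsAnalyticFamily.eventually_fn (hF : IsAnalyticFamily F) (y : V)
    (a : Fin p → L.ideal y.1.1) :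
    ∀ᶠ z in 𝓝 y, F z (fun i => spread z.1.1 (a i)) = hF.fn y a z.1.1 :=
  (hF.exists_spread y a).choose_spec.2

/-- The form on `I_y` with values in `O_{L,y}` that is defined by an analytic family. -/
def IsAnalyticFamily.form (hF : IsAnalyticFamily F) (hL : L.IsReduced) (y : V) :
    (L.ideal y.1.1) [⋀^Fin p]→ₗ[AnalyticGerm 𝕜 y.1.1] L.Stalk y.1 where
  toFun a := L.toStalk y.1 (AnalyticGerm.mk _ (hF.analyticAt_fn y a))
  map_update_add' := by
    intro _ v i a b
    rw [← map_add]
    -- Equality in `O_{L,y}` is tested at the points `z` of `L` near `y`, where it is the additivity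
    -- of the form `F z`.
    refine (toStalk_mk_eq_iff_opens hL _
      ((hF.analyticAt_fn y _).add (hF.analyticAt_fn y _))).mpr ?_
    filter_upwards [hF.eventually_fn y (Function.update v i (a + b)),
      hF.eventually_fn y (Function.update v i a), hF.eventually_fn y (Function.update v i b),
      eventually_of_nhds (eventually_spread_add a b)] with z h1 h2 h3 h4
    have h : ∀ c : L.ideal y.1.1, (fun k => spread z.1.1 (Function.update v i c k)) =
        Function.update (fun k => spread z.1.1 (v k)) i (spread z.1.1 c) :=
      fun c => Function.comp_update (spread z.1.1) v i c
    rw [← h1, Pi.add_apply, ← h2, ← h3, h, h, h, h4, (F z).map_update_add]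
  map_update_smul' := by
    intro _ v i c a
    obtain ⟨f, hf, rfl⟩ := exists_mk c
    rw [smul_stalk_eq, ← map_mul]
    refine (toStalk_mk_eq_iff_opens hL _ (hf.mul (hF.analyticAt_fn y _))).mpr ?_
    filter_upwards [hF.eventually_fn y (Function.update v i (AnalyticGerm.mk f hf • a)),
      hF.eventually_fn y (Function.update v i a),
      eventually_of_nhds (eventually_spread_smul hf a)] with z h1 h2 ⟨hz, h4⟩
    have h : ∀ c : L.ideal y.1.1, (fun k => spread z.1.1 (Function.update v i c k)) =
        Function.update (fun k => spread z.1.1 (v k)) i (spread z.1.1 c) :=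
      fun c => Function.comp_update (spread z.1.1) v i c
    rw [← h1, Pi.mul_apply, ← h2, h, h, h4, (F z).map_update_smul]
    rfl
  map_eq_zero_of_eq' := by
    intro v i j hij hne
    rw [← map_zero (L.toStalk y.1)]
    refine (toStalk_mk_eq_iff_opens hL _ analyticAt_const).mpr ?_
    filter_upwards [hF.eventually_fn y v] with z hz
    rw [← hz]
    exact (F z).map_eq_zero_of_eq _ (congrArg (spread z.1.1) hij) hne

/-- At a point `z` near `y` the form is defined by representatives chosen at `z`, whereas `g`
belongs to the functions `h` fixed at `y`. Both have the values `F w (h)` at the points `w` of `L`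
near `z`, so they agree in `O_{L,z}`. -/
lemma IsAnalyticFamily.isSection_form (hF : IsAnalyticFamily F) (hL : L.IsReduced) :
    IsSection (fun y => Cochain.ofIdeal (hF.form hL y)) := by
  rw [isSection_iff]
  intro y h hh
  obtain ⟨g, hg, H⟩ := hF y h hh
  refine ⟨g, hg, ?_⟩
  filter_upwards [H.eventually_nhds] with z Hz hm hgz
  rw [Cochain.ofIdeal_apply]
  refine (toStalk_mk_eq_iff_opens hL _ _).mpr ?_
  filter_upwards [Hz, hF.eventually_fn z fun i => (hm i).germ, eventually_of_nhds
    (eventually_all.mpr fun i => eventually_spread_eq (hm i).germ (hm i) rfl)] with w h1 h2 h3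
  rw [← h2, ← h1 fun i => (h3 i).choose]
  exact congrArg _ (funext fun i => (h3 i).choose_spec)

lemma IsAnalyticFamily.evForm_form (hF : IsAnalyticFamily F) (hL : L.IsReduced) (y : V) :
    (Cochain.ofIdeal (hF.form hL y)).evForm = F y := by
  ext a
  rw [Cochain.evForm_apply, Cochain.ofIdeal_apply]
  refine (hF.eventually_fn y a).self_of_nhds.symm.trans ?_
  simp only [spread_self]

/-- Sections of the sheaf of cochains are the same as analytic families of point forms. -/
lemma IsAnalyticFamily.exists_section (hF : IsAnalyticFamily F) (hL : L.IsReduced) :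
    ∃ φ : L.sections p V, ∀ y, (φ.1 y).evForm = F y :=
  ⟨⟨_, hF.isSection_form hL⟩, hF.evForm_form hL⟩

end Family

/-- A single function `g` represents the element of the stalk at `y` and the values at all nearby
points. This is the bridge from identities between values to identities between elements of stalks.
-/
lemma IsSection.eventually_repr {p : ℕ} {φ : ∀ x : V, L.Cochain p x.1} (hφ : IsSection φ) (y : V)
    (a : Fin p → L.ideal y.1.1) : ∃ (g : PhaseSpace 𝕜 n → 𝕜) (hg : AnalyticAt 𝕜 g y.1.1),
      φ y (fun i => toConormal (a i)) = L.toStalk y.1 (AnalyticGerm.mk g hg) ∧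
      ∀ᶠ z in 𝓝 y, (φ z).evForm (fun i => spread z.1.1 (a i)) = g z.1.1 := by
  obtain ⟨g, hg, H⟩ := isSection_iff.mp hφ y (fun i => repr (a i)) (fun i => locallyMem_repr (a i))
  refine ⟨g, hg, ?_, ?_⟩
  · have := H.self_of_nhds (fun i => locallyMem_repr (a i)) hg
    simpa only [germ_repr] using this
  · filter_upwards [H, eventually_of_nhds hg.eventually_analyticAt, eventually_of_nhds
      (eventually_all.mpr fun i => (locallyMem_repr (a i)).eventually)] with z hz hgz hm
    have : (fun i => spread z.1.1 (a i)) = fun i => (hm i).germ :=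
      funext fun i => spread_of_locallyMem (a i) (hm i)
    rw [this, Cochain.evForm_apply, hz hm hgz]
    rfl

lemma IsSection.ext_evForm (hL : L.IsReduced) {p : ℕ} {φ ψ : ∀ x : V, L.Cochain p x.1}
    (hφ : IsSection φ) (hψ : IsSection ψ) (h : ∀ y, (φ y).evForm = (ψ y).evForm) : φ = ψ := by
  funext y
  refine Cochain.toIdeal_injective ?_
  ext a
  obtain ⟨f, hf, e1, h1⟩ := hφ.eventually_repr y a
  obtain ⟨g, hg, e2, h2⟩ := hψ.eventually_repr y a
  rw [Cochain.toIdeal_apply, Cochain.toIdeal_apply, e1, e2, toStalk_mk_eq_iff_opens hL]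
  filter_upwards [h1, h2] with z hz1 hz2
  rw [← hz1, ← hz2, h]

end Sections

end InvolutiveSubspace
end

/-! ### Analytic primitives along straight segments. -/

noncomputable section

section Antiderivative
open MeasureTheory

variable {𝕜 : Type*} [RCLike 𝕜] {E : Type*} [NormedAddCommGroup E] [NormedSpace 𝕜 E]

/-- An integral over a family of linear contractions of the argument preserves analyticity. -/
lemma AnalyticAt.intervalIntegral_comp_clm {f : E → 𝕜} {x₀ : E} (hf : AnalyticAt 𝕜 f x₀)
    (A : ℝ → E →L[𝕜] E) (hA : Continuous A) (hA1 : ∀ s ∈ Set.Icc (0 : ℝ) 1, ‖A s‖ ≤ 1) :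
    AnalyticAt 𝕜 (fun x => ∫ s in (0 : ℝ)..1, f (x₀ + A s (x - x₀))) x₀ := by
  obtain ⟨p, r, hp⟩ := hf
  let c : ∀ n : ℕ, ℝ → E [×n]→L[𝕜] 𝕜 := fun n s => (p n).compContinuousLinearMap fun _ => A s
  have hc : ∀ n, Continuous (c n) := fun n =>
    ((ContinuousMultilinearMap.compContinuousLinearMapContinuousMultilinear 𝕜 (fun _ : Fin n => E)
      (fun _ => E) 𝕜).cont.comp (continuous_pi fun _ => hA)).clm_apply continuous_const
  have hcn : ∀ n, ∀ s ∈ Set.Icc (0 : ℝ) 1, ‖c n s‖ ≤ ‖p n‖ := by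
    intro n s hs
    refine ((p n).norm_compContinuousLinearMap_le _).trans ?_
    refine mul_le_of_le_one_right (norm_nonneg _) (Finset.prod_le_one (fun _ _ => norm_nonneg _)
      fun _ _ => hA1 s hs)
  have hui : Set.uIoc (0 : ℝ) 1 ⊆ Set.Icc 0 1 := by
    rw [Set.uIoc_of_le zero_le_one]; exact Set.Ioc_subset_Icc_self
  -- The power series of the integral is the integral of the power series. Composition with
  -- contractions does not increase the norms of the coefficients, so the radius does not shrink.
  let P : FormalMultilinearSeries 𝕜 E 𝕜 := fun n => ∫ s in (0 : ℝ)..1, c n s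
  have hP : ∀ n, ‖P n‖ ≤ ‖p n‖ := by
    intro n
    have := intervalIntegral.norm_integral_le_of_norm_le_const (a := (0 : ℝ)) (b := 1) (f := c n)
      (C := ‖p n‖) fun s hs => hcn n s (hui hs)
    simpa using this
  have hPv : ∀ n (y : E), P n (fun _ => y) = ∫ s in (0 : ℝ)..1, p n (fun _ => A s y) := by
    intro n y
    exact ((ContinuousMultilinearMap.apply 𝕜 (fun _ : Fin n => E) 𝕜
      (fun _ => y)).intervalIntegral_comp_comm ((hc n).intervalIntegrable 0 1)).symm
  refine ⟨P, r, hp.r_le.trans (FormalMultilinearSeries.radius_le_of_le hP), hp.r_pos, ?_⟩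
  intro y hy
  simp only [hPv]
  have hyr : ∀ s ∈ Set.Icc (0 : ℝ) 1, A s y ∈ Metric.eball (0 : E) r := by
    intro s hs
    simp only [Metric.mem_eball, edist_zero_right] at hy ⊢
    refine lt_of_le_of_lt ?_ hy
    rw [enorm_le_iff_norm_le]
    exact ((A s).le_opNorm y).trans (mul_le_of_le_one_left (norm_nonneg _) (hA1 s hs))
  -- The terms are dominated by `‖p n‖ * ‖y‖ ^ n`, uniformly in `s`, and this series converges
  -- inside the ball of radius `r`.
  refine intervalIntegral.hasSum_integral_of_dominated_convergence
    (fun n _ => ‖p n‖ * ‖y‖ ^ n) ?_ ?_ ?_ ?_ ?_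
  · intro n
    have : Continuous fun s => c n s (fun _ => y) :=
      (ContinuousMultilinearMap.apply 𝕜 (fun _ : Fin n => E) 𝕜
      (fun _ => y)).continuous.comp (hc n)
    exact this.aestronglyMeasurable
  · intro n
    refine Eventually.of_forall fun s hs => ?_
    refine ((p n).le_opNorm _).trans ?_
    rw [Finset.prod_const, Finset.card_univ, Fintype.card_fin]
    gcongr
    exact ((A s).le_opNorm y).trans (mul_le_of_le_one_left (norm_nonneg _) (hA1 s (hui hs)))
  · refine Eventually.of_forall fun s hs => ?_
    have hy' : ‖y‖ₑ < r := by
      rwa [Metric.mem_eball, edist_zero_right] at hy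
    have := p.summable_norm_mul_pow (r := ‖y‖₊) (hy'.trans_le hp.r_le)
    simpa only [coe_nnnorm] using this
  · exact intervalIntegrable_const
  · refine Eventually.of_forall fun s hs => ?_
    have := hp.hasSum (hyr s (hui hs))
    simpa using this

/-- The primitive of `u` that vanishes at `q₀`. -/
def primitive (q₀ : 𝕜) (u : 𝕜 → 𝕜) (t : 𝕜) : 𝕜 :=
  (t - q₀) * ∫ s in (0 : ℝ)..1, u (q₀ + (s : 𝕜) * (t - q₀))

lemma segment_mem_ball {q₀ t : 𝕜} {r : ℝ} (ht : t ∈ Metric.ball q₀ r) {s : ℝ}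
    (hs : s ∈ Set.Icc (0 : ℝ) 1) : q₀ + (s : 𝕜) * (t - q₀) ∈ Metric.ball q₀ r := by
  rw [mem_ball_iff_norm] at ht ⊢
  rw [add_sub_cancel_left, norm_mul, RCLike.norm_ofReal, abs_of_nonneg hs.1]
  exact (mul_le_of_le_one_left (norm_nonneg _) hs.2).trans_lt ht

/-- Differentiation under the integral sign yields `∫ (u + (t - q₀) s u') ds`, evaluated at `q₀ + s
(t - q₀)`. The integrand is the `s`-derivative of `s u(q₀ + s (t - q₀))`, so the integral is `u t`.
Only a real parameter `s` enters, hence no theory of path integrals is needed for `𝕜 = ℂ`. -/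
lemma hasDerivAt_primitive {q₀ : 𝕜} {u : 𝕜 → 𝕜} {r : ℝ}
    (hu : ∀ t ∈ Metric.ball q₀ r, AnalyticAt 𝕜 u t) {t : 𝕜} (ht : t ∈ Metric.ball q₀ r) :
    HasDerivAt (primitive q₀ u) (u t) t := by
  -- On the compact ball of the intermediate radius `ρ` the derivative of `u` is bounded; this bound
  -- is the dominating function.
  obtain ⟨ρ, hρ1, hρ2⟩ := exists_between (mem_ball_iff_norm.mp ht)
  have hρ : Metric.closedBall q₀ ρ ⊆ Metric.ball q₀ r := Metric.closedBall_subset_ball hρ2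
  have hui : Set.uIoc (0 : ℝ) 1 ⊆ Set.Icc 0 1 := by
    rw [Set.uIoc_of_le zero_le_one]; exact Set.Ioc_subset_Icc_self
  have hseg : ∀ τ ∈ Metric.ball q₀ ρ, ∀ s ∈ Set.Icc (0 : ℝ) 1,
      q₀ + (s : 𝕜) * (τ - q₀) ∈ Metric.ball q₀ ρ := fun τ hτ s hs => segment_mem_ball hτ hs
  have hsr : ∀ τ ∈ Metric.ball q₀ ρ, ∀ s ∈ Set.Icc (0 : ℝ) 1,
      q₀ + (s : 𝕜) * (τ - q₀) ∈ Metric.ball q₀ r :=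
    fun τ hτ s hs => hρ (Metric.ball_subset_closedBall (hseg τ hτ s hs))
  have hcont : ∀ {w : 𝕜 → 𝕜}, (∀ t ∈ Metric.ball q₀ r, AnalyticAt 𝕜 w t) →
      ∀ τ ∈ Metric.ball q₀ ρ,
      ContinuousOn (fun s : ℝ => w (q₀ + (s : 𝕜) * (τ - q₀))) (Set.Icc 0 1) := by
    intro w hw τ hτ s hs
    refine (ContinuousAt.comp (f := fun s : ℝ => q₀ + (s : 𝕜) * (τ - q₀)) (g := w)
      (hw _ (hsr τ hτ s hs)).continuousAt ?_).continuousWithinAt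
    exact (continuous_const.add (RCLike.continuous_ofReal.mul continuous_const)).continuousAt
  have hu' : ∀ t ∈ Metric.ball q₀ r, AnalyticAt 𝕜 (deriv u) t := fun t ht => (hu t ht).deriv
  obtain ⟨C, hC⟩ := (isCompact_closedBall q₀ ρ).exists_bound_of_continuousOn
    (f := deriv u) fun t ht => (hu' t (hρ ht)).continuousAt.continuousWithinAt
  have htρ : t ∈ Metric.ball q₀ ρ := mem_ball_iff_norm.mpr hρ1
  have hc1 := hcont hu t htρ
  have hc2 := hcont hu' t htρ
  have hof : ContinuousOn (fun s : ℝ => (s : 𝕜)) (Set.Icc 0 1) :=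
    RCLike.continuous_ofReal.continuousOn
  have hlin : ∀ (s : ℝ) (τ : 𝕜), HasDerivAt (fun τ => q₀ + (s : 𝕜) * (τ - q₀)) (s : 𝕜) τ := by
    intro s τ
    simpa using (((hasDerivAt_id τ).sub_const q₀).const_mul (s : 𝕜)).const_add q₀
  have hN := (intervalIntegral.hasDerivAt_integral_of_dominated_loc_of_deriv_le (μ := volume)
    (a := (0 : ℝ)) (b := 1) (F := fun τ s => u (q₀ + (s : 𝕜) * (τ - q₀)))
    (F' := fun τ s => deriv u (q₀ + (s : 𝕜) * (τ - q₀)) * s) (x₀ := t) (bound := fun _ => C)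
    (Metric.isOpen_ball.mem_nhds htρ)
    (by
      filter_upwards [Metric.isOpen_ball.mem_nhds htρ] with τ hτ
      exact ((hcont hu τ hτ).mono hui).aestronglyMeasurable measurableSet_uIoc)
    (hc1.intervalIntegrable_of_Icc zero_le_one)
    (((hc2.mul hof).mono hui).aestronglyMeasurable measurableSet_uIoc)
    (Eventually.of_forall fun s hs τ hτ => by
      rw [norm_mul, RCLike.norm_ofReal, abs_of_nonneg (hui hs).1]
      exact (mul_le_of_le_one_right (norm_nonneg _) (hui hs).2).trans
        (hC _ (Metric.ball_subset_closedBall (hseg τ hτ s (hui hs)))))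
    intervalIntegrable_const
    (Eventually.of_forall fun s hs τ hτ =>
      (hu _ (hsr τ hτ s (hui hs))).differentiableAt.hasDerivAt.comp τ (hlin s τ))).2
  have hprod := ((hasDerivAt_id t).sub_const q₀).mul hN
  refine hprod.congr_deriv ?_
  have hi1 : IntervalIntegrable (fun s : ℝ => u (q₀ + (s : 𝕜) * (t - q₀))) volume 0 1 :=
    hc1.intervalIntegrable_of_Icc zero_le_one
  have hi2 : IntervalIntegrable (fun s : ℝ => (t - q₀) * (deriv u (q₀ + (s : 𝕜) * (t - q₀)) * s))
      volume 0 1 :=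
    (continuousOn_const.mul (hc2.mul hof)).intervalIntegrable_of_Icc zero_le_one
  rw [one_mul, id, ← intervalIntegral.integral_const_mul, ← intervalIntegral.integral_add hi1 hi2]
  -- The fundamental theorem of calculus in the real variable `s`; the boundary term at `s = 0`
  -- vanishes.
  rw [intervalIntegral.integral_eq_sub_of_hasDerivAt
    (f := fun s : ℝ => (s : 𝕜) * u (q₀ + (s : 𝕜) * (t - q₀))) ?_ (hi1.add hi2)]
  · simp
  · intro s hs
    rw [Set.uIcc_of_le zero_le_one] at hs
    have h1 : HasDerivAt (fun s : ℝ => (s : 𝕜)) 1 s :=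
      (RCLike.ofRealCLM (K := 𝕜)).hasDerivAt.congr_deriv (by simp)
    have h2 : HasDerivAt (fun s : ℝ => q₀ + (s : 𝕜) * (t - q₀)) (t - q₀) s := by
      simpa using (h1.mul_const (t - q₀)).const_add q₀
    have h3 := ((hu _ (hsr t htρ s hs)).differentiableAt.hasDerivAt.hasFDerivAt.restrictScalars
      ℝ).comp_hasDerivAt s h2
    refine (h1.mul h3).congr_deriv ?_
    simp
    ring

lemma analyticAt_primitive {g : E × 𝕜 → 𝕜} {y₀ : E} {q₀ : 𝕜} (hg : AnalyticAt 𝕜 g (y₀, q₀)) :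
    AnalyticAt 𝕜 (fun w : E × 𝕜 => primitive q₀ (fun t => g (w.1, t)) w.2) (y₀, q₀) := by
  -- `A s (y, t) = (y, s t)` moves along the segment and leaves the parameter alone. It is a
  -- contraction for the maximum norm, so the primitive is analytic in both variables jointly.
  let A : ℝ → E × 𝕜 →L[𝕜] E × 𝕜 := fun s =>
    (ContinuousLinearMap.fst 𝕜 E 𝕜).prod ((s : 𝕜) • ContinuousLinearMap.snd 𝕜 E 𝕜)
  have hA : Continuous A := by
    have h1 : Continuous fun s : ℝ => (s : 𝕜) • ContinuousLinearMap.snd 𝕜 E 𝕜 :=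
      Continuous.smul (f := fun s : ℝ => (s : 𝕜)) (g := fun _ => ContinuousLinearMap.snd 𝕜 E 𝕜)
        RCLike.continuous_ofReal continuous_const
    exact (ContinuousLinearMap.prodₗᵢ 𝕜).continuous.comp (continuous_const.prodMk h1)
  have hA1 : ∀ s ∈ Set.Icc (0 : ℝ) 1, ‖A s‖ ≤ 1 := by
    intro s hs
    refine ContinuousLinearMap.opNorm_le_bound _ zero_le_one fun v => ?_
    rw [one_mul]
    refine max_le (norm_fst_le v) ?_
    change ‖(s : 𝕜) * v.2‖ ≤ _
    rw [norm_mul, RCLike.norm_ofReal, abs_of_nonneg hs.1]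
    exact (mul_le_of_le_one_left (norm_nonneg _) hs.2).trans (norm_snd_le v)
  have := hg.intervalIntegral_comp_clm A hA hA1
  have h2 : AnalyticAt 𝕜 (fun w : E × 𝕜 => w.2 - q₀) (y₀, q₀) := analyticAt_snd.sub analyticAt_const
  refine (h2.mul this).congr (Eventually.of_forall fun w => ?_)
  simp [primitive, A]

end Antiderivative
end

/-! ### Symplectic linear algebra and the coordinates `p₁`, `q₁`. -/

noncomputable section

namespace PhaseSpace
open AnalyticGerm
variable {𝕜 : Type u} [RCLike 𝕜] {n m : ℕ}

lemma omega_single_right (u : PhaseSpace 𝕜 n) (i : Fin n) :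
    omega u (0, Pi.single i 1) = u.1 i := by
  simp [omega, Pi.single_apply]

lemma omega_single_left (u : PhaseSpace 𝕜 n) (i : Fin n) :
    omega u (Pi.single i 1, 0) = - u.2 i := by
  simp [omega, Pi.single_apply]

lemma eq_zero_of_omega_eq_zero {u : PhaseSpace 𝕜 n} (h : ∀ v, omega u v = 0) : u = 0 := by
  refine Prod.ext (funext fun i => ?_) (funext fun i => ?_)
  · exact (omega_single_right u i).symm.trans (h _)
  · exact neg_eq_zero.mp ((omega_single_left u i).symm.trans (h _))

lemma omega_zero_left (v : PhaseSpace 𝕜 n) : omega 0 v = 0 := by simp [omega]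

/-- The linear functionals on the phase space are given by the symplectic form. -/
lemma exists_eq_omega (α : PhaseSpace 𝕜 n →ₗ[𝕜] 𝕜) : ∃ u, ∀ v, α v = omega u v := by
  refine ⟨(fun i => α (0, Pi.single i 1), fun i => - α (Pi.single i 1, 0)), fun v => ?_⟩
  have h1 : v = ∑ i, (v.1 i • ((Pi.single i 1, 0) : PhaseSpace 𝕜 n) +
      v.2 i • ((0, Pi.single i 1) : PhaseSpace 𝕜 n)) := by
    refine Prod.ext (funext fun k => ?_) (funext fun k => ?_) <;>
    simp [Prod.fst_sum, Prod.snd_sum, Finset.sum_apply, Pi.single_apply]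
  conv_lhs => rw [h1]
  simp only [map_sum, map_add, map_smul, smul_eq_mul, omega]
  exact Finset.sum_congr rfl fun i _ => by ring

/-- The Poisson tensor is the inverse of the symplectic form: under the identification of vectors
with functionals `u ↦ ω(u, ·)` it becomes `ω` itself. -/
lemma sum_bracket_omega (u w : PhaseSpace 𝕜 n) :
    ∑ i, (omega u (Pi.single i 1, 0) * omega w (0, Pi.single i 1) -
      omega u (0, Pi.single i 1) * omega w (Pi.single i 1, 0)) = omega u w := by
  simp only [omega_single_left, omega_single_right]
  exact Finset.sum_congr rfl fun i _ => by ring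

lemma injective_of_omega {A : PhaseSpace 𝕜 n →ₗ[𝕜] PhaseSpace 𝕜 n}
    (hA : ∀ v w, omega (A v) (A w) = omega v w) : Function.Injective A := by
  rw [injective_iff_map_eq_zero]
  intro v hv
  refine eq_zero_of_omega_eq_zero fun w => ?_
  rw [← hA, hv, omega_zero_left]

/-- A symplectic linear map preserves the Poisson tensor. -/
lemma sum_bracket_comp {A : PhaseSpace 𝕜 n →ₗ[𝕜] PhaseSpace 𝕜 n}
    (hA : ∀ v w, omega (A v) (A w) = omega v w) (α β : PhaseSpace 𝕜 n →ₗ[𝕜] 𝕜) :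
    ∑ i, (α (A (Pi.single i 1, 0)) * β (A (0, Pi.single i 1)) -
      α (A (0, Pi.single i 1)) * β (A (Pi.single i 1, 0))) =
    ∑ i, (α (Pi.single i 1, 0) * β (0, Pi.single i 1) -
      α (0, Pi.single i 1) * β (Pi.single i 1, 0)) := by
  have hs : Function.Surjective A := LinearMap.injective_iff_surjective.mp (injective_of_omega hA)
  obtain ⟨u, hu⟩ := exists_eq_omega α
  obtain ⟨w, hw⟩ := exists_eq_omega β
  -- Written as `α = ω(A u, ·)`, the functional satisfies `α ∘ A = ω(A u, A ·) = ω(u, ·)`, so both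
  -- sums become `ω(u, w) = ω(A u, A w)`.
  obtain ⟨u, rfl⟩ := hs u
  obtain ⟨w, rfl⟩ := hs w
  simp only [hu, hw, sum_bracket_omega]
  simp only [hA, sum_bracket_omega]

lemma poissonFun_comp {Φ : PhaseSpace 𝕜 n → PhaseSpace 𝕜 n} {x : PhaseSpace 𝕜 n}
    (hΦ : DifferentiableAt 𝕜 Φ x)
    (hs : ∀ v w, omega (fderiv 𝕜 Φ x v) (fderiv 𝕜 Φ x w) = omega v w) {f g : PhaseSpace 𝕜 n → 𝕜}
    (hf : DifferentiableAt 𝕜 f (Φ x)) (hg : DifferentiableAt 𝕜 g (Φ x)) :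
    poissonFun (f ∘ Φ) (g ∘ Φ) x = poissonFun f g (Φ x) := by
  have := sum_bracket_comp (A := (fderiv 𝕜 Φ x).toLinearMap) hs (fderiv 𝕜 f (Φ x)).toLinearMap
    (fderiv 𝕜 g (Φ x)).toLinearMap
  simp only [poissonFun, fderiv_comp x hf hΦ, fderiv_comp x hg hΦ]
  exact this

variable (𝕜 m) in
/-- The projection as a continuous linear map. -/
def projCLM : PhaseSpace 𝕜 (m + 1) →L[𝕜] PhaseSpace 𝕜 m where
  toFun := proj
  map_add' _ _ := rfl
  map_smul' _ _ := rfl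
  cont := continuous_iff_continuousAt.mpr fun y => (analyticAt_proj y).continuousAt

variable (𝕜 m) in
/-- The coordinate `p₁` as a continuous linear map. -/
def coordPCLM : PhaseSpace 𝕜 (m + 1) →L[𝕜] 𝕜 where
  toFun := coordP
  map_add' _ _ := rfl
  map_smul' _ _ := rfl
  cont := continuous_iff_continuousAt.mpr fun y => (analyticAt_coordP y).continuousAt

/-- The coordinate `q₁`. -/
def coordQ (y : PhaseSpace 𝕜 (m + 1)) : 𝕜 := y.2 0

lemma continuous_coordQ : Continuous (coordQ (𝕜 := 𝕜) (m := m)) := by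
  unfold coordQ; fun_prop

lemma analyticAt_coordQ (y : PhaseSpace 𝕜 (m + 1)) :
    AnalyticAt 𝕜 (coordQ (𝕜 := 𝕜) (m := m)) y :=
  ((ContinuousLinearMap.proj (R := 𝕜) (φ := fun _ => 𝕜) 0).comp
      (ContinuousLinearMap.snd 𝕜 (Fin (m + 1) → 𝕜) (Fin (m + 1) → 𝕜))).analyticAt y

lemma fderiv_comp_proj {f : PhaseSpace 𝕜 m → 𝕜} {y : PhaseSpace 𝕜 (m + 1)}
    (hf : DifferentiableAt 𝕜 f (proj y)) (v : PhaseSpace 𝕜 (m + 1)) :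
    fderiv 𝕜 (f ∘ proj) y v = fderiv 𝕜 f (proj y) (proj v) := by
  have h : HasFDerivAt (proj (𝕜 := 𝕜) (m := m)) (projCLM 𝕜 m) y := (projCLM 𝕜 m).hasFDerivAt
  rw [fderiv_comp y hf h.differentiableAt, h.fderiv]
  rfl

lemma proj_single_zero (c d : 𝕜) :
    proj ((Pi.single 0 c, Pi.single 0 d) : PhaseSpace 𝕜 (m + 1)) = 0 := by
  refine Prod.ext (funext fun k => ?_) (funext fun k => ?_) <;> simp [proj, Fin.tail]

lemma proj_single_fst (i : Fin m) :
    proj ((Pi.single i.succ 1, 0) : PhaseSpace 𝕜 (m + 1)) = (Pi.single i 1, 0) := by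
  refine Prod.ext (funext fun k => ?_) (funext fun k => ?_) <;>
    simp [proj, Fin.tail, Pi.single_apply]

lemma proj_single_snd (i : Fin m) :
    proj ((0, Pi.single i.succ 1) : PhaseSpace 𝕜 (m + 1)) = (0, Pi.single i 1) := by
  refine Prod.ext (funext fun k => ?_) (funext fun k => ?_) <;>
    simp [proj, Fin.tail, Pi.single_apply]

lemma proj_single_zero_fst : proj ((Pi.single 0 1, 0) : PhaseSpace 𝕜 (m + 1)) = 0 := by
  simpa using proj_single_zero (m := m) (1 : 𝕜) 0

lemma proj_single_zero_snd : proj ((0, Pi.single 0 1) : PhaseSpace 𝕜 (m + 1)) = 0 := by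
  simpa using proj_single_zero (m := m) (0 : 𝕜) 1

lemma poissonFun_comp_proj {f g : PhaseSpace 𝕜 m → 𝕜} {y : PhaseSpace 𝕜 (m + 1)}
    (hf : DifferentiableAt 𝕜 f (proj y)) (hg : DifferentiableAt 𝕜 g (proj y)) :
    poissonFun (f ∘ proj) (g ∘ proj) y = poissonFun f g (proj y) := by
  simp only [poissonFun, fderiv_comp_proj hf, fderiv_comp_proj hg, Fin.sum_univ_succ,
    proj_single_fst, proj_single_snd, proj_single_zero_fst, proj_single_zero_snd, map_zero]
  simp

/-- The Hamiltonian flow of `p₁` is the translation in `q₁`. This is the source of the derivative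
along the lines of `L' × 𝕜`. -/
lemma poissonFun_coordP (g : PhaseSpace 𝕜 (m + 1) → 𝕜) (y : PhaseSpace 𝕜 (m + 1)) :
    poissonFun coordP g y = fderiv 𝕜 g y (0, Pi.single 0 1) := by
  have h : fderiv 𝕜 (coordP (𝕜 := 𝕜) (m := m)) y = coordPCLM 𝕜 m := (coordPCLM 𝕜 m).fderiv
  have h1 : ∀ v, coordPCLM 𝕜 m v = v.1 0 := fun _ => rfl
  simp [poissonFun, h, h1, Fin.sum_univ_succ]

/-- The point of `𝕜^(2m+2)` with `p₁ = 0`, `q₁ = t` and projection `y`. -/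
def emb (y : PhaseSpace 𝕜 m) (t : 𝕜) : PhaseSpace 𝕜 (m + 1) := (Fin.cons 0 y.1, Fin.cons t y.2)

@[simp] lemma proj_emb (y : PhaseSpace 𝕜 m) (t : 𝕜) : proj (emb y t) = y := rfl
@[simp] lemma coordP_emb (y : PhaseSpace 𝕜 m) (t : 𝕜) : coordP (emb y t) = 0 := rfl
@[simp] lemma coordQ_emb (y : PhaseSpace 𝕜 m) (t : 𝕜) : coordQ (emb y t) = t := rfl

lemma emb_eq (y : PhaseSpace 𝕜 (m + 1)) (h : coordP y = 0) : emb (proj y) (coordQ y) = y := by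
  refine Prod.ext ?_ ?_
  · change Fin.cons 0 (Fin.tail y.1) = y.1
    rw [← h]
    exact Fin.cons_self_tail _
  · exact Fin.cons_self_tail _

/-- `emb` as a continuous linear map. -/
def embCLM : PhaseSpace 𝕜 m × 𝕜 →L[𝕜] PhaseSpace 𝕜 (m + 1) :=
  LinearMap.toContinuousLinearMap
  { toFun := fun w => emb w.1 w.2
    map_add' := fun v w => by
      refine Prod.ext (funext fun k => ?_) (funext fun k => ?_) <;>
      refine Fin.cases ?_ (fun k => ?_) k <;> simp [emb]
    map_smul' := fun c w => by
      refine Prod.ext (funext fun k => ?_) (funext fun k => ?_) <;>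
      refine Fin.cases ?_ (fun k => ?_) k <;> simp [emb] }

lemma analyticAt_emb (w : PhaseSpace 𝕜 m × 𝕜) :
    AnalyticAt 𝕜 (fun w : PhaseSpace 𝕜 m × 𝕜 => emb w.1 w.2) w :=
  (embCLM (𝕜 := 𝕜) (m := m)).analyticAt w

lemma continuous_emb : Continuous (fun w : PhaseSpace 𝕜 m × 𝕜 => emb w.1 w.2) :=
  (embCLM (𝕜 := 𝕜) (m := m)).continuous

lemma hasDerivAt_emb (y : PhaseSpace 𝕜 m) (t : 𝕜) :
    HasDerivAt (emb y) (0, Pi.single 0 1) t := by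
  have h : HasDerivAt (fun t : 𝕜 => (y, t)) ((0, 1) : PhaseSpace 𝕜 m × 𝕜) t :=
    (hasDerivAt_const t y).prodMk (hasDerivAt_id t)
  have h2 := embCLM.hasFDerivAt.comp_hasDerivAt t h
  have e : embCLM ((0, 1) : PhaseSpace 𝕜 m × 𝕜) = (0, Pi.single 0 1) := by
    refine Prod.ext (funext fun k => ?_) (funext fun k => ?_) <;>
      refine Fin.cases ?_ (fun k => ?_) k <;> simp [emb, embCLM]
  rw [e] at h2
  exact h2

end PhaseSpace
end

/-! ### Charts: pullback along the projection and restriction to slices. -/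

noncomputable section

namespace InvolutiveSubspace
open PhaseSpace AnalyticGerm
variable {𝕜 : Type u} [RCLike 𝕜] {m : ℕ} {D : Opens (PhaseSpace 𝕜 (m + 1))}
  {D' : Opens (PhaseSpace 𝕜 m)}

/-- On all of `D`, the map `Φ` is a symplectic change of coordinates, with inverse `Ψ`, that takes
`L` to `L' × 𝕜`. -/
structure IsChart (L : InvolutiveSubspace D) (L' : InvolutiveSubspace D')
    (Φ Ψ : PhaseSpace 𝕜 (m + 1) → PhaseSpace 𝕜 (m + 1)) : Prop where
  analyticAt : ∀ x ∈ D, AnalyticAt 𝕜 Φ x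
  symplectic : ∀ x ∈ D, ∀ v w, omega (fderiv 𝕜 Φ x v) (fderiv 𝕜 Φ x w) = omega v w
  analyticAt_inv : ∀ x ∈ D, AnalyticAt 𝕜 Ψ (Φ x)
  left_inv : ∀ x ∈ D, Ψ (Φ x) = x
  right_inv : ∀ x ∈ D, ∀ᶠ w in 𝓝 (Φ x), Φ (Ψ w) = w
  proj_mem : ∀ x ∈ D, proj (Φ x) ∈ D'
  ideal_eq : ∀ x (hx : AnalyticAt 𝕜 Φ x), x ∈ D →
    L.ideal x = (L'.prodLineIdeal (Φ x)).map (AnalyticGerm.pullback hx rfl)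
  reduced : L.IsReduced
  reduced' : L'.IsReduced

/-- A linear map that preserves `ω` is injective, hence invertible, so the inverse function theorem
supplies `Ψ`. All remaining conditions hold near `0`, thus on one open set, and they are inherited
by its open subsets. -/
lemma exists_isChart {L : InvolutiveSubspace D} {L' : InvolutiveSubspace D'}
    (hL : L.IsLagrangianAtZero) (hL' : L'.IsLagrangianAtZero)
    {Φ : PhaseSpace 𝕜 (m + 1) → PhaseSpace 𝕜 (m + 1)} (hΦ : L.IsDecomposition L' Φ) :
    ∃ (Ψ : PhaseSpace 𝕜 (m + 1) → PhaseSpace 𝕜 (m + 1)) (W₀ : Opens (PhaseSpace 𝕜 (m + 1))),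
      0 ∈ W₀ ∧ W₀ ≤ D ∧ ∀ (W : Opens (PhaseSpace 𝕜 (m + 1))) (hW : W ≤ D), W ≤ W₀ →
        (L.restrict W hW).IsChart L' Φ Ψ := by
  have hequiv : ∀ x : PhaseSpace 𝕜 (m + 1),
      (∀ v w, omega (fderiv 𝕜 Φ x v) (fderiv 𝕜 Φ x w) = omega v w) →
      ∃ i : PhaseSpace 𝕜 (m + 1) ≃L[𝕜] PhaseSpace 𝕜 (m + 1), fderiv 𝕜 Φ x = i := by
    intro x hx
    refine ⟨(LinearEquiv.ofInjectiveEndo (fderiv 𝕜 Φ x).toLinearMap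
      (injective_of_omega hx)).toContinuousLinearEquiv, ?_⟩
    ext v <;> rfl
  obtain ⟨i, hi⟩ := hequiv 0 hΦ.symplectic.self_of_nhds
  have hstrict : HasStrictFDerivAt Φ (i : PhaseSpace 𝕜 (m + 1) →L[𝕜] PhaseSpace 𝕜 (m + 1)) 0 :=
    hi ▸ hΦ.analyticAt.hasStrictFDerivAt
  let e := hstrict.toOpenPartialHomeomorph Φ
  have he : ⇑e = Φ := rfl
  have hD' : ∀ᶠ x in 𝓝 (0 : PhaseSpace 𝕜 (m + 1)), proj (Φ x) ∈ D' := by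
    have h1 : ContinuousAt (fun x => proj (Φ x)) 0 :=
      ContinuousAt.comp (g := proj) (analyticAt_proj _).continuousAt hΦ.analyticAt.continuousAt
    refine h1.eventually (D'.2.mem_nhds ?_)
    change proj (Φ 0) ∈ D'
    rw [hΦ.map_zero]
    exact hL'.zero_mem
  have hsource : ∀ᶠ x in 𝓝 (0 : PhaseSpace 𝕜 (m + 1)), x ∈ e.source :=
    e.open_source.mem_nhds hstrict.mem_toOpenPartialHomeomorph_source
  have hD : ∀ᶠ x in 𝓝 (0 : PhaseSpace 𝕜 (m + 1)), x ∈ D := D.2.mem_nhds hL.zero_mem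
  obtain ⟨U, hU, hUo, h0⟩ := eventually_nhds_iff.mp (hΦ.analyticAt.eventually_analyticAt.and
    (hΦ.symplectic.and (hΦ.ideal_eq.and (hD'.and (hsource.and hD)))))
  refine ⟨e.symm, ⟨U, hUo⟩, h0, fun x hx => (hU x hx).2.2.2.2.2, fun W hW hWU => ?_⟩
  have hW' : ∀ x ∈ W, _ := fun x hx => hU x (hWU hx)
  exact
  { analyticAt := fun x hx => (hW' x hx).1
    symplectic := fun x hx => (hW' x hx).2.1
    analyticAt_inv := fun x hx => by
      -- Analyticity of the inverse at `Φ x` requires an invertible derivative at `x` itself, which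
      -- symplecticity at `x` provides.
      obtain ⟨j, hj⟩ := hequiv x (hW' x hx).2.1
      exact e.analyticAt_symm' (hW' x hx).2.2.2.2.1 (hW' x hx).1 hj
    left_inv := fun x hx => e.left_inv (hW' x hx).2.2.2.2.1
    right_inv := fun x hx => e.eventually_right_inverse' (hW' x hx).2.2.2.2.1
    proj_mem := fun x hx => (hW' x hx).2.2.2.1
    ideal_eq := fun x hx hxW => (hW' x hxW).2.2.1.choose_spec
    reduced := hL.reduced.restrict W hW
    reduced' := hL'.reduced }

/-- The point `x` has the coordinates `p₁ = 0`, `q₁ = t` and lies over `y`. -/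
structure Over (D : Opens (PhaseSpace 𝕜 (m + 1))) (Φ : PhaseSpace 𝕜 (m + 1) → PhaseSpace 𝕜 (m + 1))
    (x : PhaseSpace 𝕜 (m + 1)) (y : PhaseSpace 𝕜 m) (t : 𝕜) : Prop where
  mem : x ∈ D
  eq : Φ x = emb y t

section
variable {L : InvolutiveSubspace D} {L' : InvolutiveSubspace D'}
  {Φ Ψ : PhaseSpace 𝕜 (m + 1) → PhaseSpace 𝕜 (m + 1)} (C : L.IsChart L' Φ Ψ)
  {x : PhaseSpace 𝕜 (m + 1)} {y : PhaseSpace 𝕜 m} {t : 𝕜}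

namespace IsChart

include C in
lemma analyticAt_proj_comp (hx : x ∈ D) : AnalyticAt 𝕜 (fun z => proj (Φ z)) x :=
  (analyticAt_proj (Φ x)).comp (C.analyticAt x hx)

/-- The germ of the function `p₁ ∘ Φ`. -/
def germP (hx : x ∈ D) : AnalyticGerm 𝕜 x :=
  AnalyticGerm.mk (coordP ∘ Φ) ((analyticAt_coordP (Φ x)).comp (C.analyticAt x hx))

/-- The pullback of germs along `π`. -/
def pb (h : Over D Φ x y t) : AnalyticGerm 𝕜 y →ₐ[𝕜] AnalyticGerm 𝕜 x :=
  pullback (C.analyticAt_proj_comp h.mem) (by rw [h.eq, proj_emb])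

include C in
lemma analyticAt_slice (h : Over D Φ x y t) : AnalyticAt 𝕜 (fun z => Ψ (emb z t)) y := by
  have h1 : AnalyticAt 𝕜 (fun z : PhaseSpace 𝕜 m => emb z t) y :=
    AnalyticAt.comp (f := fun z : PhaseSpace 𝕜 m => (z, t)) (analyticAt_emb (y, t))
      (analyticAt_id.prod analyticAt_const)
  refine AnalyticAt.comp ?_ h1
  rw [← h.eq]
  exact C.analyticAt_inv x h.mem

include C in
lemma slice_eq (h : Over D Φ x y t) : Ψ (emb y t) = x := by
  rw [← h.eq]
  exact C.left_inv x h.mem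

/-- The restriction of germs to the slice `p₁ = 0`, `q₁ = t`. -/
def sl (h : Over D Φ x y t) : AnalyticGerm 𝕜 x →ₐ[𝕜] AnalyticGerm 𝕜 y :=
  pullback (C.analyticAt_slice h) (C.slice_eq h)

lemma ev_pb (h : Over D Φ x y t) (a : AnalyticGerm 𝕜 y) : ev x (C.pb h a) = ev y a :=
  ev_pullback _ _ _

lemma ev_sl (h : Over D Φ x y t) (a : AnalyticGerm 𝕜 x) : ev y (C.sl h a) = ev x a :=
  ev_pullback _ _ _

include C in
lemma eventually_slice (h : Over D Φ x y t) : ∀ᶠ z in 𝓝 y, Φ (Ψ (emb z t)) = emb z t := by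
  have h1 : ContinuousAt (fun z : PhaseSpace 𝕜 m => emb z t) y :=
    (continuous_emb.comp (continuous_id.prodMk continuous_const)).continuousAt
  have := C.right_inv x h.mem
  rw [h.eq] at this
  exact h1.eventually this

/-- The slice `z ↦ Ψ (emb z t)` is a section of the projection. So `sl` is a retraction of `pb`, and
it is compatible with the ideals; injectivity of pullbacks rests on it. -/
lemma sl_pb (h : Over D Φ x y t) (a : AnalyticGerm 𝕜 y) : C.sl h (C.pb h a) = a := by
  obtain ⟨f, hf, rfl⟩ := exists_mk a
  refine toGerm_injective (Germ.coe_eq.mpr ?_)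
  filter_upwards [C.eventually_slice h] with z hz
  simp only [Function.comp_apply, hz, proj_emb]

lemma sl_germP (h : Over D Φ x y t) : C.sl h (C.germP h.mem) = 0 := by
  refine toGerm_injective (Germ.coe_eq.mpr ?_)
  filter_upwards [C.eventually_slice h] with z hz
  simp only [Function.comp_apply, hz, coordP_emb]

lemma ideal_eq_sup (h : Over D Φ x y t) :
    L.ideal x = (L'.ideal y).map (C.pb h) ⊔ Ideal.span {C.germP h.mem} := by
  obtain rfl : y = proj (Φ x) := by rw [h.eq, proj_emb]
  rw [C.ideal_eq x (C.analyticAt x h.mem) h.mem, prodLineIdeal, Ideal.map_sup, Ideal.map_span,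
    Set.image_singleton]
  congr 1
  have := Ideal.map_map (I := L'.ideal (proj (Φ x)))
    (pullback (analyticAt_proj (Φ x)) rfl : _ →ₐ[𝕜] AnalyticGerm 𝕜 (Φ x)).toRingHom
    (pullback (C.analyticAt x h.mem) rfl : _ →ₐ[𝕜] AnalyticGerm 𝕜 x).toRingHom
  refine this.trans ?_
  have e : (pullback (C.analyticAt x h.mem) rfl : _ →ₐ[𝕜] AnalyticGerm 𝕜 x).toRingHom.comp
      (pullback (analyticAt_proj (Φ x)) rfl : _ →ₐ[𝕜] AnalyticGerm 𝕜 (Φ x)).toRingHom =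
      (C.pb h).toRingHom := by
    refine RingHom.ext fun a => ?_
    obtain ⟨f, hf, rfl⟩ := exists_mk a
    rfl
  rw [e]
  rfl

lemma pb_mem (h : Over D Φ x y t) {a : AnalyticGerm 𝕜 y} (ha : a ∈ L'.ideal y) :
    C.pb h a ∈ L.ideal x := by
  rw [C.ideal_eq_sup h]
  exact Ideal.mem_sup_left (Ideal.mem_map_of_mem _ ha)

/-- It suffices to look at generators: `sl` returns `b` from the pullback of `b ∈ I'`, and it kills
`p₁ ∘ Φ`. -/
lemma sl_mem (h : Over D Φ x y t) {a : AnalyticGerm 𝕜 x} (ha : a ∈ L.ideal x) :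
    C.sl h a ∈ L'.ideal y := by
  have : L.ideal x ≤ (L'.ideal y).comap (C.sl h) := by
    rw [C.ideal_eq_sup h]
    refine sup_le (Ideal.map_le_iff_le_comap.mpr fun b hb => ?_) ?_
    · change C.sl h (C.pb h b) ∈ L'.ideal y
      rwa [C.sl_pb]
    · rw [Ideal.span_le, Set.singleton_subset_iff]
      change C.sl h (C.germP h.mem) ∈ L'.ideal y
      rw [C.sl_germP]
      exact zero_mem _
  exact this ha

lemma germP_mem (hx : x ∈ D) : C.germP hx ∈ L.ideal x := by
  rw [C.ideal_eq x (C.analyticAt x hx) hx]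
  have h1 : AnalyticGerm.mk coordP (analyticAt_coordP (Φ x)) ∈ L'.prodLineIdeal (Φ x) :=
    Ideal.mem_sup_right (Ideal.subset_span rfl)
  exact Ideal.mem_map_of_mem (pullback (C.analyticAt x hx) rfl) h1

include C in
lemma over_support (hx : x ∈ L.support) : Over D Φ x (proj (Φ x)) (coordQ (Φ x)) :=
  ⟨hx.1, (emb_eq _ (ev_eq_zero_of_mem hx.2 (C.germP_mem hx.1))).symm⟩

-- Restriction to the slice maps `I_x` into `I'_y` and preserves values at the base point, so germs
-- in `I_x` vanish at `x` if those in `I'_y` vanish at `y`.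
include C in
lemma support_of_over (h : Over D Φ x y t) (hy : y ∈ L'.support) : x ∈ L.support := by
  refine ⟨h.mem, ne_top_of_ev_eq_zero fun a ha => ?_⟩
  rw [← C.ev_sl h]
  exact ev_eq_zero_of_mem hy.2 (C.sl_mem h ha)

include C in
lemma support_base (h : Over D Φ x y t) (hx : x ∈ L.support) : y ∈ L'.support := by
  obtain rfl : y = proj (Φ x) := by rw [h.eq, proj_emb]
  refine ⟨C.proj_mem x h.mem, ne_top_of_ev_eq_zero fun a ha => ?_⟩
  rw [← C.ev_pb h]
  exact ev_eq_zero_of_mem hx.2 (C.pb_mem h ha)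

/-- `pb` on the ideals. -/
def pbI (h : Over D Φ x y t) (a : L'.ideal y) : L.ideal x := ⟨C.pb h a.1, C.pb_mem h a.2⟩

/-- `sl` on the ideals. -/
def slI (h : Over D Φ x y t) (a : L.ideal x) : L'.ideal y := ⟨C.sl h a.1, C.sl_mem h a.2⟩

/-- `germP` as an element of the ideal. -/
def germPI (hx : x ∈ D) : L.ideal x := ⟨C.germP hx, C.germP_mem hx⟩

lemma pbI_add (h : Over D Φ x y t) (a b : L'.ideal y) :
    C.pbI h (a + b) = C.pbI h a + C.pbI h b := Subtype.ext (map_add (C.pb h) _ _)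

lemma pbI_smul (h : Over D Φ x y t) (c : AnalyticGerm 𝕜 y) (a : L'.ideal y) :
    C.pbI h (c • a) = C.pb h c • C.pbI h a := Subtype.ext (map_mul (C.pb h) _ _)

lemma slI_add (h : Over D Φ x y t) (a b : L.ideal x) :
    C.slI h (a + b) = C.slI h a + C.slI h b := Subtype.ext (map_add (C.sl h) _ _)

lemma slI_smul (h : Over D Φ x y t) (c : AnalyticGerm 𝕜 x) (a : L.ideal x) :
    C.slI h (c • a) = C.sl h c • C.slI h a := Subtype.ext (map_mul (C.sl h) _ _)

lemma slI_pbI (h : Over D Φ x y t) (a : L'.ideal y) : C.slI h (C.pbI h a) = a :=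
  Subtype.ext (C.sl_pb h a.1)

lemma slI_germPI (h : Over D Φ x y t) : C.slI h (C.germPI h.mem) = 0 :=
  Subtype.ext (C.sl_germP h)

/-- Multilinear identities on `I_x` thereby reduce to tuples made of `p₁ ∘ Φ` and of pullbacks. -/
lemma span_generators (h : Over D Φ x y t) :
    Submodule.span (AnalyticGerm 𝕜 x) (insert (C.germPI h.mem) (Set.range (C.pbI h))) = ⊤ := by
  rw [eq_top_iff]
  rintro ⟨a, ha⟩ -
  have hle : L.ideal x ≤ (Submodule.span (AnalyticGerm 𝕜 x)
      (insert (C.germPI h.mem) (Set.range (C.pbI h)))).map (Submodule.subtype _) := by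
    refine (C.ideal_eq_sup h).le.trans (sup_le ?_ ?_)
    · refine Ideal.span_le.mpr ?_
      rintro _ ⟨b, hb, rfl⟩
      exact ⟨C.pbI h ⟨b, hb⟩, Submodule.subset_span (Or.inr ⟨_, rfl⟩), rfl⟩
    · rw [Ideal.span_le, Set.singleton_subset_iff]
      exact ⟨C.germPI h.mem, Submodule.subset_span (Or.inl rfl), rfl⟩
  obtain ⟨⟨b, hb⟩, hb', rfl⟩ := hle ha
  exact hb'

/-- `Φ` is symplectic, and the coordinates that `proj` forgets form a conjugate pair, so `π` is a
Poisson map. -/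
lemma poisson_pb (h : Over D Φ x y t) (a b : AnalyticGerm 𝕜 y) :
    poisson (C.pb h a) (C.pb h b) = C.pb h (poisson a b) := by
  obtain ⟨f, hf, rfl⟩ := exists_mk a
  obtain ⟨g, hg, rfl⟩ := exists_mk b
  obtain rfl : y = proj (Φ x) := by rw [h.eq, proj_emb]
  simp only [pb, pullback_mk, poisson_mk, mk_eq_mk]
  have hc := (C.analyticAt_proj_comp h.mem).continuousAt
  filter_upwards [D.2.mem_nhds h.mem, hc.eventually hf.eventually_analyticAt,
    hc.eventually hg.eventually_analyticAt] with z hz hfz hgz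
  have e : ∀ k : PhaseSpace 𝕜 m → 𝕜, (k ∘ fun z => proj (Φ z)) = (k ∘ proj) ∘ Φ := fun k => rfl
  have hp := fun z => (analyticAt_proj (𝕜 := 𝕜) (m := m) z).differentiableAt
  rw [e, e, poissonFun_comp (C.analyticAt z hz).differentiableAt (C.symplectic z hz)
    (hfz.differentiableAt.comp _ (hp _)) (hgz.differentiableAt.comp _ (hp _)),
    poissonFun_comp_proj hfz.differentiableAt hgz.differentiableAt]
  rfl

lemma poisson_germP_pb (h : Over D Φ x y t) (b : AnalyticGerm 𝕜 y) :
    poisson (C.germP h.mem) (C.pb h b) = 0 := by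
  obtain ⟨g, hg, rfl⟩ := exists_mk b
  obtain rfl : y = proj (Φ x) := by rw [h.eq, proj_emb]
  simp only [pb, pullback_mk, germP, poisson_mk]
  refine toGerm_injective (Germ.coe_eq.mpr ?_)
  have hc := (C.analyticAt_proj_comp h.mem).continuousAt
  filter_upwards [D.2.mem_nhds h.mem, hc.eventually hg.eventually_analyticAt] with z hz hgz
  have e : ∀ k : PhaseSpace 𝕜 m → 𝕜, (k ∘ fun z => proj (Φ z)) = (k ∘ proj) ∘ Φ := fun k => rfl
  have hp := fun z => (analyticAt_proj (𝕜 := 𝕜) (m := m) z).differentiableAt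
  rw [e, poissonFun_comp (C.analyticAt z hz).differentiableAt (C.symplectic z hz)
    (analyticAt_coordP _).differentiableAt (hgz.differentiableAt.comp _ (hp _)),
    poissonFun_coordP, fderiv_comp_proj hgz.differentiableAt, proj_single_zero_snd, map_zero]

/-- The bracket with `p₁ ∘ Φ` is the derivative along the lines of `L' × 𝕜`. -/
lemma hasDerivAt_slice (h : Over D Φ x y t) {g : PhaseSpace 𝕜 (m + 1) → 𝕜}
    (hg : AnalyticAt 𝕜 g x) :
    HasDerivAt (fun τ => g (Ψ (emb y τ)))
      (ev x (poisson (C.germP h.mem) (AnalyticGerm.mk g hg))) t := by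
  have hΨ : DifferentiableAt 𝕜 Ψ (Φ x) := (C.analyticAt_inv x h.mem).differentiableAt
  have hg' : DifferentiableAt 𝕜 g (Ψ (Φ x)) := by
    rw [C.left_inv x h.mem]; exact hg.differentiableAt
  have hgΨ : DifferentiableAt 𝕜 (g ∘ Ψ) (Φ x) := DifferentiableAt.comp _ hg' hΨ
  -- In this form both entries of the bracket are pulled back along `Φ`, and the bracket can be
  -- computed in the target, where it is `∂/∂q₁`.
  have e : g =ᶠ[𝓝 x] (g ∘ Ψ) ∘ Φ := by
    filter_upwards [D.2.mem_nhds h.mem] with z hz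
    simp only [Function.comp_apply, C.left_inv z hz]
  have e2 : ev x (poisson (C.germP h.mem) (AnalyticGerm.mk g hg)) =
      fderiv 𝕜 (g ∘ Ψ) (Φ x) (0, Pi.single 0 1) := by
    rw [germP, poisson_mk, ev_mk, ← poissonFun_coordP,
      ← poissonFun_comp (C.analyticAt x h.mem).differentiableAt (C.symplectic x h.mem)
        (analyticAt_coordP _).differentiableAt hgΨ]
    simp only [poissonFun, e.fderiv_eq]
  rw [e2]
  have h1 := hgΨ.hasFDerivAt
  rw [h.eq] at h1 ⊢
  exact h1.comp_hasDerivAt t (hasDerivAt_emb y t)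

end IsChart
end
end InvolutiveSubspace
end

/-! ### Horizontal forms and the analyticity of families of such forms. -/

noncomputable section

namespace InvolutiveSubspace
open PhaseSpace AnalyticGerm

section
variable {𝕜 : Type u} [RCLike 𝕜] {n : ℕ} {D : Opens (PhaseSpace 𝕜 n)} {L : InvolutiveSubspace D}

/-- The same finite set of functions generates the ideals of all nearby points; this uniformity is
needed for integration along whole segments. -/
lemma exists_generators {y : PhaseSpace 𝕜 n} (hy : y ∈ D) :
    ∃ s : Finset (PhaseSpace 𝕜 n → 𝕜), ∀ᶠ z in 𝓝 y, ∃ hm : ∀ f : s, L.LocallyMem f.1 z,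
      Submodule.span (AnalyticGerm 𝕜 z) (Set.range fun f => (hm f).germ) = ⊤ := by
  obtain ⟨s, hs, H⟩ := L.finite_type y hy
  refine ⟨s, ?_⟩
  filter_upwards [H.eventually_nhds, eventually_all.mpr fun f : s =>
    (hs f.1 f.2).eventually_analyticAt.eventually_nhds] with z hz han
  have hm : ∀ f : s, L.LocallyMem f.1 z := by
    intro f
    filter_upwards [hz, han f] with w hw hfw
    refine ⟨AnalyticGerm.mk f.1 hfw, ?_, rfl⟩
    rw [hw]
    exact Ideal.subset_span ⟨f.1, f.2, rfl⟩
  refine ⟨hm, ?_⟩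
  rw [eq_top_iff]
  rintro ⟨a, ha⟩ -
  have hle : L.ideal z ≤ (Submodule.span (AnalyticGerm 𝕜 z)
      (Set.range fun f => (hm f).germ)).map (Submodule.subtype _) := by
    refine hz.self_of_nhds.le.trans (Ideal.span_le.mpr ?_)
    rintro a ⟨f, hf, ha⟩
    refine ⟨(hm ⟨f, hf⟩).germ, Submodule.subset_span ⟨_, rfl⟩, (toGerm_injective ha).symm⟩
  obtain ⟨⟨b, hb⟩, hb', rfl⟩ := hle ha
  exact hb'

lemma eventually_spread_zero {y : L.support} :
    ∀ᶠ z in 𝓝 y.1, spread z (0 : L.ideal y.1) = 0 := by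
  filter_upwards [eventually_spread_add (0 : L.ideal y.1) 0] with z hz
  simpa using hz

lemma eventually_spread_sum {y : L.support} {ι : Type*} (s : Finset ι) (a : ι → L.ideal y.1) :
    ∀ᶠ z in 𝓝 y.1, spread z (∑ k ∈ s, a k) = ∑ k ∈ s, spread z (a k) := by
  classical
  induction s using Finset.induction_on with
  | empty => simpa using eventually_spread_zero
  | insert k s hk ih =>
    filter_upwards [ih, eventually_spread_add (a k) (∑ k ∈ s, a k)] with z h1 h2
    rw [Finset.sum_insert hk, Finset.sum_insert hk, h2, h1]

end

section
variable {𝕜 : Type u} [RCLike 𝕜] {m : ℕ} {D : Opens (PhaseSpace 𝕜 (m + 1))}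
  {D' : Opens (PhaseSpace 𝕜 m)} {L : InvolutiveSubspace D} {L' : InvolutiveSubspace D'}
  {Φ Ψ : PhaseSpace 𝕜 (m + 1) → PhaseSpace 𝕜 (m + 1)} (C : L.IsChart L' Φ Ψ)
  {x : PhaseSpace 𝕜 (m + 1)} {y : PhaseSpace 𝕜 m} {t : 𝕜} {p : ℕ}

namespace IsChart

/-- The pullback of a point form along the restriction to slices. -/
def slForm (h : Over D Φ x y t) (G : L'.PointForm p y) : L.PointForm p x where
  toFun a := G fun i => C.slI h (a i)
  map_update_add' := by
    intro _ v i a b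
    have e : ∀ c, (fun k => C.slI h (Function.update v i c k)) =
        Function.update (fun k => C.slI h (v k)) i (C.slI h c) :=
      fun c => Function.comp_update (C.slI h) v i c
    rw [e, e, e, C.slI_add, G.map_update_add]
  map_update_smul' := by
    intro _ v i c a
    have e : ∀ c, (fun k => C.slI h (Function.update v i c k)) =
        Function.update (fun k => C.slI h (v k)) i (C.slI h c) :=
      fun c => Function.comp_update (C.slI h) v i c
    rw [e, e, C.slI_smul, G.map_update_smul, smul_eq_ev_mul, smul_eq_ev_mul, C.ev_sl]
  map_eq_zero_of_eq' := fun v i j hij hne => G.map_eq_zero_of_eq _ (by rw [hij]) hne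

lemma slForm_apply (h : Over D Φ x y t) (G : L'.PointForm p y) (a : Fin p → L.ideal x) :
    C.slForm h G a = G fun i => C.slI h (a i) := rfl

/-- The restriction of a point form to pullbacks. -/
def pbForm (h : Over D Φ x y t) (G : L.PointForm p x) : L'.PointForm p y where
  toFun a := G fun i => C.pbI h (a i)
  map_update_add' := by
    intro _ v i a b
    have e : ∀ c, (fun k => C.pbI h (Function.update v i c k)) =
        Function.update (fun k => C.pbI h (v k)) i (C.pbI h c) :=
      fun c => Function.comp_update (C.pbI h) v i c
    rw [e, e, e, C.pbI_add, G.map_update_add]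
  map_update_smul' := by
    intro _ v i c a
    have e : ∀ c, (fun k => C.pbI h (Function.update v i c k)) =
        Function.update (fun k => C.pbI h (v k)) i (C.pbI h c) :=
      fun c => Function.comp_update (C.pbI h) v i c
    rw [e, e, C.pbI_smul, G.map_update_smul, smul_eq_ev_mul, smul_eq_ev_mul, C.ev_pb]
  map_eq_zero_of_eq' := fun v i j hij hne => G.map_eq_zero_of_eq _ (by rw [hij]) hne

lemma pbForm_apply (h : Over D Φ x y t) (G : L.PointForm p x) (a : Fin p → L'.ideal y) :
    C.pbForm h G a = G fun i => C.pbI h (a i) := rfl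

lemma pbForm_slForm (h : Over D Φ x y t) (G : L'.PointForm p y) :
    C.pbForm h (C.slForm h G) = G := by
  ext a
  simp only [pbForm_apply, slForm_apply, C.slI_pbI]

/-- A form that vanishes if one argument is `p₁ ∘ Φ`. -/
def IsHorizontal (hx : x ∈ D) (G : L.PointForm p x) : Prop :=
  ∀ a : Fin p → L.ideal x, ∀ i, a i = C.germPI hx → G a = 0

lemma isHorizontal_slForm (h : Over D Φ x y t) (G : L'.PointForm p y) :
    C.IsHorizontal h.mem (C.slForm h G) := by
  intro a i ha
  rw [slForm_apply]
  exact G.map_coord_zero i (by rw [ha, C.slI_germPI])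

/-- Forms are determined by their values on pullbacks if they vanish on `p₁ ∘ Φ`. -/
lemma slForm_pbForm (h : Over D Φ x y t) {G : L.PointForm p x} (hG : C.IsHorizontal h.mem G) :
    C.slForm h (C.pbForm h G) = G := by
  refine AlternatingMap.ext_of_span_eq_top (C.span_generators h) fun v hv => ?_
  by_cases hP : ∃ i, v i = C.germPI h.mem
  · obtain ⟨i, hi⟩ := hP
    rw [hG v i hi, C.isHorizontal_slForm h _ v i hi]
  · push Not at hP
    have : ∀ i, ∃ f, C.pbI h f = v i := fun i => (hv i).resolve_left (hP i)
    choose f hf using this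
    obtain rfl : (fun i => C.pbI h (f i)) = v := funext hf
    simp only [slForm_apply, pbForm_apply, C.slI_pbI]

include C in
lemma locallyMem_comp (h : Over D Φ x y t) {f : PhaseSpace 𝕜 m → 𝕜} (hf : L'.LocallyMem f y) :
    L.LocallyMem (f ∘ fun z => proj (Φ z)) x :=
  locallyMem_of_mem h.mem (AnalyticAt.comp_of_eq hf.analyticAt (C.analyticAt_proj_comp h.mem)
    (by rw [h.eq, proj_emb])) (C.pb_mem h hf.mem)

lemma pbI_germ (h : Over D Φ x y t) {f : PhaseSpace 𝕜 m → 𝕜} (hf : L'.LocallyMem f y)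
    (hf' : L.LocallyMem (f ∘ fun z => proj (Φ z)) x) : C.pbI h hf.germ = hf'.germ := rfl

lemma span_finite_generators (h : Over D Φ x y t) {ι : Type*} {f : ι → L'.ideal y}
    (hf : Submodule.span (AnalyticGerm 𝕜 y) (Set.range f) = ⊤) :
    Submodule.span (AnalyticGerm 𝕜 x) (insert (C.germPI h.mem) (Set.range fun k => C.pbI h (f k)))
      = ⊤ := by
  rw [eq_top_iff, ← C.span_generators h, Submodule.span_le, Set.insert_subset_iff]
  refine ⟨Submodule.subset_span (Or.inl rfl), ?_⟩
  rintro _ ⟨a, rfl⟩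
  have ha : a ∈ Submodule.span (AnalyticGerm 𝕜 y) (Set.range f) := hf ▸ Submodule.mem_top
  induction ha using Submodule.span_induction with
  | mem a ha =>
    obtain ⟨k, rfl⟩ := ha
    exact Submodule.subset_span (Or.inr ⟨k, rfl⟩)
  | zero =>
    have : C.pbI h 0 = 0 := Subtype.ext (map_zero (C.pb h))
    rw [this]; exact zero_mem _
  | add a b _ _ ha hb => rw [C.pbI_add]; exact add_mem ha hb
  | smul c a _ ha => rw [C.pbI_smul]; exact Submodule.smul_mem _ _ ha

/-- A family of horizontal forms is analytic if its values on pullbacks of generators of the ideal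
sheaf of `L'` are analytic. -/
lemma isAnalyticFamily_slForm {V : Opens L.space} (G : ∀ z : V, L'.PointForm p (proj (Φ z.1.1)))
    (H : ∀ x : V, ∃ s : Finset (PhaseSpace 𝕜 m → 𝕜),
      (∃ hm : ∀ f : s, L'.LocallyMem f.1 (proj (Φ x.1.1)), Submodule.span
        (AnalyticGerm 𝕜 (proj (Φ x.1.1))) (Set.range fun f => (hm f).germ) = ⊤) ∧
      ∀ k : Fin p → s, ∃ g : PhaseSpace 𝕜 (m + 1) → 𝕜, AnalyticAt 𝕜 g x.1.1 ∧ ∀ᶠ z in 𝓝 x,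
        ∀ hm : ∀ i, L'.LocallyMem (k i).1 (proj (Φ z.1.1)),
          G z (fun i => (hm i).germ) = g z.1.1) :
    IsAnalyticFamily fun z : V => C.slForm (C.over_support z.1.2) (G z) := by
  intro x h hh
  obtain ⟨s, ⟨hm, hspan⟩, Hk⟩ := H x
  choose g hg Hg using Hk
  have hO := C.over_support x.1.2
  -- Each argument is a combination of `p₁ ∘ Φ` and of the pulled back generators, with coefficients
  -- that are analytic functions near `x`.
  have hexp : ∀ i, ∃ (c : s → PhaseSpace 𝕜 (m + 1) → 𝕜) (hc : ∀ f, AnalyticAt 𝕜 (c f) x.1.1)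
      (b : PhaseSpace 𝕜 (m + 1) → 𝕜) (hb : AnalyticAt 𝕜 b x.1.1),
      (hh i).germ = AnalyticGerm.mk b hb • C.germPI hO.mem +
        ∑ f, AnalyticGerm.mk (c f) (hc f) • C.pbI hO (hm f).germ := by
    intro i
    have hi : (hh i).germ ∈ Submodule.span (AnalyticGerm 𝕜 x.1.1)
        (insert (C.germPI hO.mem) (Set.range fun k => C.pbI hO (hm k).germ)) := by
      rw [C.span_finite_generators hO hspan]; trivial
    obtain ⟨b, z, hz, e⟩ := Submodule.mem_span_insert.mp hi
    obtain ⟨c, rfl⟩ := (Submodule.mem_span_range_iff_exists_fun _).mp hz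
    obtain ⟨b, hb, rfl⟩ := exists_mk b
    choose c' hc' e' using fun f => exists_mk (c f)
    refine ⟨c', hc', b, hb, ?_⟩
    rw [e]
    simp only [e']
  choose c hc b hb e using hexp
  -- This is the multilinear expansion of the form. The multiples of `p₁ ∘ Φ` make no contribution,
  -- because the slice kills them.
  refine ⟨fun z => ∑ k : Fin p → s, (∏ i, c i (k i) z) * g k z, ?_, ?_⟩
  · refine Finset.analyticAt_fun_sum _ fun k _ => AnalyticAt.mul ?_ (hg k)
    exact Finset.analyticAt_fun_prod _ fun i _ => hc i (k i)
  have hπ : ContinuousAt (fun z => proj (Φ z)) x.1.1 :=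
    (C.analyticAt_proj_comp x.1.2.1).continuousAt
  have hPm : L.LocallyMem (coordP ∘ Φ) x.1.1 := locallyMem_of_mem hO.mem _ (C.germP_mem hO.mem)
  have E1 := fun i => eventually_spread_eq (hh i).germ (hh i) rfl
  have E2 := fun i => eventually_spread_add (AnalyticGerm.mk (b i) (hb i) • C.germPI hO.mem)
    (∑ f, AnalyticGerm.mk (c i f) (hc i f) • C.pbI hO (hm f).germ)
  have E3 := fun i => eventually_spread_sum Finset.univ
    fun f => AnalyticGerm.mk (c i f) (hc i f) • C.pbI hO (hm f).germ
  have E4 := fun i => eventually_spread_smul (hb i) (C.germPI hO.mem)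
  have E5 := fun i f => eventually_spread_smul (hc i f) (C.pbI hO (hm f).germ)
  have E6 := eventually_spread_eq (C.germPI hO.mem) hPm rfl
  have E7 := fun f => eventually_spread_eq (C.pbI hO (hm f).germ)
    (C.locallyMem_comp hO (hm f)) rfl
  filter_upwards [eventually_of_nhds (eventually_all.mpr E1),
    eventually_of_nhds (eventually_all.mpr E2),
    eventually_of_nhds (eventually_all.mpr E3), eventually_of_nhds (eventually_all.mpr E4),
    eventually_of_nhds (eventually_all.mpr fun i => eventually_all.mpr (E5 i)),
    eventually_of_nhds E6, eventually_of_nhds (eventually_all.mpr E7),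
    eventually_of_nhds (hπ.eventually (eventually_all.mpr fun f => (hm f).eventually)),
    eventually_all.mpr Hg] with z h1 h2 h3 h4 h5 h6 h7 h8 h9 hmz
  have hOz := C.over_support z.1.2
  choose h4 h4' using h4
  choose h5 h5' using h5
  have h6' : spread z.1.1 (C.germPI hO.mem) = C.germPI hOz.mem := h6.choose_spec
  have h7' : ∀ f, spread z.1.1 (C.pbI hO (hm f).germ) = C.pbI hOz (h8 f).germ :=
    fun f => (h7 f).choose_spec
  -- The expansion at `x` persists at nearby points `z`; restriction to the slice through `z`
  -- removes its first term.
  have key : ∀ i, C.slI hOz (hmz i).germ =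
      ∑ f, C.sl hOz (AnalyticGerm.mk (c i f) (h5 i f)) • (h8 f).germ := by
    intro i
    have e1 : (hmz i).germ = AnalyticGerm.mk (b i) (h4 i) • C.germPI hOz.mem +
        ∑ f, AnalyticGerm.mk (c i f) (h5 i f) • C.pbI hOz (h8 f).germ := by
      have e2 : spread z.1.1 (hh i).germ = (hmz i).germ := (h1 i).choose_spec
      rw [e i, h2 i, h3 i, h4' i, h6'] at e2
      refine e2.symm.trans (congrArg₂ _ rfl (Finset.sum_congr rfl fun f _ => ?_))
      rw [h5' i f, h7' f]
    let slHom : L.ideal z.1.1 →+ L'.ideal (proj (Φ z.1.1)) := AddMonoidHom.mk' (C.slI hOz)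
      (C.slI_add hOz)
    have e3 : ∀ a, C.slI hOz a = slHom a := fun _ => rfl
    rw [e1, e3, map_add, map_sum]
    simp only [← e3, C.slI_smul, C.slI_pbI, C.slI_germPI, smul_zero, zero_add]
  rw [slForm_apply]
  simp only [key]
  change (G z).toMultilinearMap _ = _
  rw [MultilinearMap.map_sum]
  refine Finset.sum_congr rfl fun k _ => ?_
  rw [MultilinearMap.map_smul_univ, smul_eq_ev_mul, map_prod]
  congr 1
  · refine Finset.prod_congr rfl fun i _ => ?_
    rw [C.ev_sl, ev_mk]
  · exact h9 k fun i => h8 (k i)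

end IsChart
end
end InvolutiveSubspace
end

/-! ### Pullback of cochains and of sections. -/

noncomputable section

lemma AlternatingMap.eq_zero_of_curryLeft_eq_zero {R M N : Type*} [CommRing R] [AddCommGroup M]
    [Module R M] [AddCommGroup N] [Module R N] {p : ℕ} {f : M [⋀^Fin (p + 1)]→ₗ[R] N} {u : M}
    (hf : f.curryLeft u = 0) {v : Fin (p + 1) → M} {i : Fin (p + 1)} (hv : v i = u) : f v = 0 := by
  have h := f.map_insertNth i u (i.removeNth v)
  rw [← hv, Fin.insertNth_self_removeNth, hv] at h
  have h2 : f (Matrix.vecCons u (i.removeNth v)) = 0 := DFunLike.congr_fun hf (i.removeNth v)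
  rw [h, h2, smul_zero]

namespace InvolutiveSubspace
open PhaseSpace AnalyticGerm

variable {𝕜 : Type u} [RCLike 𝕜] {m : ℕ} {D : Opens (PhaseSpace 𝕜 (m + 1))}
  {D' : Opens (PhaseSpace 𝕜 m)} {L : InvolutiveSubspace D} {L' : InvolutiveSubspace D'}
  {Φ Ψ : PhaseSpace 𝕜 (m + 1) → PhaseSpace 𝕜 (m + 1)} (C : L.IsChart L' Φ Ψ)
  {x : L.support} {y : L'.support} {t : 𝕜} {p : ℕ}

namespace IsChart

/-- The class of `p₁ ∘ Φ` in `I_x / I_x²`. -/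
def conP (x : L.support) : L.Conormal x := toConormal (C.germPI x.2.1)

/-- The pullback `O_{L',y} → O_{L,x}`. -/
def pbStalk (h : Over D Φ x.1 y.1 t) : L'.Stalk y →ₐ[𝕜] L.Stalk x :=
  Ideal.Quotient.liftₐ (L'.ideal y.1) ((L.toStalk x).comp (C.pb h)) fun _ ha =>
    Ideal.Quotient.eq_zero_iff_mem.mpr (C.pb_mem h ha)

lemma pbStalk_toStalk (h : Over D Φ x.1 y.1 t) (a : AnalyticGerm 𝕜 y.1) :
    C.pbStalk h (L'.toStalk y a) = L.toStalk x (C.pb h a) := rfl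

lemma pbStalk_injective (h : Over D Φ x.1 y.1 t) : Function.Injective (C.pbStalk h) := by
  rw [injective_iff_map_eq_zero]
  intro s hs
  obtain ⟨a, rfl⟩ := L'.toStalk_surjective s
  have h1 : C.pb h a ∈ L.ideal x.1 := Ideal.Quotient.eq_zero_iff_mem.mp hs
  have h2 := C.sl_mem h h1
  rw [C.sl_pb] at h2
  exact Ideal.Quotient.eq_zero_iff_mem.mpr h2

/-- The pullback of conormal vectors. -/
def pbCon (h : Over D Φ x.1 y.1 t) (u : L'.Conormal y) : L.Conormal x :=
  toConormal (C.pbI h u.out)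

/-- The pullback maps `I'²` into `I²`, so the choice of a representative is immaterial. -/
lemma pbCon_toConormal (h : Over D Φ x.1 y.1 t) (a : L'.ideal y.1) :
    C.pbCon h (toConormal a) = toConormal (C.pbI h a) := by
  have h1 : (toConormal (toConormal a : L'.Conormal y).out : L'.Conormal y) = toConormal a :=
    toConormal_out _
  rw [toConormal_eq] at h1
  rw [pbCon, toConormal_eq]
  change C.pb h _ - C.pb h _ ∈ _
  rw [← map_sub]
  have h2 := Ideal.mem_map_of_mem (C.pb h) h1
  rw [Ideal.map_pow] at h2
  exact Ideal.pow_right_mono (Ideal.map_le_iff_le_comap.mpr fun b hb => C.pb_mem h hb) 2 h2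

lemma pbCon_lie (h : Over D Φ x.1 y.1 t) (u v : L'.Conormal y) :
    C.pbCon h ⁅u, v⁆ = ⁅C.pbCon h u, C.pbCon h v⁆ := by
  obtain ⟨a, rfl⟩ := toConormal_surjective u
  obtain ⟨b, rfl⟩ := toConormal_surjective v
  rw [lie_toConormal, C.pbCon_toConormal, C.pbCon_toConormal, C.pbCon_toConormal, lie_toConormal]
  exact congrArg _ (Subtype.ext (C.poisson_pb h _ _).symm)

lemma pbStalk_lie (h : Over D Φ x.1 y.1 t) (u : L'.Conormal y) (s : L'.Stalk y) :
    C.pbStalk h ⁅u, s⁆ = ⁅C.pbCon h u, C.pbStalk h s⁆ := by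
  obtain ⟨a, rfl⟩ := toConormal_surjective u
  obtain ⟨b, rfl⟩ := L'.toStalk_surjective s
  rw [lie_mk, C.pbCon_toConormal, pbStalk_toStalk, pbStalk_toStalk, lie_mk]
  exact congrArg _ (C.poisson_pb h _ _).symm

lemma conP_lie_pbCon (h : Over D Φ x.1 y.1 t) (u : L'.Conormal y) :
    ⁅C.conP x, C.pbCon h u⁆ = 0 := by
  obtain ⟨a, rfl⟩ := toConormal_surjective u
  rw [C.pbCon_toConormal, conP, lie_toConormal]
  exact congrArg (toConormal (L := L) (x := x)) (a₂ := 0) (Subtype.ext (C.poisson_germP_pb h _))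

lemma conP_lie_pbStalk (h : Over D Φ x.1 y.1 t) (s : L'.Stalk y) :
    ⁅C.conP x, C.pbStalk h s⁆ = 0 := by
  obtain ⟨b, rfl⟩ := L'.toStalk_surjective s
  rw [pbStalk_toStalk, conP, lie_mk]
  refine (congrArg (L.toStalk x) (C.poisson_germP_pb h _)).trans (map_zero _)

/-- Cochains that agree on `p₁ ∘ Φ` and on pullbacks are equal. -/
lemma cochain_ext (h : Over D Φ x.1 y.1 t) {φ ψ : L.Cochain p x}
    (h1 : ∀ v i, v i = C.conP x → φ v = ψ v)
    (h2 : ∀ v : Fin p → L'.Conormal y, φ (fun i => C.pbCon h (v i)) = ψ fun i => C.pbCon h (v i)) :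
    φ = ψ := by
  refine Cochain.toIdeal_injective ?_
  refine AlternatingMap.ext_of_span_eq_top (C.span_generators h) fun v hv => ?_
  rw [Cochain.toIdeal_apply, Cochain.toIdeal_apply]
  by_cases hP : ∃ i, v i = C.germPI h.mem
  · obtain ⟨i, hi⟩ := hP
    exact h1 _ i (by rw [hi]; rfl)
  · push Not at hP
    have : ∀ i, ∃ f, C.pbI h f = v i := fun i => (hv i).resolve_left (hP i)
    choose f hf using this
    obtain rfl : (fun i => C.pbI h (f i)) = v := funext hf
    have := h2 fun i => toConormal (f i)
    simpa only [C.pbCon_toConormal] using this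

/-- The cochain `ψ` is horizontal. -/
def IsHorizontalCochain (ψ : L.Cochain p x) : Prop := ∀ v i, v i = C.conP x → ψ v = 0

lemma isHorizontalCochain_iff {ψ : L.Cochain (p + 1) x} :
    C.IsHorizontalCochain ψ ↔ ψ.curryLeft (C.conP x) = 0 := by
  constructor
  · intro h
    ext v
    exact h _ 0 rfl
  · exact fun h v i hv => AlternatingMap.eq_zero_of_curryLeft_eq_zero h hv

lemma IsHorizontalCochain.evForm {ψ : L.Cochain p x} (h : C.IsHorizontalCochain ψ) :
    C.IsHorizontal x.2.1 ψ.evForm := by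
  intro a i hi
  rw [Cochain.evForm_apply, h _ i (by rw [hi]; rfl), map_zero]

/-- The terms in which the arguments are differentiated vanish, since `p₁ ∘ Φ` commutes with
pullbacks. Only the derivative of the value remains. -/
lemma lieDeriv_pbCon (h : Over D Φ x.1 y.1 t) (ψ : L.Cochain p x) (v : Fin p → L'.Conormal y) :
    LieRinehartAlgebra.lieDeriv (C.conP x) ψ (fun i => C.pbCon h (v i)) =
      ⁅C.conP x, ψ fun i => C.pbCon h (v i)⁆ := by
  rw [LieRinehartAlgebra.lieDeriv_apply]
  simp only [C.conP_lie_pbCon h, AlternatingMap.map_update_zero, Finset.sum_const_zero, sub_zero]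

/-- `𝓛_u` commutes with `i_u` because `⁅u, u⁆ = 0`. -/
lemma IsHorizontalCochain.lieDeriv {ψ : L.Cochain p x} (h : C.IsHorizontalCochain ψ) :
    C.IsHorizontalCochain (LieRinehartAlgebra.lieDeriv (C.conP x) ψ) := by
  cases p with
  | zero => exact fun v i => i.elim0
  | succ p =>
    rw [isHorizontalCochain_iff] at h ⊢
    rw [LieRinehartAlgebra.curryLeft_lieDeriv, h, lie_self, map_zero]
    ext v
    simp [LieRinehartAlgebra.lieDeriv_apply]

/-- `ψ` is the pullback of `φ`. -/
structure IsPullback (h : Over D Φ x.1 y.1 t) (φ : L'.Cochain p y) (ψ : L.Cochain p x) : Prop where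
  horizontal : C.IsHorizontalCochain ψ
  apply : ∀ v : Fin p → L'.Conormal y, ψ (fun i => C.pbCon h (v i)) = C.pbStalk h (φ v)

lemma IsPullback.unique {h : Over D Φ x.1 y.1 t} {φ : L'.Cochain p y} {ψ ψ' : L.Cochain p x}
    (h1 : C.IsPullback h φ ψ) (h2 : C.IsPullback h φ ψ') : ψ = ψ' :=
  C.cochain_ext h (fun v i hv => (h1.horizontal v i hv).trans (h2.horizontal v i hv).symm)
    fun v => (h1.apply v).trans (h2.apply v).symm

lemma IsPullback.injective {h : Over D Φ x.1 y.1 t} {φ φ' : L'.Cochain p y} {ψ : L.Cochain p x}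
    (h1 : C.IsPullback h φ ψ) (h2 : C.IsPullback h φ' ψ) : φ = φ' := by
  ext v
  exact C.pbStalk_injective h ((h1.apply v).symm.trans (h2.apply v))

lemma IsPullback.lieDeriv {h : Over D Φ x.1 y.1 t} {φ : L'.Cochain p y} {ψ : L.Cochain p x}
    (hψ : C.IsPullback h φ ψ) : LieRinehartAlgebra.lieDeriv (C.conP x) ψ = 0 := by
  refine C.cochain_ext h (fun v i hv => hψ.horizontal.lieDeriv C v i hv) fun v => ?_
  rw [C.lieDeriv_pbCon h, hψ.apply, C.conP_lie_pbStalk]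
  rfl

/-- Cartan's formula gives horizontality: `i_u δψ = -𝓛_u ψ - δ i_u ψ`, and both terms vanish for a
pullback. On pullback arguments `δ` is compatible with `π`, because the bracket and the anchor are.
-/
lemma IsPullback.delta {h : Over D Φ x.1 y.1 t} {φ : L'.Cochain p y} {ψ : L.Cochain p x}
    (hψ : C.IsPullback h φ ψ) :
    C.IsPullback h (LieRinehartAlgebra.delta 𝕜 p φ) (LieRinehartAlgebra.delta 𝕜 p ψ) := by
  constructor
  · rw [isHorizontalCochain_iff]
    cases p with
    | zero => rw [LieRinehartAlgebra.curryLeft_delta_zero, hψ.lieDeriv C, neg_zero]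
    | succ p =>
      rw [LieRinehartAlgebra.curryLeft_delta, hψ.lieDeriv C,
        C.isHorizontalCochain_iff.mp hψ.horizontal, map_zero]
      simp
  · intro v
    rw [LieRinehartAlgebra.delta_apply, LieRinehartAlgebra.delta_apply,
      LieRinehartAlgebra.deltaFun, LieRinehartAlgebra.deltaFun]
    have e1 : ∀ i : Fin (p + 1), ψ (i.removeNth fun k => C.pbCon h (v k)) =
        C.pbStalk h (φ (i.removeNth v)) := fun i => hψ.apply (i.removeNth v)
    have e2 : ∀ i j : Fin (p + 1), ψ (i.removeNth (Function.update (fun k => C.pbCon h (v k)) j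
        ⁅C.pbCon h (v i), C.pbCon h (v j)⁆)) =
        C.pbStalk h (φ (i.removeNth (Function.update v j ⁅v i, v j⁆))) := by
      intro i j
      rw [← hψ.apply, ← C.pbCon_lie]
      congr 1
      ext k
      have := congrFun (Function.comp_update (C.pbCon h) v j ⁅v i, v j⁆) (i.succAbove k)
      exact this.symm
    simp only [e1, e2, ← C.pbStalk_lie, map_add, map_sum, map_mul, map_pow, map_neg, map_one]

/-- The projection `L → L'`. -/
def piMap : L.space ⟶ L'.space :=
  TopCat.ofHom ⟨fun x => ⟨proj (Φ x.1), C.support_base (C.over_support x.2) x.2⟩, by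
    refine Continuous.subtype_mk (continuous_iff_continuousAt.mpr fun x => ?_) _
    exact (C.analyticAt_proj_comp x.2.1).continuousAt.comp continuous_subtype_val.continuousAt⟩

lemma piMap_val (x : L.support) : (C.piMap x : L'.support).1 = proj (Φ x.1) := rfl

lemma over_piMap (x : L.support) :
    Over D Φ x.1 (C.piMap x : L'.support).1 (coordQ (Φ x.1)) := C.over_support x.2

section PullbackSection
variable {V : Opens L'.space}

/-- The base point of a point over `V`. -/
def base (z : ((Opens.map C.piMap).obj V : Opens L.space)) : V := ⟨C.piMap z.1, z.2⟩

lemma continuous_base : Continuous (C.base (V := V)) :=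
  (C.piMap.hom.continuous.comp continuous_subtype_val).subtype_mk _

lemma isAnalyticFamily_pullback (φ : L'.sections p V) :
    IsAnalyticFamily (V := (Opens.map C.piMap).obj V) fun z =>
      C.slForm (C.over_support z.1.2) (φ.1 (C.base z)).evForm := by
  refine C.isAnalyticFamily_slForm (V := (Opens.map C.piMap).obj V)
    (fun z => (φ.1 (C.base z)).evForm) fun x => ?_
  obtain ⟨s, hs⟩ := L'.exists_generators (C.proj_mem x.1.1 x.1.2.1)
  refine ⟨s, hs.self_of_nhds, fun k => ?_⟩
  obtain ⟨hm, _⟩ := hs.self_of_nhds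
  have hφ : IsSection φ.1 := φ.2
  obtain ⟨g, hg, H⟩ := hφ.isAnalyticFamily (C.base x) (fun i => (k i).1) fun i => hm (k i)
  refine ⟨g ∘ fun z => proj (Φ z), ?_, ?_⟩
  · exact AnalyticAt.comp (g := g) hg (C.analyticAt_proj_comp x.1.2.1)
  · filter_upwards [C.continuous_base.continuousAt.eventually H] with z hz hmz
    exact hz hmz

/-- The pullback of a section. -/
def pullbackSection (φ : L'.sections p V) : L.sections p ((Opens.map C.piMap).obj V) :=
  ((C.isAnalyticFamily_pullback φ).exists_section C.reduced).choose

lemma evForm_pullbackSection (φ : L'.sections p V) (z : (Opens.map C.piMap).obj V) :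
    ((C.pullbackSection φ).1 z).evForm =
      C.slForm (C.over_support z.1.2) (φ.1 (C.base z)).evForm :=
  ((C.isAnalyticFamily_pullback φ).exists_section C.reduced).choose_spec z

end PullbackSection

/-- A section is horizontal if it is so at all points. -/
lemma isHorizontalCochain_of_evForm {V : Opens L.space} {ψ : ∀ x : V, L.Cochain p x.1}
    (hψ : IsSection ψ) (h : ∀ z : V, C.IsHorizontal z.1.2.1 (ψ z).evForm) (z : V) :
    C.IsHorizontalCochain (ψ z) := by
  intro v i hv
  -- The germ of `p₁ ∘ Φ` itself is put into slot `i`, so that near `z` this slot is again filled by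
  -- `p₁ ∘ Φ` and the pointwise hypothesis applies.
  obtain ⟨g, hg, e, H⟩ := hψ.eventually_repr z fun k => if k = i then C.germPI z.1.2.1 else (v k).out
  have e1 : (fun k => (toConormal (if k = i then C.germPI z.1.2.1 else (v k).out) :
      L.Conormal z.1)) = v := by
    ext k
    by_cases hk : k = i
    · subst hk; simp [hv, conP]
    · simp [hk]
  rw [e1] at e
  rw [e, ← map_zero (L.toStalk z.1)]
  refine (toStalk_mk_eq_iff_opens C.reduced (y := z) hg analyticAt_const).mpr ?_
  have hPm : L.LocallyMem (coordP ∘ Φ) z.1.1 :=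
    locallyMem_of_mem z.1.2.1 _ (C.germP_mem z.1.2.1)
  filter_upwards [H, eventually_of_nhds (eventually_spread_eq (C.germPI z.1.2.1) hPm rfl)]
    with w hw ⟨hw2, hw3⟩
  rw [← hw]
  refine h w _ i ?_
  simp only [if_true]
  exact hw3

/-- `pullbackSection` is known only through its values at points. The identities in the stalks
follow because on `L` near `z` both sides are represented by analytic functions with the same
values. -/
lemma isPullback_pullbackSection {V : Opens L'.space} (φ : L'.sections p V)
    (z : (Opens.map C.piMap).obj V) :
    C.IsPullback (C.over_piMap z.1) (φ.1 (C.base z)) ((C.pullbackSection φ).1 z) := by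
  have hs : IsSection (C.pullbackSection φ).1 := (C.pullbackSection φ).2
  have hφ : IsSection φ.1 := φ.2
  constructor
  · refine C.isHorizontalCochain_of_evForm hs (fun w => ?_) z
    rw [C.evForm_pullbackSection]
    exact C.isHorizontal_slForm _ _
  · intro v
    obtain ⟨g, hg, e, H⟩ := hφ.eventually_repr (C.base z) fun k => (v k).out
    have hv : (fun k => (toConormal (v k).out : L'.Conormal (C.base z).1)) = v :=
      funext fun k => toConormal_out _
    have hO := C.over_piMap z.1
    have hgc : AnalyticAt 𝕜 (g ∘ fun z => proj (Φ z)) z.1.1 :=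
      AnalyticAt.comp (g := g) hg (C.analyticAt_proj_comp z.1.2.1)
    have e2 : C.pbStalk hO (φ.1 (C.base z) v) = L.toStalk z.1 (AnalyticGerm.mk _ hgc) :=
      congrArg (C.pbStalk hO) ((congrArg (φ.1 (C.base z)) hv).symm.trans e)
    obtain ⟨g', hg', e', H'⟩ := hs.eventually_repr z fun k => C.pbI hO (v k).out
    refine Eq.trans e' (Eq.trans ?_ e2.symm)
    refine (toStalk_mk_eq_iff_opens C.reduced (y := z) hg' hgc).mpr ?_
    have E := fun k => eventually_spread_eq (C.pbI hO (v k).out) (C.locallyMem_comp hO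
      (locallyMem_repr (v k).out)) (by rw [← C.pbI_germ hO (locallyMem_repr (v k).out), germ_repr])
    have hπ : ContinuousAt (fun z => proj (Φ z)) z.1.1 :=
      (C.analyticAt_proj_comp z.1.2.1).continuousAt
    have E2 := fun k => hπ.eventually (locallyMem_repr (v k).out).eventually
    filter_upwards [H', C.continuous_base.continuousAt.eventually H,
      eventually_of_nhds (eventually_all.mpr E), eventually_of_nhds (eventually_all.mpr E2)]
      with w h1 h2 h3 h4
    rw [← h1, C.evForm_pullbackSection]
    -- Near `z`, spreading a pulled back germ and restricting it to a slice is the same as spreading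
    -- the original germ on the base.
    have h5 : ∀ k, C.slI (C.over_support w.1.2) (spread w.1.1 (C.pbI hO (v k).out)) =
        spread (C.base w).1.1 (v k).out := by
      intro k
      obtain ⟨h6, h7⟩ := h3 k
      rw [h7, ← C.pbI_germ (C.over_support w.1.2) (h4 k), C.slI_pbI]
      exact (spread_of_locallyMem (v k).out (h4 k)).symm
    exact Eq.trans (congrArg (φ.1 (C.base w)).evForm (funext h5)) h2

end IsChart
end InvolutiveSubspace
end

/-! ### Restriction of cochains to the lines of `L' × 𝕜`. -/

noncomputable section

lemma primitive_congr {𝕜 : Type*} [RCLike 𝕜] {q₀ t : 𝕜} {r : ℝ} {u v : 𝕜 → 𝕜}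
    (h : ∀ τ ∈ Metric.ball q₀ r, u τ = v τ) (ht : t ∈ Metric.ball q₀ r) :
    primitive q₀ u t = primitive q₀ v t := by
  refine congrArg _ (intervalIntegral.integral_congr fun s hs => ?_)
  rw [Set.uIcc_of_le zero_le_one] at hs
  exact h _ (segment_mem_ball ht hs)

lemma intervalIntegrable_segment {𝕜 : Type*} [RCLike 𝕜] {q₀ t : 𝕜} {r : ℝ} {u : 𝕜 → 𝕜}
    (hu : ∀ τ ∈ Metric.ball q₀ r, ContinuousAt u τ) (ht : t ∈ Metric.ball q₀ r) :
    IntervalIntegrable (fun s : ℝ => u (q₀ + (s : 𝕜) * (t - q₀))) MeasureTheory.volume 0 1 := by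
  refine ContinuousOn.intervalIntegrable fun s hs => ?_
  rw [Set.uIcc_of_le zero_le_one] at hs
  refine ContinuousAt.continuousWithinAt ?_
  refine ContinuousAt.comp (f := fun s : ℝ => q₀ + (s : 𝕜) * (t - q₀))
    (hu _ (segment_mem_ball ht hs)) ?_
  exact (continuous_const.add (RCLike.continuous_ofReal.mul continuous_const)).continuousAt

lemma primitive_add {𝕜 : Type*} [RCLike 𝕜] {q₀ t : 𝕜} {r : ℝ} {u v : 𝕜 → 𝕜}
    (hu : ∀ τ ∈ Metric.ball q₀ r, ContinuousAt u τ) (hv : ∀ τ ∈ Metric.ball q₀ r, ContinuousAt v τ)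
    (ht : t ∈ Metric.ball q₀ r) :
    primitive q₀ (fun τ => u τ + v τ) t = primitive q₀ u t + primitive q₀ v t := by
  rw [primitive, intervalIntegral.integral_add (intervalIntegrable_segment hu ht)
    (intervalIntegrable_segment hv ht), mul_add]
  rfl

lemma primitive_const_mul {𝕜 : Type*} [RCLike 𝕜] (q₀ t c : 𝕜) (u : 𝕜 → 𝕜) :
    primitive q₀ (fun τ => c * u τ) t = c * primitive q₀ u t := by
  rw [primitive, intervalIntegral.integral_const_mul, mul_left_comm]
  rfl

namespace InvolutiveSubspace
open PhaseSpace AnalyticGerm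

/-- The primitive of a family of point forms. -/
def PointForm.primitive {𝕜 : Type u} [RCLike 𝕜] {n : ℕ} {D : Opens (PhaseSpace 𝕜 n)}
    {L : InvolutiveSubspace D} {p : ℕ} {y : PhaseSpace 𝕜 n} {q₀ t : 𝕜} {r : ℝ}
    (e : 𝕜 → L.PointForm p y)
    (he : ∀ f, ∀ τ ∈ Metric.ball q₀ r, ContinuousAt (fun τ => e τ f) τ)
    (ht : t ∈ Metric.ball q₀ r) : L.PointForm p y where
  toFun f := _root_.primitive q₀ (fun τ => e τ f) t
  map_update_add' := by
    intro _ v i a b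
    simp only [AlternatingMap.map_update_add]
    exact primitive_add (he _) (he _) ht
  map_update_smul' := by
    intro _ v i c a
    simp only [AlternatingMap.map_update_smul, smul_eq_ev_mul]
    exact primitive_const_mul _ _ _ _
  map_eq_zero_of_eq' := by
    intro v i j hij hne
    simp only [AlternatingMap.map_eq_zero_of_eq _ v hij hne]
    simp [_root_.primitive]

variable {𝕜 : Type u} [RCLike 𝕜] {m : ℕ} {D : Opens (PhaseSpace 𝕜 (m + 1))}
  {D' : Opens (PhaseSpace 𝕜 m)} {L : InvolutiveSubspace D} {L' : InvolutiveSubspace D'}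
  {Φ Ψ : PhaseSpace 𝕜 (m + 1) → PhaseSpace 𝕜 (m + 1)} (C : L.IsChart L' Φ Ψ) {p : ℕ}

namespace IsChart

include C in
lemma analyticAt_section {x : PhaseSpace 𝕜 (m + 1)} {y : PhaseSpace 𝕜 m} {t : 𝕜}
    (h : Over D Φ x y t) :
    AnalyticAt 𝕜 (fun s : PhaseSpace 𝕜 m × 𝕜 => Ψ (emb s.1 s.2)) (y, t) := by
  refine AnalyticAt.comp (f := fun s : PhaseSpace 𝕜 m × 𝕜 => emb s.1 s.2) ?_ (analyticAt_emb (y, t))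
  change AnalyticAt 𝕜 Ψ (emb y t)
  rw [← h.eq]
  exact C.analyticAt_inv x h.mem

variable {V : Opens L.space}

include C in
/-- The points near `(y, t)` have points of `L` over them. -/
lemma eventually_over {z : V} {y : L'.support} {t : 𝕜} (h : Over D Φ z.1.1 y.1 t) {P : V → Prop}
    (hP : ∀ᶠ w in 𝓝 z, P w) :
    ∀ᶠ s : L'.support × 𝕜 in 𝓝 (y, t), ∃ w : V, Over D Φ w.1.1 s.1.1 s.2 ∧ P w := by
  have h1 := eventually_opens.mpr hP
  have hV : ∀ᶠ w in 𝓝 z.1.1, ∀ hw : w ∈ L.support, (⟨w, hw⟩ : L.support) ∈ V :=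
    eventually_support.mpr (V.2.mem_nhds z.2)
  have hc : ContinuousAt (fun s : L'.support × 𝕜 => Ψ (emb s.1.1 s.2)) (y, t) :=
    ContinuousAt.comp (f := fun s : L'.support × 𝕜 => (s.1.1, s.2))
      (g := fun s : PhaseSpace 𝕜 m × 𝕜 => Ψ (emb s.1 s.2)) (C.analyticAt_section h).continuousAt
      (by fun_prop)
  have hc' : Tendsto (fun s : L'.support × 𝕜 => Ψ (emb s.1.1 s.2)) (𝓝 (y, t)) (𝓝 z.1.1) := by
    have := hc.tendsto
    rwa [C.slice_eq h] at this
  have he : ContinuousAt (fun s : L'.support × 𝕜 => emb s.1.1 s.2) (y, t) :=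
    (continuous_emb.comp (f := fun s : L'.support × 𝕜 => (s.1.1, s.2)) (by fun_prop)).continuousAt
  have hr := C.right_inv z.1.1 h.mem
  rw [h.eq] at hr
  filter_upwards [hc'.eventually h1, hc'.eventually hV, hc'.eventually (D.2.mem_nhds h.mem),
    he.eventually hr] with s hs1 hs2 hs3 hs4
  have hO : Over D Φ (Ψ (emb s.1.1 s.2)) s.1.1 s.2 := ⟨hs3, hs4⟩
  have hsup := C.support_of_over hO s.1.2
  exact ⟨⟨⟨_, hsup⟩, hs2 hsup⟩, hO, hs1 hsup (hs2 hsup)⟩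

include C in
lemma eq_of_over {z w : V} {y : PhaseSpace 𝕜 m} {t : 𝕜} (hz : Over D Φ z.1.1 y t)
    (hw : Over D Φ w.1.1 y t) : z = w :=
  Subtype.ext (Subtype.ext ((C.slice_eq hz).symm.trans (C.slice_eq hw)))

lemma piMap_eq_of_over {z : L.support} {y : L'.support} {t : 𝕜} (hz : Over D Φ z.1 y.1 t) :
    C.piMap z = y :=
  Subtype.ext (by rw [piMap_val, hz.eq, proj_emb])

open Classical in
/-- The restriction of a family of cochains to the point of `L` over `(y, t)`, as a form
on `I'_y`. -/
def lineForm (ψ : ∀ z : V, L.Cochain p z.1) (y : PhaseSpace 𝕜 m) (t : 𝕜) : L'.PointForm p y :=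
  -- The point over `(y, t)` is unique (`eq_of_over`), so the choice is harmless. The form now lives
  -- on `I'_y`, which does not depend on `t`; therefore it can be differentiated and integrated in
  -- `t`.
  if h : ∃ z : V, Over D Φ z.1.1 y t then C.pbForm h.choose_spec (ψ h.choose).evForm else 0

lemma lineForm_eq (ψ : ∀ z : V, L.Cochain p z.1) {z : V} {y : PhaseSpace 𝕜 m} {t : 𝕜}
    (h : Over D Φ z.1.1 y t) : C.lineForm ψ y t = C.pbForm h (ψ z).evForm := by
  have h' : ∃ z : V, Over D Φ z.1.1 y t := ⟨z, h⟩
  have key : ∀ w : V, ∀ hw : Over D Φ w.1.1 y t,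
      C.pbForm hw (ψ w).evForm = C.pbForm h (ψ z).evForm := by
    intro w hw
    obtain rfl := C.eq_of_over h hw
    rfl
  rw [lineForm, dif_pos h']
  exact key _ _

/-- One analytic `g` represents the value in the stalk at `z` and, in the coordinates `(y, t)`, the
values of the line forms at the neighbouring points. It gives joint analyticity as well as the
derivative in `t`. -/
lemma eventually_lineForm {ψ : ∀ z : V, L.Cochain p z.1} (hψ : IsSection ψ) {z : V} {y : L'.support}
    {t : 𝕜} (h : Over D Φ z.1.1 y.1 t) {k : Fin p → PhaseSpace 𝕜 m → 𝕜}
    (hk : ∀ i, L'.LocallyMem (k i) y.1) :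
    ∃ (g : PhaseSpace 𝕜 (m + 1) → 𝕜) (hg : AnalyticAt 𝕜 g z.1.1),
      ψ z (fun i => toConormal (C.pbI h (hk i).germ)) = L.toStalk z.1 (AnalyticGerm.mk g hg) ∧
      ∀ᶠ s : L'.support × 𝕜 in 𝓝 (y, t), ∀ hm : ∀ i, L'.LocallyMem (k i) s.1.1,
        C.lineForm ψ s.1.1 s.2 (fun i => (hm i).germ) = g (Ψ (emb s.1.1 s.2)) := by
  obtain ⟨g, hg, e, H⟩ := hψ.eventually_repr z fun i => C.pbI h (hk i).germ
  refine ⟨g, hg, e, ?_⟩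
  have E := fun i => eventually_spread_eq (C.pbI h (hk i).germ) (C.locallyMem_comp h (hk i)) rfl
  filter_upwards [C.eventually_over h (H.and (eventually_of_nhds (eventually_all.mpr E)))]
    with s ⟨w, hw, h1, h2⟩ hm
  rw [C.lineForm_eq ψ hw, pbForm_apply, C.slice_eq hw, ← h1]
  congr 1
  ext1 i
  obtain ⟨h3, h4⟩ := h2 i
  rw [h4]
  rfl

lemma exists_repr {y : PhaseSpace 𝕜 m} (hy : y ∈ D') (f : Fin p → L'.ideal y) :
    ∃ (k : Fin p → PhaseSpace 𝕜 m → 𝕜) (hk : ∀ i, L'.LocallyMem (k i) y),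
      f = fun i => (hk i).germ := by
  choose k hk e using fun i => exists_locallyMem hy (f i)
  exact ⟨k, hk, funext e⟩

/-- The derivative along the lines of `L' × 𝕜` is the Lie derivative along `p₁ ∘ Φ`. -/
lemma hasDerivAt_lineForm {ψ : ∀ z : V, L.Cochain p z.1} (hψ : IsSection ψ) {z : V}
    {y : PhaseSpace 𝕜 m} {t : 𝕜} (h : Over D Φ z.1.1 y t) (f : Fin p → L'.ideal y) :
    HasDerivAt (fun τ => C.lineForm ψ y τ f)
      (Cochain.evForm (LieRinehartAlgebra.lieDeriv (C.conP z.1) (ψ z)) fun i => C.pbI h (f i)) t ∧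
    AnalyticAt 𝕜 (fun τ => C.lineForm ψ y τ f) t := by
  have hy := C.support_base h z.1.2
  obtain ⟨k, hk, rfl⟩ := exists_repr hy.1 f
  obtain ⟨g, hg, e, H⟩ := C.eventually_lineForm hψ (y := ⟨y, hy⟩) h hk
  have hc : ContinuousAt (fun τ : 𝕜 => ((⟨y, hy⟩ : L'.support), τ)) t := by fun_prop
  have H2 : (fun τ => C.lineForm ψ y τ fun i => (hk i).germ) =ᶠ[𝓝 t]
      fun τ => g (Ψ (emb y τ)) := (hc.eventually H).mono fun τ hτ => hτ hk
  constructor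
  · refine HasDerivAt.congr_of_eventuallyEq ?_ H2
    have h1 := C.hasDerivAt_slice h hg
    have h2 := C.lieDeriv_pbCon (y := ⟨y, hy⟩) h (ψ z) fun i => toConormal (hk i).germ
    simp only [C.pbCon_toConormal] at h2
    have h3 := lie_mk (x := z.1) (C.germPI z.1.2.1) (AnalyticGerm.mk g hg)
    have h4 : Cochain.evForm (LieRinehartAlgebra.lieDeriv (C.conP z.1) (ψ z))
        (fun i => C.pbI h (hk i).germ) = evStalk z.1 ⁅C.conP z.1, ψ z fun i =>
          toConormal (C.pbI h (hk i).germ)⁆ := congrArg (evStalk z.1) h2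
    -- The value of `𝓛_u ψ` is that of `{p₁ ∘ Φ, g}`, which is the derivative of `g` along the line
    -- by `hasDerivAt_slice`.
    rw [h4, e, conP, h3]
    exact h1
  · refine AnalyticAt.congr ?_ H2.symm
    have h1 : AnalyticAt 𝕜 (fun s : PhaseSpace 𝕜 m × 𝕜 => g (Ψ (emb s.1 s.2))) (y, t) :=
      AnalyticAt.comp_of_eq (g := g) hg (C.analyticAt_section h) (C.slice_eq h)
    exact AnalyticAt.comp (f := fun τ : 𝕜 => (y, τ)) h1 (analyticAt_const.prod analyticAt_id)

/-- The points over `U'` with `q₁` in the ball. -/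
def box (U' : Opens L'.space) (q : 𝕜) (r : ℝ) : Opens L.space :=
  ⟨{z | C.piMap z ∈ U' ∧ coordQ (Φ z.1) ∈ Metric.ball q r}, by
    refine (U'.2.preimage C.piMap.hom.continuous).inter ?_
    refine IsOpen.preimage (f := fun z : L.support => coordQ (Φ z.1)) ?_ Metric.isOpen_ball
    exact continuous_coordQ.comp (continuous_iff_continuousAt.mpr fun z =>
      (C.analyticAt z.1 z.2.1).continuousAt.comp continuous_subtype_val.continuousAt)⟩

/-- Product neighbourhoods whose second factor is a ball around `q₁(x)` are used, since such a ball
contains the segments from its centre and is connected. -/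
lemma exists_box {x : L.support} {P : L'.support × 𝕜 → Prop}
    (hP : ∀ᶠ s in 𝓝 (C.piMap x, coordQ (Φ x.1)), P s) :
    ∃ (U' : Opens L'.space) (r : ℝ), 0 < r ∧ C.piMap x ∈ U' ∧
      x ∈ C.box U' (coordQ (Φ x.1)) r ∧
      ∀ y ∈ U', ∀ t ∈ Metric.ball (coordQ (Φ x.1)) r, P (y, t) := by
  rw [nhds_prod_eq, eventually_prod_iff] at hP
  obtain ⟨P1, h1, P2, h2, H⟩ := hP
  obtain ⟨U, hU, hUo, hx⟩ := eventually_nhds_iff.mp h1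
  obtain ⟨r, hr, hr2⟩ := Metric.eventually_nhds_iff_ball.mp h2
  exact ⟨⟨U, hUo⟩, r, hr, hx, ⟨hx, Metric.mem_ball_self hr⟩,
    fun y hy t ht => H (hU y hy) (hr2 t ht)⟩

end IsChart
end InvolutiveSubspace
end

/-! ### Primitives and descent of horizontal sections. -/

noncomputable section

namespace InvolutiveSubspace
open PhaseSpace AnalyticGerm

variable {𝕜 : Type u} [RCLike 𝕜] {m : ℕ} {D : Opens (PhaseSpace 𝕜 (m + 1))}
  {D' : Opens (PhaseSpace 𝕜 m)} {L : InvolutiveSubspace D} {L' : InvolutiveSubspace D'}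
  {Φ Ψ : PhaseSpace 𝕜 (m + 1) → PhaseSpace 𝕜 (m + 1)} (C : L.IsChart L' Φ Ψ) {p : ℕ}
  {V : Opens L.space}

namespace IsChart

lemma isSection_curryLeft {ψ : ∀ z : V, L.Cochain (p + 1) z.1} (hψ : IsSection ψ) :
    IsSection (p := p) fun z => (ψ z).curryLeft (C.conP z.1) := by
  rw [isSection_iff] at hψ ⊢
  intro y h hh
  have hP : ∀ z : V, L.LocallyMem (coordP ∘ Φ) z.1.1 := fun z =>
    locallyMem_of_mem z.1.2.1 _ (C.germP_mem z.1.2.1)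
  have key : ∀ z : V, (∀ i, L.LocallyMem (h i) z.1.1) →
      ∀ i, L.LocallyMem ((Fin.cons (coordP ∘ Φ) h : Fin (p + 1) → PhaseSpace 𝕜 (m + 1) → 𝕜) i) z.1.1 :=
    fun z hz i => Fin.cases (hP z) (fun i => hz i) i
  obtain ⟨g, hg, H⟩ := hψ y (Fin.cons (coordP ∘ Φ) h) (key y hh)
  refine ⟨g, hg, H.mono fun z hz hm hgz => ?_⟩
  rw [← hz (key z hm) hgz]
  refine congrArg (ψ z) (funext fun i => ?_)
  refine Fin.cases ?_ (fun i => ?_) i <;> rfl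

lemma isSection_neg {n : ℕ} {D : Opens (PhaseSpace 𝕜 n)} {L : InvolutiveSubspace D}
    {V : Opens L.space} {ψ : ∀ z : V, L.Cochain p z.1} (hψ : IsSection ψ) :
    IsSection (p := p) fun z => - ψ z := (L.sections p V).neg_mem hψ

lemma isSection_sub {n : ℕ} {D : Opens (PhaseSpace 𝕜 n)} {L : InvolutiveSubspace D}
    {V : Opens L.space} {ψ χ : ∀ z : V, L.Cochain p z.1} (hψ : IsSection ψ) (hχ : IsSection χ) :
    IsSection (p := p) fun z => ψ z - χ z := (L.sections p V).sub_mem hψ hχ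

/-- Cartan's formula expresses `𝓛_u` through `δ` and the contraction with `u`, and both preserve
sections. -/
lemma isSection_lieDeriv {ψ : ∀ z : V, L.Cochain p z.1} (hψ : IsSection ψ) :
    IsSection (p := p) fun z => LieRinehartAlgebra.lieDeriv (C.conP z.1) (ψ z) := by
  cases p with
  | zero =>
    convert isSection_neg (C.isSection_curryLeft hψ.delta) using 2 with z
    rw [LieRinehartAlgebra.curryLeft_delta_zero, neg_neg]
  | succ p =>
    convert isSection_sub (isSection_neg (C.isSection_curryLeft hψ.delta))
      (C.isSection_curryLeft hψ).delta using 2 with z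
    rw [LieRinehartAlgebra.curryLeft_delta]
    abel

lemma ext_lineForm {ψ χ : ∀ z : V, L.Cochain p z.1} (hψ : IsSection ψ)
    (hχ : IsSection χ) (h1 : ∀ z, C.IsHorizontalCochain (ψ z))
    (h2 : ∀ z, C.IsHorizontalCochain (χ z))
    (h : ∀ (z : V) (f : Fin p → L'.ideal (proj (Φ z.1.1))),
      (ψ z).evForm (fun i => C.pbI (C.over_support z.1.2) (f i)) =
      (χ z).evForm (fun i => C.pbI (C.over_support z.1.2) (f i))) : ψ = χ := by
  refine hψ.ext_evForm C.reduced hχ fun z => ?_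
  rw [← C.slForm_pbForm (C.over_support z.1.2) (h1 z).evForm,
    ← C.slForm_pbForm (C.over_support z.1.2) (h2 z).evForm]
  congr 1
  ext f
  exact h z f

/-- Horizontal sections have horizontal primitives along the lines of `L' × 𝕜`. -/
lemma exists_primitive {η : ∀ z : V, L.Cochain p z.1} (hη : IsSection η)
    (hh : ∀ z, C.IsHorizontalCochain (η z)) (x : V) :
    ∃ (V₁ : Opens L.space) (_ : x.1 ∈ V₁) (hV : V₁ ≤ V) (κ : L.sections p V₁),
      (∀ z, C.IsHorizontalCochain (κ.1 z)) ∧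
      ∀ z : V₁, LieRinehartAlgebra.lieDeriv (C.conP z.1) (κ.1 z) = η ⟨z.1, hV z.2⟩ := by
  have hO := C.over_piMap x.1
  obtain ⟨s, hs⟩ := L'.exists_generators (C.proj_mem x.1.1 x.1.2.1)
  obtain ⟨hm, -⟩ := hs.self_of_nhds
  choose g hg e H using fun k : Fin p → s =>
    C.eventually_lineForm hη hO (k := fun i => (k i).1) fun i => hm (k i)
  set q₀ := coordQ (Φ x.1.1) with hq₀
  have hG : ∀ k, AnalyticAt 𝕜 (fun s : PhaseSpace 𝕜 m × 𝕜 => g k (Ψ (emb s.1 s.2)))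
      ((C.piMap x.1 : L'.support).1, q₀) := fun k =>
    AnalyticAt.comp_of_eq (g := g k) (hg k) (C.analyticAt_section hO) (C.slice_eq hO)
  have hK := fun k => analyticAt_primitive (hG k)
  have hc : ContinuousAt (fun s : L'.support × 𝕜 => (s.1.1, s.2)) (C.piMap x.1, q₀) := by fun_prop
  have hc' : ContinuousAt (fun s : L'.support × 𝕜 => s.1.1) (C.piMap x.1, q₀) := by fun_prop
  -- The box is so small that every `(y, t)` in it has a point of `V` above it, the functions `g k`
  -- give the values of `η` on the generators, their primitives are analytic, and `s` still
  -- generates `I'`.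
  obtain ⟨U', r, hr, hxU, hxb, hbox⟩ := C.exists_box
    ((C.eventually_over (P := fun _ => True) hO (Eventually.of_forall fun _ => trivial)).and
    ((eventually_all.mpr H).and ((hc.eventually (eventually_all.mpr fun k =>
      (hK k).eventually_analyticAt)).and (hc'.eventually hs))))
  set V₁ := C.box U' q₀ r with hV₁
  have hov : ∀ y ∈ U', ∀ t ∈ Metric.ball q₀ r, ∃ w : V, Over D Φ w.1.1 y.1 t :=
    fun y hy t ht => let ⟨w, hw, _⟩ := (hbox y hy t ht).1; ⟨w, hw⟩
  have hV : V₁ ≤ V := by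
    intro z hz
    obtain ⟨w, hw⟩ := hov _ hz.1 _ hz.2
    have : z = w.1 := Subtype.ext ((C.slice_eq (C.over_piMap z)).symm.trans (C.slice_eq hw))
    rw [this]
    exact w.2
  have han : ∀ z : V₁, ∀ f, ∀ τ ∈ Metric.ball q₀ r,
      AnalyticAt 𝕜 (fun τ => C.lineForm η (proj (Φ z.1.1)) τ f) τ := by
    intro z f τ hτ
    obtain ⟨w, hw⟩ := hov _ z.2.1 τ hτ
    exact (C.hasDerivAt_lineForm hη hw f).2
  -- The integral of `η` over the segment from `q₀` to `q₁(z)` in the line through `z`.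
  let G : ∀ z : V₁, L'.PointForm p (proj (Φ z.1.1)) := fun z =>
    PointForm.primitive (C.lineForm η (proj (Φ z.1.1)))
      (fun f τ hτ => (han z f τ hτ).continuousAt) z.2.2
  have hGa : ∀ z f, G z f = primitive q₀ (fun τ => C.lineForm η (proj (Φ z.1.1)) τ f)
    (coordQ (Φ z.1.1)) := fun z f => rfl
  have hF : IsAnalyticFamily fun z : V₁ => C.slForm (C.over_support z.1.2) (G z) := by
    refine C.isAnalyticFamily_slForm G fun z => ?_
    obtain ⟨-, -, h3, h4⟩ := hbox _ z.2.1 _ z.2.2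
    refine ⟨s, h4, fun k => ⟨_, AnalyticAt.comp (f := fun w => (proj (Φ w), coordQ (Φ w))) (h3 k)
      ((C.analyticAt_proj_comp z.1.2.1).prod ((analyticAt_coordQ _).comp
        (C.analyticAt z.1.1 z.1.2.1))), Eventually.of_forall fun w hmw => ?_⟩⟩
    rw [hGa]
    exact primitive_congr (v := fun τ => g k (Ψ (emb (proj (Φ w.1.1)) τ)))
      (fun τ hτ => (hbox _ w.2.1 _ hτ).2.1 k hmw) w.2.2
  obtain ⟨κ, hκ⟩ := hF.exists_section C.reduced
  have hκs : IsSection κ.1 := κ.2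
  have hκh : ∀ z, C.IsHorizontalCochain (κ.1 z) := fun z =>
    C.isHorizontalCochain_of_evForm hκs (fun w => by
      rw [hκ]; exact C.isHorizontal_slForm _ _) z
  refine ⟨V₁, hxb, hV, κ, hκh, fun z => ?_⟩
  -- Both sides are horizontal sections, so they may be compared through their values on pullbacks.
  have := C.ext_lineForm (C.isSection_lieDeriv hκs) (IsSection.restrict hV hη)
    (fun w => (hκh w).lieDeriv C) (fun w => hh _) fun z f => ?_
  · exact congrFun this z
  have hOz := C.over_support z.1.2
  have h1 := (C.hasDerivAt_lineForm hκs hOz f).1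
  have h2 := hasDerivAt_primitive (han z f) z.2.2
  -- Along the line through `z`, the section `κ` is the primitive of `η`. Its derivative is thus `η`
  -- by calculus and `𝓛_u κ` by `hasDerivAt_lineForm`.
  have h3 : (fun τ => C.lineForm κ.1 (proj (Φ z.1.1)) τ f) =ᶠ[𝓝 (coordQ (Φ z.1.1))]
      primitive q₀ fun τ => C.lineForm η (proj (Φ z.1.1)) τ f := by
    filter_upwards [Metric.isOpen_ball.mem_nhds z.2.2] with τ hτ
    obtain ⟨w, hw⟩ := hov _ z.2.1 τ hτ
    have e1 : C.piMap w.1 = C.piMap z.1 := C.piMap_eq_of_over hw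
    have e2 : coordQ (Φ w.1.1) = τ := by rw [hw.eq, coordQ_emb]
    have hwV : w.1 ∈ V₁ := ⟨e1 ▸ z.2.1, by rw [e2]; exact hτ⟩
    have e3 : ∀ (w : V₁) (y : PhaseSpace 𝕜 m) (τ : 𝕜) (hw : Over D Φ w.1.1 y τ) (f : Fin p → L'.ideal y),
        C.lineForm κ.1 y τ f = primitive q₀ (fun τ => C.lineForm η y τ f) τ := by
      intro w y τ hw f
      obtain rfl : y = proj (Φ w.1.1) := by rw [hw.eq, proj_emb]
      obtain rfl : τ = coordQ (Φ w.1.1) := by rw [hw.eq, coordQ_emb]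
      rw [C.lineForm_eq κ.1 hw, hκ, C.pbForm_slForm]
      rfl
    exact e3 ⟨w.1, hwV⟩ _ τ hw f
  rw [h1.unique (h2.congr_of_eventuallyEq h3)]
  rw [C.lineForm_eq η (z := ⟨z.1, hV z.2⟩) hOz]
  rfl

/-- Horizontal sections that are constant along the lines of `L' × 𝕜` are pullbacks. -/
lemma exists_descent {ψ : ∀ z : V, L.Cochain p z.1} (hψ : IsSection ψ)
    (hh : ∀ z, C.IsHorizontalCochain (ψ z))
    (hl : ∀ z, LieRinehartAlgebra.lieDeriv (C.conP z.1) (ψ z) = 0) (x : V) :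
    ∃ (V₁ : Opens L.space) (_ : x.1 ∈ V₁) (hV : V₁ ≤ V) (U' : Opens L'.space)
      (hU : V₁ ≤ (Opens.map C.piMap).obj U') (φ : L'.sections p U'),
      ∀ z : V₁, ψ ⟨z.1, hV z.2⟩ = (C.pullbackSection φ).1 ⟨z.1, hU z.2⟩ := by
  have hO := C.over_piMap x.1
  obtain ⟨U', r, hr, hxU, hxb, hbox⟩ := C.exists_box
    (C.eventually_over (P := fun _ => True) hO (Eventually.of_forall fun _ => trivial))
  set q₀ := coordQ (Φ x.1.1) with hq₀
  set V₁ := C.box U' q₀ r with hV₁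
  have hov : ∀ y ∈ U', ∀ t ∈ Metric.ball q₀ r, ∃ w : V, Over D Φ w.1.1 y.1 t :=
    fun y hy t ht => let ⟨w, hw, _⟩ := hbox y hy t ht; ⟨w, hw⟩
  have hV : V₁ ≤ V := by
    intro z hz
    obtain ⟨w, hw⟩ := hov _ hz.1 _ hz.2
    have : z = w.1 := Subtype.ext ((C.slice_eq (C.over_piMap z)).symm.trans (C.slice_eq hw))
    rw [this]
    exact w.2
  -- The section on `L'` is the restriction of `ψ` to the slice `q₁ = q₀`.
  have hF : IsAnalyticFamily fun y : U' => C.lineForm ψ y.1.1 q₀ := by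
    intro y k hk
    obtain ⟨w, hw⟩ := hov y.1 y.2 q₀ (Metric.mem_ball_self hr)
    obtain ⟨g, hg, -, H⟩ := C.eventually_lineForm hψ hw hk
    refine ⟨fun y => g (Ψ (emb y q₀)), ?_, ?_⟩
    · exact AnalyticAt.comp_of_eq (g := g) hg (C.analyticAt_slice hw) (C.slice_eq hw)
    · have hc : ContinuousAt (fun z : U' => ((z.1 : L'.support), q₀)) y := by fun_prop
      exact hc.eventually H
  obtain ⟨φ, hφ⟩ := hF.exists_section C.reduced'
  have hU : V₁ ≤ (Opens.map C.piMap).obj U' := fun z hz => hz.1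
  refine ⟨V₁, hxb, hV, U', hU, φ, ?_⟩
  refine congrFun ((IsSection.restrict hV hψ).ext_evForm C.reduced
    (IsSection.restrict hU (C.pullbackSection φ).2) fun z => ?_)
  have hz := C.over_support z.1.2
  refine Eq.trans ?_ (C.evForm_pullbackSection φ ⟨z.1, hU z.2⟩).symm
  rw [hφ]
  refine (C.slForm_pbForm hz (hh ⟨z.1, hV z.2⟩).evForm).symm.trans ?_
  refine congrArg (C.slForm hz) ?_
  rw [← C.lineForm_eq ψ (z := ⟨z.1, hV z.2⟩) hz]
  ext f
  -- As `𝓛_u ψ = 0`, the line forms have zero derivative on the connected ball; hence the values at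
  -- `q₁(z)` and at `q₀` agree.
  refine (Metric.isOpen_ball (x := q₀) (ε := r)).is_const_of_deriv_eq_zero
    (f := fun τ => C.lineForm ψ (proj (Φ z.1.1)) τ f) (convex_ball q₀ r).isPreconnected ?_ ?_ z.2.2 (Metric.mem_ball_self hr)
  · intro τ hτ
    obtain ⟨w, hw⟩ := hov _ z.2.1 τ hτ
    exact (C.hasDerivAt_lineForm hψ hw f).1.differentiableAt.differentiableWithinAt
  · intro τ hτ
    obtain ⟨w, hw⟩ := hov _ z.2.1 τ hτ
    refine (C.hasDerivAt_lineForm hψ hw f).1.deriv.trans ?_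
    rw [hl w]
    exact map_zero (evStalk w.1)

/-- A section is determined by its pullback. -/
lemma exists_eq_of_pullbackSection_eq {U' : Opens L'.space} {φ φ' : L'.sections p U'} (x : V)
    (hU : V ≤ (Opens.map C.piMap).obj U')
    (h : ∀ z : V, (C.pullbackSection φ).1 ⟨z.1, hU z.2⟩ = (C.pullbackSection φ').1 ⟨z.1, hU z.2⟩) :
    ∃ (U₁ : Opens L'.space) (_ : C.piMap x.1 ∈ U₁) (hU₁ : U₁ ≤ U'),
      ∀ y : U₁, φ.1 ⟨y.1, hU₁ y.2⟩ = φ'.1 ⟨y.1, hU₁ y.2⟩ := by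
  -- The slice `q₁ = q₁(x)` stays in `V` over a neighbourhood `U₁` of `π(x)`, so each point of `U₁`
  -- is the image of a point of `V`.
  obtain ⟨U₁, r, hr, hxU, -, hbox⟩ := C.exists_box
    (C.eventually_over (P := fun _ => True) (C.over_piMap x.1) (Eventually.of_forall fun _ => trivial))
  have hov : ∀ y ∈ U₁, ∃ w : V, C.piMap w.1 = y := fun y hy =>
    let ⟨w, hw, _⟩ := hbox y hy _ (Metric.mem_ball_self hr); ⟨w, C.piMap_eq_of_over hw⟩
  have hU₁ : U₁ ≤ U' := by
    intro y hy
    obtain ⟨w, rfl⟩ := hov y hy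
    exact hU w.2
  refine ⟨U₁, hxU, hU₁, fun ⟨y, hy⟩ => ?_⟩
  obtain ⟨w, rfl⟩ := hov y hy
  have h1 := C.isPullback_pullbackSection φ ⟨w.1, hU w.2⟩
  have h2 := C.isPullback_pullbackSection φ' ⟨w.1, hU w.2⟩
  rw [← h w] at h2
  exact IsPullback.injective C h1 h2

end IsChart
end InvolutiveSubspace
end

/-! ### Stalks of inverse image sheaves and a criterion for quasi-isomorphisms. -/

noncomputable section

namespace TopCat.Sheaf
variable {A : Type*} [Category.{u} A] [Limits.HasColimits A] {X Y : TopCat.{u}}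

/-- The map of stalks that is induced by a morphism of sheaves. -/
def stalkMap {F G : X.Sheaf A} (α : F ⟶ G) (x : X) : F.presheaf.stalk x ⟶ G.presheaf.stalk x :=
  (Presheaf.stalkFunctor A x).map α.1

/-- The map of sections that is induced by a morphism of sheaves. -/
def appMap {F G : X.Sheaf A} (α : F ⟶ G) (V : Opens X) :
    F.presheaf.obj (op V) ⟶ G.presheaf.obj (op V) := α.1.app (op V)

lemma germ_stalkMap {F G : X.Sheaf A} (α : F ⟶ G) (V : Opens X) (x : X) (hx : x ∈ V) :
    F.presheaf.germ V x hx ≫ stalkMap α x = appMap α V ≫ G.presheaf.germ V x hx :=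
  Presheaf.stalkFunctor_map_germ V x hx α.1

lemma stalkMap_comp {F G H : X.Sheaf A} (α : F ⟶ G) (β : G ⟶ H) (x : X) :
    stalkMap (α ≫ β) x = stalkMap α x ≫ stalkMap β x :=
  (Presheaf.stalkFunctor A x).map_comp α.1 β.1

variable {FA : A → A → Type*} {CA : A → Type u}
variable [∀ X Y, FunLike (FA X Y) (CA X) (CA Y)] [ConcreteCategory.{u} A FA]
variable [Limits.HasLimits A] [Limits.PreservesLimits (CategoryTheory.forget A)]
variable [Limits.PreservesFilteredColimits (CategoryTheory.forget A)]
variable [(CategoryTheory.forget A).ReflectsIsomorphisms] (f : X ⟶ Y)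

/-- The unit of the adjunction between `f⁻¹` and `f_*`, on sections. -/
def unitApp (F : Y.Sheaf A) (V : Opens Y) :
    F.presheaf.obj (op V) ⟶ ((pullback A f).obj F).presheaf.obj (op ((Opens.map f).obj V)) :=
  ((pullbackPushforwardAdjunction A f).unit.app F).1.app (op V)

/-- The natural map from the stalk of `F` at `f x` to the stalk of `f⁻¹ F` at `x`. -/
def stalkToPullback (F : Y.Sheaf A) (x : X) :
    F.presheaf.stalk (f x) ⟶ ((pullback A f).obj F).presheaf.stalk x :=
  stalkMap ((pullbackPushforwardAdjunction A f).unit.app F) (f x) ≫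
    Presheaf.stalkPushforward A f ((pullback A f).obj F).presheaf x

lemma germ_stalkToPullback (F : Y.Sheaf A) (x : X) (V : Opens Y) (hV : f x ∈ V)
    (hV' : x ∈ (Opens.map f).obj V) :
    F.presheaf.germ V (f x) hV ≫ stalkToPullback f F x = unitApp f F V ≫
      ((pullback A f).obj F).presheaf.germ ((Opens.map f).obj V) x hV' :=
  (Category.assoc _ _ _).symm.trans <|
    (congrArg (· ≫ Presheaf.stalkPushforward A f ((pullback A f).obj F).presheaf x)
      (germ_stalkMap ((pullbackPushforwardAdjunction A f).unit.app F) V (f x) hV)).trans <|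
    (Category.assoc _ _ _).trans <| congrArg (unitApp f F V ≫ ·)
      (Presheaf.stalkPushforward_germ A f ((pullback A f).obj F).presheaf V x hV)

/-- Morphisms from the stalk at `x` to `M` correspond to morphisms into the skyscraper sheaf with
value `M`. By adjunction these are morphisms from `F` to its direct image, and they are determined
by the composite with the map of stalks. -/
instance epi_stalkToPullback (F : Y.Sheaf A) (x : X) : Epi (stalkToPullback f F x) := by
  classical
  refine ⟨fun {M} a b h => ?_⟩
  let s : ∀ a : ((pullback A f).obj F).presheaf.stalk x ⟶ M,
      (pullback A f).obj F ⟶ skyscraperSheaf x M := fun a =>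
    ⟨StalkSkyscraperPresheafAdjunctionAuxs.toSkyscraperPresheaf x a⟩
  have key : s a = s b := by
    refine ((pullbackPushforwardAdjunction A f).homEquiv _ _).injective ?_
    rw [Adjunction.homEquiv_unit, Adjunction.homEquiv_unit]
    apply CategoryTheory.Sheaf.hom_ext
    refine NatTrans.ext (funext fun V => ?_)
    change unitApp f F V.unop ≫ appMap (s a) ((Opens.map f).obj V.unop) =
      unitApp f F V.unop ≫ appMap (s b) ((Opens.map f).obj V.unop)
    -- If `V` contains `f x`, the skyscraper map is the germ map followed by the given morphism;
    -- otherwise it takes one and the same value for all morphisms.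
    by_cases hx : x ∈ (Opens.map f).obj V.unop
    · obtain ⟨ε, e⟩ : ∃ ε : M ⟶ (skyscraperSheaf x M).presheaf.obj (op ((Opens.map f).obj V.unop)),
          ∀ a, appMap (s a) ((Opens.map f).obj V.unop) =
            ((pullback A f).obj F).presheaf.germ ((Opens.map f).obj V.unop) x hx ≫ a ≫ ε :=
        ⟨eqToHom (if_pos hx).symm, fun a => dif_pos hx⟩
      have e' : ∀ a, unitApp f F V.unop ≫ appMap (s a) ((Opens.map f).obj V.unop) =
          F.presheaf.germ V.unop (f x) hx ≫ (stalkToPullback f F x ≫ a) ≫ ε := by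
        intro a
        rw [e, ← Category.assoc, ← germ_stalkToPullback f F x V.unop hx hx]
        simp only [Category.assoc]
      rw [e', e', h]
    · obtain ⟨ζ, e⟩ : ∃ ζ, ∀ a, appMap (s a) ((Opens.map f).obj V.unop) = ζ :=
        ⟨_, fun a => dif_neg hx⟩
      rw [e, e]
  have h3 : ∀ a : ((pullback A f).obj F).presheaf.stalk x ⟶ M,
      StalkSkyscraperPresheafAdjunctionAuxs.fromStalk x (s a).1 = a :=
    fun a => StalkSkyscraperPresheafAdjunctionAuxs.fromStalk_to_skyscraper x a
  rw [← h3 a, ← h3 b, key]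

lemma stalkToPullback_naturality {F G : Y.Sheaf A} (α : F ⟶ G) (x : X) :
    stalkMap α (f x) ≫ stalkToPullback f G x =
      stalkToPullback f F x ≫ stalkMap ((pullback A f).map α) x := by
  refine F.presheaf.stalk_hom_ext fun V hV => ?_
  have hV' : x ∈ (Opens.map f).obj V := hV
  have h1 : appMap α V ≫ unitApp f G V = unitApp f F V ≫
      appMap ((pullback A f).map α) ((Opens.map f).obj V) :=
    congrArg (fun β => β.1.app (op V)) ((pullbackPushforwardAdjunction A f).unit.naturality α)
  rw [← Category.assoc, germ_stalkMap, Category.assoc, germ_stalkToPullback f G x V hV hV',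
    ← Category.assoc, h1, ← Category.assoc, germ_stalkToPullback f F x V hV hV', Category.assoc,
    Category.assoc, germ_stalkMap]

lemma stalkMap_stalkToPullback {F G : Y.Sheaf A} {F' G' : X.Sheaf A} {α : F ⟶ G} {β : F' ⟶ G'}
    {j : (pullback A f).obj F ⟶ F'} {k : (pullback A f).obj G ⟶ G'}
    (h : (pullback A f).map α ≫ k = j ≫ β) (x : X) :
    stalkMap α (f x) ≫ stalkToPullback f G x ≫ stalkMap k x =
      (stalkToPullback f F x ≫ stalkMap j x) ≫ stalkMap β x := by
  rw [← Category.assoc, stalkToPullback_naturality, Category.assoc, ← stalkMap_comp, h,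
    stalkMap_comp, Category.assoc]

lemma germ_stalkToPullback_stalkMap {F : Y.Sheaf A} {G : X.Sheaf A} (α : (pullback A f).obj F ⟶ G)
    {β : F ⟶ (pushforward A f).obj G}
    (h : β = (pullbackPushforwardAdjunction A f).homEquiv F G α) {x : X} {V : Opens Y}
    (hV : f x ∈ V) (hV' : x ∈ (Opens.map f).obj V) :
    F.presheaf.germ V (f x) hV ≫ stalkToPullback f F x ≫ stalkMap α x =
      (show F.presheaf.obj (op V) ⟶ G.presheaf.obj (op ((Opens.map f).obj V)) from
        β.1.app (op V)) ≫ G.presheaf.germ ((Opens.map f).obj V) x hV' := by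
  rw [Adjunction.homEquiv_unit] at h
  have h1 : (show F.presheaf.obj (op V) ⟶ G.presheaf.obj (op ((Opens.map f).obj V)) from
        β.1.app (op V)) = unitApp f F V ≫ appMap α ((Opens.map f).obj V) :=
    congrArg (fun β => β.1.app (op V)) h
  rw [h1, ← Category.assoc, germ_stalkToPullback f F x V hV hV', Category.assoc, germ_stalkMap,
    Category.assoc]

end TopCat.Sheaf

/-- A morphism of short complexes of modules is a quasi-isomorphism if it satisfies the elementwise
criterion. -/
lemma CategoryTheory.ShortComplex.quasiIso_of_elements {R : Type u} [CommRing R]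
    {S T : ShortComplex (ModuleCat.{u} R)} (f : S ⟶ T)
    (hs : ∀ z : T.X₂, T.g z = 0 → ∃ (k : S.X₂) (w : T.X₁), S.g k = 0 ∧ z = f.τ₂ k + T.f w)
    (hi : ∀ (k : S.X₂) (w : T.X₁), f.τ₂ k = T.f w → ∃ w' : S.X₁, k = S.f w') :
    ShortComplex.QuasiIso f := by
  have hι : Function.Injective T.homologyι := (ModuleCat.mono_iff_injective _).mp inferInstance
  have hιS : Function.Injective S.homologyι := (ModuleCat.mono_iff_injective _).mp inferInstance
  have hπ : Function.Surjective T.homologyπ := (ModuleCat.epi_iff_surjective _).mp inferInstance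
  have hπS : Function.Surjective S.homologyπ := (ModuleCat.epi_iff_surjective _).mp inferInstance
  -- Homology embeds into the opcycles, where a class vanishes exactly if its representative is a
  -- boundary; so elements are compared there.
  have e1 : ∀ c : S.cycles, T.homologyι (ShortComplex.homologyMap f (S.homologyπ c)) =
      T.pOpcycles (f.τ₂ (S.iCycles c)) := by
    intro c
    have : S.homologyπ ≫ ShortComplex.homologyMap f ≫ T.homologyι = S.iCycles ≫ f.τ₂ ≫ T.pOpcycles := by
      simp
    exact congrArg (fun g => g.hom c) this
  have e2 : ∀ (U : ShortComplex (ModuleCat.{u} R)) (c : U.cycles),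
      U.homologyι (U.homologyπ c) = U.pOpcycles (U.iCycles c) :=
    fun U c => congrArg (fun g => g.hom c) U.homology_π_ι
  rw [ShortComplex.quasiIso_iff]
  have hm : Mono (ShortComplex.homologyMap f) := by
    rw [ModuleCat.mono_iff_injective, injective_iff_map_eq_zero]
    intro h hh
    obtain ⟨c, rfl⟩ := hπS h
    have h1 := e1 c
    rw [hh, map_zero] at h1
    obtain ⟨w, hw⟩ := (T.moduleCat_pOpcycles_eq_zero_iff _).mp h1.symm
    obtain ⟨w', hw'⟩ := hi _ w hw.symm
    refine hιS ?_
    rw [e2, map_zero]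
    exact (S.moduleCat_pOpcycles_eq_zero_iff _).mpr ⟨w', hw'.symm⟩
  have he : Epi (ShortComplex.homologyMap f) := by
    rw [ModuleCat.epi_iff_surjective]
    intro h
    obtain ⟨c, rfl⟩ := hπ h
    obtain ⟨k, w, hk, hz⟩ := hs (T.iCycles c) (congrArg (fun g => g.hom c) T.iCycles_g)
    -- The element `k` is viewed as a morphism from `R`, to lift it to the cycles by their universal
    -- property.
    have hk' : ModuleCat.ofHom (LinearMap.toSpanSingleton R S.X₂ k) ≫ S.g = 0 := by
      ext; simpa using hk
    let c' := (S.liftCycles _ hk').hom 1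
    have hc' : S.iCycles c' = k := by
      exact (congrArg (fun g => g.hom 1) (S.liftCycles_i _ hk')).trans (one_smul R k)
    refine ⟨S.homologyπ c', hι ?_⟩
    rw [e1, e2, hc', hz, map_add]
    have h0 : T.pOpcycles (T.f w) = 0 := (T.moduleCat_pOpcycles_eq_zero_iff _).mpr ⟨w, rfl⟩
    rw [h0, add_zero]
  exact isIso_of_mono_of_epi _

namespace TopCat.Sheaf
variable {R : Type u} [CommRing R] {X : TopCat.{u}}

/-- Taking stalks is exact, so it commutes with homology, and isomorphisms of sheaves are detected
on stalks. -/
lemma quasiIso_of_stalks {S T : ShortComplex (X.Sheaf (ModuleCat.{u} R))} (f : S ⟶ T)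
    (h : ∀ x : X, ShortComplex.QuasiIso ((forget (ModuleCat.{u} R) X ⋙
      Presheaf.stalkFunctor (ModuleCat.{u} R) x).mapShortComplex.map f)) :
    ShortComplex.QuasiIso f := by
  rw [ShortComplex.quasiIso_iff, Presheaf.isIso_iff_stalkFunctor_map_iso]
  intro x
  have := h x
  rw [ShortComplex.quasiIso_iff] at this
  have e := ShortComplex.mapHomologyIso_hom_naturality f (forget (ModuleCat.{u} R) X ⋙
      Presheaf.stalkFunctor (ModuleCat.{u} R) x)
  have h2 : IsIso ((forget (ModuleCat.{u} R) X ⋙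
      Presheaf.stalkFunctor (ModuleCat.{u} R) x).map (ShortComplex.homologyMap f)) := by
    rw [(Iso.eq_inv_comp _).mpr e.symm]
    exact IsIso.comp_isIso' inferInstance (IsIso.comp_isIso' this inferInstance)
  exact h2

/-- A morphism of complexes of sheaves of modules is a quasi-isomorphism if it satisfies the
elementwise criterion on the stalks. -/
lemma quasiIso_of_stalkMap {K M : CochainComplex (X.Sheaf (ModuleCat.{u} R)) ℕ} (f : K ⟶ M)
    (hs : ∀ (i : ℕ) (x : X) (z : (M.X i).presheaf.stalk x), stalkMap (M.d i (i + 1)) x z = 0 →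
      ∃ (k : (K.X i).presheaf.stalk x) (w : (M.X ((ComplexShape.up ℕ).prev i)).presheaf.stalk x),
        stalkMap (K.d i (i + 1)) x k = 0 ∧
        z = stalkMap (f.f i) x k + stalkMap (M.d ((ComplexShape.up ℕ).prev i) i) x w)
    (hi : ∀ (i : ℕ) (x : X) (k : (K.X i).presheaf.stalk x)
      (w : (M.X ((ComplexShape.up ℕ).prev i)).presheaf.stalk x),
      stalkMap (f.f i) x k = stalkMap (M.d ((ComplexShape.up ℕ).prev i) i) x w →
        ∃ w' : (K.X ((ComplexShape.up ℕ).prev i)).presheaf.stalk x,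
          k = stalkMap (K.d ((ComplexShape.up ℕ).prev i) i) x w') :
    QuasiIso f := by
  refine ⟨fun i => ?_⟩
  rw [quasiIsoAt_iff]
  refine quasiIso_of_stalks _ fun x => ?_
  have hn : (ComplexShape.up ℕ).next i = i + 1 := CochainComplex.next ℕ i
  have hd : ∀ (N : CochainComplex (X.Sheaf (ModuleCat.{u} R)) ℕ) (b : ℕ), b = i + 1 →
      ∀ z : (N.X i).presheaf.stalk x, stalkMap (N.d i b) x z = 0 ↔
        stalkMap (N.d i (i + 1)) x z = 0 := by
    rintro N b rfl z
    rfl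
  refine ShortComplex.quasiIso_of_elements _ ?_ ?_
  · intro z hz
    obtain ⟨k, w, hk, h⟩ := hs i x z ((hd M _ hn z).mp hz)
    exact ⟨k, w, (hd K _ hn k).mpr hk, h⟩
  · exact fun k w h => hi i x k w h
end TopCat.Sheaf

end

/-! ### The natural inclusion as a morphism of complexes. -/

noncomputable section

namespace InvolutiveSubspace
open PhaseSpace AnalyticGerm TopCat.Sheaf

section
variable {𝕜 : Type u} [RCLike 𝕜] {n : ℕ} {D : Opens (PhaseSpace 𝕜 n)} (L : InvolutiveSubspace D)
  {p : ℕ}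

/-- The differential on sections. -/
def sectionDelta {V : Opens L.space} (ψ : L.sections p V) : L.sections (p + 1) V :=
  ⟨fun x => LieRinehartAlgebra.delta 𝕜 p (ψ.1 x), IsSection.delta ψ.2⟩

/-- The germ at `x` of a section of the sheaf of cochains. -/
def sectionGerm {V : Opens L.space} (ψ : L.sections p V) (x : L.space) (hx : x ∈ V) :
    (L.complex.X p).presheaf.stalk x :=
  (L.complex.X p).presheaf.germ V x hx ψ

variable {L}

lemma exists_sectionGerm {x : L.space} (z : (L.complex.X p).presheaf.stalk x) :
    ∃ (V : Opens L.space) (hx : x ∈ V) (ψ : L.sections p V), L.sectionGerm ψ x hx = z :=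
  TopCat.Presheaf.exists_germ_eq _ z

lemma sectionGerm_eq_iff {V W : Opens L.space} {ψ : L.sections p V} {χ : L.sections p W}
    {x : L.space} {hx : x ∈ V} {hx' : x ∈ W} :
    L.sectionGerm ψ x hx = L.sectionGerm χ x hx' ↔ ∃ (U : Opens L.space) (_ : x ∈ U) (hV : U ≤ V)
      (hW : U ≤ W), ∀ z : U, ψ.1 ⟨z.1, hV z.2⟩ = χ.1 ⟨z.1, hW z.2⟩ := by
  constructor
  · intro h
    obtain ⟨U, hU, i, j, e⟩ := TopCat.Presheaf.germ_eq (L.complex.X p).presheaf x hx hx' _ _ h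
    exact ⟨U, hU, i.le, j.le, fun z => congrFun (congrArg Subtype.val e) z⟩
  · rintro ⟨U, hU, hV, hW, e⟩
    exact TopCat.Presheaf.germ_ext (L.complex.X p).presheaf U hU (homOfLE hV) (homOfLE hW)
      (Subtype.ext (funext e))

lemma sectionGerm_add {V : Opens L.space} (ψ χ : L.sections p V) (x : L.space) (hx : x ∈ V) :
    L.sectionGerm (ψ + χ) x hx = L.sectionGerm ψ x hx + L.sectionGerm χ x hx :=
  map_add ((L.complex.X p).presheaf.germ V x hx).hom ψ χ

lemma stalkMap_d_sectionGerm {V : Opens L.space} (ψ : L.sections p V) (x : L.space) (hx : x ∈ V) :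
    stalkMap (L.complex.d p (p + 1)) x (L.sectionGerm ψ x hx) =
      L.sectionGerm (L.sectionDelta ψ) x hx := by
  have e : L.complex.d p (p + 1) = L.differential p := CochainComplex.of_d _ _ _
  rw [e]
  exact congrArg (fun g => g.hom ψ) (germ_stalkMap (L.differential p) V x hx)

end

variable {𝕜 : Type u} [RCLike 𝕜] {m : ℕ} {D : Opens (PhaseSpace 𝕜 (m + 1))}
  {D' : Opens (PhaseSpace 𝕜 m)} {L : InvolutiveSubspace D} {L' : InvolutiveSubspace D'}
  {Φ Ψ : PhaseSpace 𝕜 (m + 1) → PhaseSpace 𝕜 (m + 1)} (C : L.IsChart L' Φ Ψ) {p : ℕ}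

namespace IsChart

lemma IsPullback.add {x : L.support} {y : L'.support} {t : 𝕜} {h : Over D Φ x.1 y.1 t}
    {φ φ' : L'.Cochain p y} {ψ ψ' : L.Cochain p x} (h1 : C.IsPullback h φ ψ)
    (h2 : C.IsPullback h φ' ψ') : C.IsPullback h (φ + φ') (ψ + ψ') where
  horizontal v i hv := by
    rw [AlternatingMap.add_apply, h1.horizontal v i hv, h2.horizontal v i hv, add_zero]
  apply v := by
    rw [AlternatingMap.add_apply, AlternatingMap.add_apply, h1.apply, h2.apply, map_add]

lemma IsPullback.smul {x : L.support} {y : L'.support} {t : 𝕜} {h : Over D Φ x.1 y.1 t}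
    {φ : L'.Cochain p y} {ψ : L.Cochain p x} (c : 𝕜) (h1 : C.IsPullback h φ ψ) :
    C.IsPullback h (c • φ) (c • ψ) where
  horizontal v i hv := by
    rw [AlternatingMap.smul_apply, h1.horizontal v i hv, smul_zero]
  apply v := by
    rw [AlternatingMap.smul_apply, AlternatingMap.smul_apply, h1.apply, map_smul]

lemma eq_pullbackSection {V : Opens L'.space} {φ : L'.sections p V}
    {ψ : L.sections p ((Opens.map C.piMap).obj V)}
    (h : ∀ z, C.IsPullback (C.over_piMap z.1) (φ.1 (C.base z)) (ψ.1 z)) :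
    C.pullbackSection φ = ψ :=
  Subtype.ext (funext fun z => IsPullback.unique C (C.isPullback_pullbackSection φ z) (h z))

/-- A pullback is unique, and by `IsPullback.delta` the differential of the pullback is a pullback
of the differential. -/
lemma pullbackSection_sectionDelta {V : Opens L'.space} (φ : L'.sections p V) :
    C.pullbackSection (L'.sectionDelta φ) = L.sectionDelta (C.pullbackSection φ) :=
  C.eq_pullbackSection fun z => (C.isPullback_pullbackSection φ z).delta C

/-- The morphism `C^p_{L'} → π_* C^p_L`. -/
def pullbackHom (p : ℕ) : L'.cochainSheaf p ⟶
    (TopCat.Sheaf.pushforward (ModuleCat.{u} 𝕜) C.piMap).obj (L.cochainSheaf p) :=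
  ⟨{ app := fun V => ModuleCat.ofHom
      (Y := L.sections p ((Opens.map C.piMap).obj V.unop))
      { toFun := fun φ : L'.sections p V.unop => C.pullbackSection φ
        map_add' := fun φ φ' => C.eq_pullbackSection fun z =>
          (C.isPullback_pullbackSection φ z).add C (C.isPullback_pullbackSection φ' z)
        map_smul' := fun c φ => C.eq_pullbackSection fun z =>
          (C.isPullback_pullbackSection φ z).smul C c }
     naturality := fun V W i => by
      ext φ
      exact C.eq_pullbackSection fun z => C.isPullback_pullbackSection φ ⟨z.1, i.unop.le z.2⟩ }⟩

lemma differential_pullbackHom (p : ℕ) :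
    L'.differential p ≫ C.pullbackHom (p + 1) = C.pullbackHom p ≫
      (TopCat.Sheaf.pushforward (ModuleCat.{u} 𝕜) C.piMap).map (L.differential p) := by
  apply CategoryTheory.Sheaf.hom_ext
  ext V φ
  exact C.pullbackSection_sectionDelta φ

/-- The natural inclusion `π⁻¹ C^•_{L'} → C^•_L`. -/
def inclusion : ((TopCat.Sheaf.pullback (ModuleCat.{u} 𝕜) C.piMap).mapHomologicalComplex _).obj
    L'.complex ⟶ L.complex where
  f p := ((TopCat.Sheaf.pullbackPushforwardAdjunction (ModuleCat.{u} 𝕜) C.piMap).homEquiv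
    (L'.cochainSheaf p) (L.cochainSheaf p)).symm (C.pullbackHom p)
  comm' := by
    rintro i k rfl
    have e : L.complex.d i (i + 1) = L.differential i := CochainComplex.of_d _ _ _
    have e' : L'.complex.d i (i + 1) = L'.differential i := CochainComplex.of_d _ _ _
    rw [Functor.mapHomologicalComplex_obj_d, e, e']
    have h := congrArg ((TopCat.Sheaf.pullbackPushforwardAdjunction (ModuleCat.{u} 𝕜)
      C.piMap).homEquiv _ _).symm (C.differential_pullbackHom i)
    rw [Adjunction.homEquiv_naturality_left_symm, Adjunction.homEquiv_naturality_right_symm] at h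
    exact h.symm

lemma homEquiv_inclusion (p : ℕ) : C.pullbackHom p =
    (TopCat.Sheaf.pullbackPushforwardAdjunction (ModuleCat.{u} 𝕜) C.piMap).homEquiv
      (L'.complex.X p) (L.complex.X p) (C.inclusion.f p) :=
  (Equiv.apply_symm_apply _ _).symm

/-- The inclusion on stalks. -/
def stalkInclusion (x : L.space) (p : ℕ) : (L'.complex.X p).presheaf.stalk (C.piMap x) ⟶
    (L.complex.X p).presheaf.stalk x :=
  stalkToPullback C.piMap (L'.complex.X p) x ≫ stalkMap (C.inclusion.f p) x

lemma stalkInclusion_sectionGerm {V : Opens L'.space} (φ : L'.sections p V) (x : L.space)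
    (hx : C.piMap x ∈ V) : C.stalkInclusion x p (L'.sectionGerm φ (C.piMap x) hx) =
      L.sectionGerm (C.pullbackSection φ) x hx :=
  congrArg (fun g => g.hom φ) (germ_stalkToPullback_stalkMap C.piMap (C.inclusion.f p)
    (C.homEquiv_inclusion p) hx hx)

lemma stalkInclusion_d (x : L.space) (p q : ℕ) :
    stalkMap (L'.complex.d p q) (C.piMap x) ≫ C.stalkInclusion x q =
      C.stalkInclusion x p ≫ stalkMap (L.complex.d p q) x :=
  stalkMap_stalkToPullback C.piMap (C.inclusion.comm p q).symm x

lemma isNaturalInclusion_inclusion : IsNaturalInclusion Φ C.piMap C.inclusion := by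
  intro p V φ ψ hψ x hx
  rw [← C.homEquiv_inclusion] at hψ
  have hψ' : ψ = C.pullbackSection φ := hψ
  subst hψ'
  have h := C.isPullback_pullbackSection φ ⟨x, hx⟩
  have hO := C.over_piMap x
  refine ⟨C.analyticAt _ x.2.1, C.analyticAt_proj_comp x.2.1, rfl, fun a b c hb hc => ?_,
    fun c ⟨i, hi⟩ => ?_⟩
  · have h1 := h.apply fun i => toConormal (a i)
    have h2 : c = fun i => C.pbI hO (a i) := funext fun i => Subtype.ext (hc i)
    subst h2
    simp only [C.pbCon_toConormal] at h1
    refine h1.trans ?_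
    exact congrArg (C.pbStalk hO) hb
  · exact h.horizontal _ i (congrArg _ (Subtype.ext hi))

end IsChart
end InvolutiveSubspace
end

/-! ### The homotopy argument on stalks. -/

noncomputable section

namespace TopCat.Sheaf

lemma stalkMap_zero {R : Type u} [CommRing R] {X : TopCat.{u}} (F G : X.Sheaf (ModuleCat.{u} R))
    (x : X) : stalkMap (0 : F ⟶ G) x = 0 := by
  refine F.presheaf.stalk_hom_ext fun V hV => ?_
  rw [germ_stalkMap, Limits.comp_zero]
  exact Limits.zero_comp

end TopCat.Sheaf

namespace LieRinehartAlgebra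
variable {R A M : Type*} [CommRing R] [CommRing A] [Algebra R A] [LieRing M] [Module A M]
  [LieRingModule M A] [LieRinehartRing A M] [LieAlgebra R M] [LieRinehartAlgebra R A M]

lemma lieDeriv_eq_zero_of_curryLeft_delta {p : ℕ} {φ : M [⋀^Fin (p + 1)]→ₗ[A] A} {x : M}
    (h : φ.curryLeft x = 0) (hδ : (delta R (p + 1) φ).curryLeft x = 0) : lieDeriv x φ = 0 := by
  have := curryLeft_delta (R := R) φ x
  rw [hδ, h, map_zero, sub_zero] at this
  exact neg_eq_zero.mp this.symm

lemma curryLeft_delta_sub {p : ℕ} {φ : M [⋀^Fin (p + 1)]→ₗ[A] A} (κ : M [⋀^Fin p]→ₗ[A] A) {x : M}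
    (hδ : (delta R (p + 1) φ).curryLeft x = 0) :
    (delta R (p + 1) (φ - delta R p κ)).curryLeft x = 0 := by
  rw [map_sub, delta_delta, sub_zero, hδ]

end LieRinehartAlgebra

namespace InvolutiveSubspace
open PhaseSpace AnalyticGerm TopCat.Sheaf

variable {𝕜 : Type u} [RCLike 𝕜] {m : ℕ} {D : Opens (PhaseSpace 𝕜 (m + 1))}
  {D' : Opens (PhaseSpace 𝕜 m)} {L : InvolutiveSubspace D} {L' : InvolutiveSubspace D'}
  {Φ Ψ : PhaseSpace 𝕜 (m + 1) → PhaseSpace 𝕜 (m + 1)} (C : L.IsChart L' Φ Ψ) {p : ℕ}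

namespace IsChart

/-- If `δ χ` is horizontal then `χ` is, up to an exact form, a pullback. -/
lemma exists_eq_pullback_add_delta {V : Opens L.space} {χ : ∀ z : V, L.Cochain (p + 1) z.1}
    (hχ : IsSection χ)
    (hδ : ∀ z, C.IsHorizontalCochain (LieRinehartAlgebra.delta 𝕜 (p + 1) (χ z))) (x : V) :
    ∃ (V₁ : Opens L.space) (_ : x.1 ∈ V₁) (hV : V₁ ≤ V) (U' : Opens L'.space)
      (hU : V₁ ≤ (Opens.map C.piMap).obj U') (φ : L'.sections (p + 1) U') (κ : L.sections p V₁),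
      ∀ z : V₁, χ ⟨z.1, hV z.2⟩ = (C.pullbackSection φ).1 ⟨z.1, hU z.2⟩ +
        LieRinehartAlgebra.delta 𝕜 p (κ.1 z) := by
  -- `κ` solves `𝓛_u κ = -i_u χ`. The right-hand side is horizontal because `χ` is alternating, so
  -- `i_u i_u χ = 0`.
  obtain ⟨V₁, hx, hV, κ, hκ, hκ'⟩ := C.exists_primitive
    (isSection_neg (C.isSection_curryLeft hχ)) (fun z => by
      cases p with
      | zero => exact fun v i => i.elim0
      | succ p =>
        rw [isHorizontalCochain_iff]
        ext v
        simp only [AlternatingMap.curryLeft_apply_apply, AlternatingMap.neg_apply,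
          AlternatingMap.zero_apply, neg_eq_zero]
        exact (χ z).map_eq_zero_of_eq _ (i := 0) (j := 1) rfl (by simp)) x
  have hκs : IsSection κ.1 := κ.2
  -- Cartan's formula with `i_u κ = 0`: `i_u δκ = -𝓛_u κ = i_u χ`.
  have h1 : ∀ z : V₁, (LieRinehartAlgebra.delta 𝕜 p (κ.1 z)).curryLeft (C.conP z.1) =
      (χ ⟨z.1, hV z.2⟩).curryLeft (C.conP z.1) := by
    intro z
    cases p with
    | zero => rw [LieRinehartAlgebra.curryLeft_delta_zero, hκ', neg_neg]
    | succ p =>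
      rw [LieRinehartAlgebra.curryLeft_delta, hκ', C.isHorizontalCochain_iff.mp (hκ z), map_zero,
        neg_neg, sub_zero]
  have hψ := isSection_sub (IsSection.restrict hV hχ) hκs.delta
  have h2 : ∀ z : V₁, (χ ⟨z.1, hV z.2⟩ - LieRinehartAlgebra.delta 𝕜 p (κ.1 z)).curryLeft
      (C.conP z.1) = 0 := by
    intro z
    exact sub_eq_zero.mpr (h1 z).symm
  obtain ⟨V₂, hx₂, hV₂, U', hU, φ, hφ⟩ := C.exists_descent hψ
    (fun z => C.isHorizontalCochain_iff.mpr (h2 z)) (fun z =>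
      LieRinehartAlgebra.lieDeriv_eq_zero_of_curryLeft_delta (R := 𝕜) (h2 z)
        (LieRinehartAlgebra.curryLeft_delta_sub _
          (C.isHorizontalCochain_iff.mp (hδ ⟨z.1, hV z.2⟩)))) ⟨x.1, hx⟩
  refine ⟨V₂, hx₂, hV₂.trans hV, U', hU, φ,
    ⟨fun z => κ.1 ⟨z.1, hV₂ z.2⟩, IsSection.restrict hV₂ hκs⟩, fun z => ?_⟩
  rw [← hφ z]
  exact (sub_add_cancel _ _).symm

/-- Sections with the same pullback near `x` agree at all images of points near `x`, and these
images fill a neighbourhood of `π(x)`. -/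
lemma stalkInclusion_injective (x : L.space) (p : ℕ) :
    Function.Injective (C.stalkInclusion x p) := by
  intro a b h
  obtain ⟨V, hV, φ, rfl⟩ := exists_sectionGerm a
  obtain ⟨W, hW, φ', rfl⟩ := exists_sectionGerm b
  obtain ⟨U, hxU, h1, h2, e⟩ := sectionGerm_eq_iff.mp
    ((C.stalkInclusion_sectionGerm φ x hV).symm.trans
      (h.trans (C.stalkInclusion_sectionGerm φ' x hW)))
  have hV₁ : (Opens.map C.piMap).obj (V ⊓ W) ≤ (Opens.map C.piMap).obj V := fun _ hy => hy.1
  have hW₁ : (Opens.map C.piMap).obj (V ⊓ W) ≤ (Opens.map C.piMap).obj W := fun _ hy => hy.2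
  have hU : U ≤ (Opens.map C.piMap).obj (V ⊓ W) := fun z hz => ⟨h1 hz, h2 hz⟩
  have r1 := fun z : (Opens.map C.piMap).obj (V ⊓ W) =>
    congrFun (congrArg Subtype.val (C.eq_pullbackSection (V := V ⊓ W)
      (φ := ⟨fun y => φ.1 ⟨y.1, y.2.1⟩, IsSection.restrict inf_le_left φ.2⟩)
      (ψ := ⟨fun y => (C.pullbackSection φ).1 ⟨y.1, y.2.1⟩,
        IsSection.restrict hV₁
          (C.pullbackSection φ).2⟩)
      fun y => C.isPullback_pullbackSection φ ⟨y.1, y.2.1⟩)) z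
  have r2 := fun z : (Opens.map C.piMap).obj (V ⊓ W) =>
    congrFun (congrArg Subtype.val (C.eq_pullbackSection (V := V ⊓ W)
      (φ := ⟨fun y => φ'.1 ⟨y.1, y.2.2⟩, IsSection.restrict inf_le_right φ'.2⟩)
      (ψ := ⟨fun y => (C.pullbackSection φ').1 ⟨y.1, y.2.2⟩,
        IsSection.restrict hW₁
          (C.pullbackSection φ').2⟩)
      fun y => C.isPullback_pullbackSection φ' ⟨y.1, y.2.2⟩)) z
  obtain ⟨U₁, hxU₁, hU₁, e₁⟩ := C.exists_eq_of_pullbackSection_eq (V := U) ⟨x, hxU⟩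
    hU fun z => (r1 ⟨z.1, _⟩).trans ((e z).trans (r2 ⟨z.1, _⟩).symm)
  exact sectionGerm_eq_iff.mpr ⟨U₁, hxU₁, fun y hy => (hU₁ hy).1, fun y hy => (hU₁ hy).2, e₁⟩

/-- A germ whose differential is a pullback is, up to an exact one, a pullback. -/
lemma exists_eq_stalkInclusion_add (x : L.space) (p : ℕ) (z : (L.complex.X p).presheaf.stalk x)
    {k : (L'.complex.X (p + 1)).presheaf.stalk (C.piMap x)}
    (hz : stalkMap (L.complex.d p (p + 1)) x z = C.stalkInclusion x (p + 1) k) :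
    ∃ (k₀ : (L'.complex.X p).presheaf.stalk (C.piMap x))
      (w : (L.complex.X ((ComplexShape.up ℕ).prev p)).presheaf.stalk x),
      z = C.stalkInclusion x p k₀ + stalkMap (L.complex.d ((ComplexShape.up ℕ).prev p) p) x w := by
  obtain ⟨V, hV, χ, rfl⟩ := exists_sectionGerm z
  obtain ⟨W, hW, φ, rfl⟩ := exists_sectionGerm k
  obtain ⟨U, hxU, h1, h2, e⟩ := sectionGerm_eq_iff.mp
    ((stalkMap_d_sectionGerm χ x hV).symm.trans
      (hz.trans (C.stalkInclusion_sectionGerm φ x hW)))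
  have hχ : IsSection fun z : U => χ.1 ⟨z.1, h1 z.2⟩ := IsSection.restrict h1 χ.2
  have hδ : ∀ z : U, C.IsHorizontalCochain
      (LieRinehartAlgebra.delta 𝕜 p (χ.1 ⟨z.1, h1 z.2⟩)) := by
    intro z
    have := (C.isPullback_pullbackSection φ ⟨z.1, h2 z.2⟩).horizontal
    rw [← e z] at this
    exact this
  cases p with
  | zero =>
    -- In degree `0` no correction is needed: a function with horizontal differential is constant
    -- along the lines. So the exact part is zero.
    obtain ⟨V₁, hx, hV₁, U', hU, φ', hφ'⟩ := C.exists_descent hχ (fun z v i => i.elim0)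
      (fun z => by
        have h3 := LieRinehartAlgebra.curryLeft_delta_zero (R := 𝕜) (χ.1 ⟨z.1, h1 z.2⟩) (C.conP z.1)
        rw [C.isHorizontalCochain_iff.mp (hδ z)] at h3
        exact neg_eq_zero.mp h3.symm) ⟨x, hxU⟩
    refine ⟨L'.sectionGerm φ' _ (hU hx), 0, ?_⟩
    rw [map_zero, add_zero]
    exact (sectionGerm_eq_iff.mpr ⟨V₁, hx, hV₁.trans h1, hU, hφ'⟩).trans
      (C.stalkInclusion_sectionGerm φ' x (hU hx)).symm
  | succ q =>
    have hprev : (ComplexShape.up ℕ).prev (q + 1) = q := by simp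
    -- `prev (q + 1)` equals `q` only propositionally; generalizing the index avoids a transport
    -- between stalks.
    suffices H : ∀ r, r = q → ∃ (k₀ : (L'.complex.X (q + 1)).presheaf.stalk (C.piMap x))
        (w : (L.complex.X r).presheaf.stalk x), L.sectionGerm χ x hV =
          C.stalkInclusion x (q + 1) k₀ + stalkMap (L.complex.d r (q + 1)) x w from H _ hprev
    rintro _ rfl
    obtain ⟨V₁, hx, hV₁, U', hU, φ', κ, h⟩ := C.exists_eq_pullback_add_delta hχ hδ ⟨x, hxU⟩
    refine ⟨L'.sectionGerm φ' _ (hU hx), L.sectionGerm κ x hx, ?_⟩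
    have e3 : L.sectionGerm (C.pullbackSection φ') x (hU hx) =
        L.sectionGerm (V := V₁) 
          ⟨fun z => (C.pullbackSection φ').1 ⟨z.1, hU z.2⟩,
            IsSection.restrict hU (C.pullbackSection φ').2⟩ x hx :=
      sectionGerm_eq_iff.mpr ⟨V₁, hx, hU, le_rfl, fun _ => rfl⟩
    refine Eq.trans ?_ (congrArg₂ (· + ·) (C.stalkInclusion_sectionGerm φ' x (hU hx))
      (stalkMap_d_sectionGerm κ x hx)).symm
    refine Eq.trans ?_ (congrArg (· + _) e3).symm
    refine Eq.trans ?_ (sectionGerm_add _ _ x hx)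
    exact sectionGerm_eq_iff.mpr ⟨V₁, hx, hV₁.trans h1, le_rfl, h⟩

lemma stalkToPullback_surjective (F : L'.space.Sheaf (ModuleCat.{u} 𝕜)) (x : L.space) :
    Function.Surjective (stalkToPullback C.piMap F x) :=
  (ModuleCat.epi_iff_surjective _).mp inferInstance

/-- Both halves of the criterion come from `exists_eq_stalkInclusion_add`. Computations take place
in the stalks of `C^•_{L'}` at `π(x)`. Surjectivity of `stalkToPullback` lifts elements to them, and
injectivity of the composite `stalkInclusion` transfers equations back. -/
lemma quasiIso_inclusion : QuasiIso C.inclusion := by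
  have hd : ∀ (x : L.space) (p q : ℕ) (k : (L'.complex.X p).presheaf.stalk (C.piMap x)),
      C.stalkInclusion x q (stalkMap (L'.complex.d p q) (C.piMap x) k) =
        stalkMap (L.complex.d p q) x (C.stalkInclusion x p k) := fun x p q k =>
    congrArg (fun g => g.hom k) (C.stalkInclusion_d x p q)
  have hθ : ∀ (x : L.space) (p q : ℕ) (k : (L'.complex.X p).presheaf.stalk (C.piMap x)),
      stalkToPullback C.piMap (L'.complex.X q) x (stalkMap (L'.complex.d p q) (C.piMap x) k) =
        stalkMap ((TopCat.Sheaf.pullback (ModuleCat.{u} 𝕜) C.piMap).map (L'.complex.d p q)) x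
          (stalkToPullback C.piMap (L'.complex.X p) x k) := fun x p q k =>
    congrArg (fun g => g.hom k) (stalkToPullback_naturality C.piMap (L'.complex.d p q) x)
  have hdd : ∀ (x : L.space) (p q r : ℕ) (k : (L.complex.X p).presheaf.stalk x),
      stalkMap (L.complex.d q r) x (stalkMap (L.complex.d p q) x k) = 0 := by
    intro x p q r k
    have h := congrArg (fun g => g.hom k) (stalkMap_comp (L.complex.d p q) (L.complex.d q r) x)
    rw [L.complex.d_comp_d, stalkMap_zero] at h
    exact h.symm
  refine quasiIso_of_stalkMap C.inclusion ?_ ?_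
  · intro i x z hz
    -- A cocycle is a cochain whose differential is the pullback of `0`.
    obtain ⟨k₀, w, rfl⟩ := C.exists_eq_stalkInclusion_add x i z (k := 0) (by rw [hz, map_zero])
    refine ⟨stalkToPullback C.piMap (L'.complex.X i) x k₀, w, ?_, rfl⟩
    rw [map_add, hdd, add_zero, ← hd] at hz
    have h0 := C.stalkInclusion_injective x (i + 1) (hz.trans (map_zero _).symm)
    have h1 := hθ x i (i + 1) k₀
    rw [h0, map_zero] at h1
    exact h1.symm
  · intro i x k w h
    obtain ⟨k, rfl⟩ := C.stalkToPullback_surjective (L'.complex.X i) x k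
    have h' : C.stalkInclusion x i k = stalkMap (L.complex.d ((ComplexShape.up ℕ).prev i) i) x w := h
    suffices H : ∃ k₁, k = stalkMap (L'.complex.d ((ComplexShape.up ℕ).prev i) i) (C.piMap x) k₁ by
      obtain ⟨k₁, rfl⟩ := H
      exact ⟨_, hθ x _ i k₁⟩
    cases i with
    | zero =>
      refine ⟨0, ?_⟩
      refine C.stalkInclusion_injective x 0 ?_
      have e : L.complex.d ((ComplexShape.up ℕ).prev 0) 0 = 0 := L.complex.shape _ _ (by simp)
      rw [e, stalkMap_zero] at h'
      rw [map_zero, map_zero]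
      exact h'
    | succ q =>
      have hprev : (ComplexShape.up ℕ).prev (q + 1) = q := by simp
      suffices H : ∀ r, r = q → ∀ w : (L.complex.X r).presheaf.stalk x,
          C.stalkInclusion x (q + 1) k = stalkMap (L.complex.d r (q + 1)) x w →
          ∃ k₁, k = stalkMap (L'.complex.d r (q + 1)) (C.piMap x) k₁ from H _ hprev w h'
      intro r hr w₂ h₂
      subst hr
      -- The cochain `w₂` bounds a pullback, so modulo exact terms it is itself a pullback, of some
      -- `k₁`; then `k₁` bounds `k`.
      obtain ⟨k₁, w₁, rfl⟩ := C.exists_eq_stalkInclusion_add x r w₂ h₂.symm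
      refine ⟨k₁, C.stalkInclusion_injective x _ ?_⟩
      rw [h₂, map_add, hdd, add_zero, hd]

end IsChart
end InvolutiveSubspace
end

/-! ### Exactness of the inverse image and the conclusion. -/

noncomputable section

namespace TopCat.Sheaf
variable {R : Type u} [CommRing R] {X Y : TopCat.{u}} (f : X ⟶ Y)

-- The inverse image is the left Kan extension along `Opens.map f` followed by sheafification. The
-- first is left exact because `Opens.map f` is flat, the second is left exact anyway.
attribute [local instance] Limits.reflectsLimits_of_reflectsIsomorphisms in
lemma preservesFiniteLimits_pullback :
    Limits.PreservesFiniteLimits (pullback (ModuleCat.{u} R) f) := by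
  have : Limits.PreservesFiniteLimits ((Opens.map f).op.lan : (_ ⥤ _ ⥤ ModuleCat.{u} R)) :=
    lan_preservesFiniteLimits_of_flat _ (Opens.map f)
  exact Functor.sheafPullbackConstruction.preservesFiniteLimits _ _ _ _

lemma preservesFiniteColimits_pullback :
    Limits.PreservesFiniteColimits (pullback (ModuleCat.{u} R) f) := by
  have := (pullbackPushforwardAdjunction (ModuleCat.{u} R) f).leftAdjoint_preservesColimits
  infer_instance

/-- The inverse image of sheaves of modules commutes with homology. -/
def pullbackHomologyIso (K : CochainComplex (Y.Sheaf (ModuleCat.{u} R)) ℕ) (i : ℕ) :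
    (pullback (ModuleCat.{u} R) f).obj (K.homology i) ≅
      (((pullback (ModuleCat.{u} R) f).mapHomologicalComplex _).obj K).homology i :=
  have := preservesFiniteLimits_pullback (R := R) f
  have := preservesFiniteColimits_pullback (R := R) f
  ((K.sc i).mapHomologyIso (pullback (ModuleCat.{u} R) f)).symm

end TopCat.Sheaf

end

theorem mainTheorem3 {𝕜 : Type u} [RCLike 𝕜] {m : ℕ}
    {D : Opens (PhaseSpace 𝕜 (m + 1))} {D' : Opens (PhaseSpace 𝕜 m)}
    (L : InvolutiveSubspace D) (L' : InvolutiveSubspace D')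
    (hL : L.IsLagrangianAtZero) (hL' : L'.IsLagrangianAtZero)
    (Φ : PhaseSpace 𝕜 (m + 1) → PhaseSpace 𝕜 (m + 1)) (hΦ : L.IsDecomposition L' Φ) :
    ∃ W₀ : Opens (PhaseSpace 𝕜 (m + 1)), 0 ∈ W₀ ∧ W₀ ≤ D ∧
      ∀ (W : Opens (PhaseSpace 𝕜 (m + 1))) (hW : W ≤ D), W ≤ W₀ →
        ∃ π : (L.restrict W hW).space ⟶ L'.space,
          (∀ x : (L.restrict W hW).support, (π x).1 = PhaseSpace.proj (Φ x.1)) ∧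
          ∃ j : ((TopCat.Sheaf.pullback (ModuleCat.{u} 𝕜) π).mapHomologicalComplex _).obj
              L'.complex ⟶ (L.restrict W hW).complex,
            InvolutiveSubspace.IsNaturalInclusion Φ π j ∧
            QuasiIso j ∧
            ∀ i : ℕ, Nonempty ((TopCat.Sheaf.pullback (ModuleCat.{u} 𝕜) π).obj
              (L'.complex.homology i) ≅ (L.restrict W hW).complex.homology i) := by
  obtain ⟨Ψ, W₀, h0, hWD, H⟩ := InvolutiveSubspace.exists_isChart hL hL' hΦ
  refine ⟨W₀, h0, hWD, fun W hW hWW₀ => ?_⟩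
  have C := H W hW hWW₀
  have hC := C.quasiIso_inclusion
  exact ⟨C.piMap, fun _ => rfl, C.inclusion, C.isNaturalInclusion_inclusion, hC, fun i =>
    ⟨TopCat.Sheaf.pullbackHomologyIso C.piMap L'.complex i ≪≫ isoOfQuasiIsoAt C.inclusion i⟩⟩
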